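/- **Setting.** A marriage instance $T$ consists of two disjoint finite sets of agents $X,Y$ and, for every agent $z$, a strictly ordered preference list of agents of the other side, such that $y$ is on $x$'s list iff $x$ is on $y$'s list; then $xy$ is called an edge of $T$ (written $xy\in T$). We write $a>_z b$ if $z$ strictly prefers $a$ to $b$ (both being on $z$'s list), and every agent prefers each agent on its list to being unmatched ($\emptyset$). $T'\subseteq T$ means that $T'$ is obtained from $T$ by deleting edges; if $E$ is a set of edges of $T$, $T'\cup E$ is the subtable of $T$ whose edges are those of $T'$ and of $E$. A matching $M$ of $T$ is a set of pairwise disjoint edges of $T$, and $M(z)$ is the partner of $z$. It is stable if no $xy\in T$ has $y>_xM(x)$ and $x>_yM(y)$. $T$ is a stable table if each of its edges lies in some stable matching of $T$. $M^T_X$ is the stable matching of $T$ that all $X$-agents weakly prefer to every stable matching of $T$. A cyclic sequence $\rho=(x_0,y_0),\dots,(x_{r-1},y_{r-1})$ of $r\ge 1$ distinct pairs (indices modulo $r$, sequences identified up to a shift) is an $X$-rotation of $T$ exposed in the stable matching $M$ of $T$ if for all $i$: $x_iy_i\in M$; $x_i>_{y_{i+1}}x_{i+1}$; $y_i>_{x_i}y_{i+1}$;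 and $M(y)>_y x_i$ for all $y$ with $x_iy\in T$ and $y_i>_{x_i}y>_{x_i}y_{i+1}$. $R_X(T)$ is the set of all $X$-rotations exposed in some stable matching of $T$. $M/\rho$ is the matching with $(M/\rho)(x_i)=y_{i+1}$ for all $i$ and $(M/\rho)(x)=M(x)$ for the other $x\in X$. For a finite set $R\subseteq R_X(T)$, $M/R=((M/\rho_1)/\rho_2)\cdots/\rho_k$ for an ordering $\rho_1,\dots,\rho_k$ of $R$ in which each $\rho_i$ is exposed (in $T$) in the matching from which it is eliminated. $E(\rho)=\{x_iy_i\}_i\cup\{x_iy_{i+1}\}_i$ and $E(R)=\bigcup_{\rho\in R}E(\rho)$. For $\rho\in R_X(T)$, $R(\rho)$ is the set of all $\rho'\in R_X(T)$, $\rho'\ne\rho$, that are eliminated before $\rho$ in every sequence of successive eliminations of exposed rotations that starts from $M_X^T$ and contains both. **Problem $\mathrm{DR}(T,T',\rho)$.** Given marriage instances $T'\subseteq T$ with $T'$ a stable table, and $\rho\in R_X(T')$, let $M^0=M_X^{T'}/R(\rho)$, with $R(\rho)$ taken in $T'$. A dissecting set for $(T,T',\rho)$ is a finite set $R$ with $E(R)\subseteq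 T$, $R\subseteq R_X(T^*)\setminus R_X(T')$ where $T^*=T'\cup E(R)$, and $M^0/\rho=M^0/R$ (the elimination of $R$ taking place in $T^*$). Output a dissecting set if one exists, and $\{\rho\}$ otherwise. **Algorithm Dissect_Rotation$(T,T',\rho)$.** 1. Let $M^0=M_X^{T'}/R(\rho)$ and $M^*=M^0/\rho$. 2. Let $\widetilde T$ be the subtable of $T$ of all edges $xy$ with $M^0(x)\ge_x y\ge_x M^*(x)$ and $M^*(y)\ge_y x\ge_y M^0(y)$. 3. Let $D$ be the digraph on $X\cup Y$ with an arc $x\to y$ whenever $xy\in\widetilde T$, $x>_yM^0(y)$ and $M^0(x)>_xy$, and an arc $y\to x$ whenever $xy\in M^0$. A directed cycle $y_0\to x_0\to y_1\to x_1\to\dots\to y_{r-1}\to x_{r-1}\to y_0$ of $D$ corresponds to the sequence $(x_0,y_0),\dots,(x_{r-1},y_{r-1})$. 4. If $D$ has exactly one directed cycle, return $\{\rho\}$. 5. Otherwise choose a directed cycle of $D$ that corresponds to some $\rho_1\ne\rho$ and let $M^1=M^0/\rho_1$. Let $\rho_2,\dots,\rho_k$ be the sequences $(x_0,y_0),\dots,(x_{r-1},y_{r-1})$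 with $x_iy_i\in M^1$, $x_iy_{i+1}\in M^*$ given by the cycles of the graph with edge set $M^1\triangle M^*$. Return $\{\rho_1,\rho_2,\dots,\rho_k\}$. **Theorem.** Algorithm Dissect_Rotation correctly solves $\mathrm{DR}$: on every valid input $(T,T',\rho)$ it returns a set, and, whatever cycle it chooses in step 5, the returned set is a dissecting set for $(T,T',\rho)$ if one exists, and $\{\rho\}$ otherwise. Moreover, it can be implemented to run in time $O(n^2)$, where $n=|X|+|Y|$ is the number of agents: there are a fixed random access machine program (unit cost; the only arithmetic is successor and truncated subtraction) and a constant $c$ such that on every valid input, given by the preference lists of $T$ and $T'$ and the sequence $\rho$, the program halts after at most $c\,n^2$ steps with a possible output of the algorithm. -/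

import Mathlib

/-! ## Marriage instances -/

/-- A marriage instance with agent sets `X = {x_0, …, x_{p-1}}` and `Y = {y_0, …, y_{q-1}}`, given
by its preference table: every agent has a strict preference list (most preferred first) of agents
of the other side, and the table is symmetric. -/
structure Marriage (p q : ℕ) where
  xs : Fin p → List (Fin q)
  ys : Fin q → List (Fin p)
  xs_nodup : ∀ x, (xs x).Nodup
  ys_nodup : ∀ y, (ys y).Nodup
  symm : ∀ x y, y ∈ xs x ↔ x ∈ ys y

namespace Marriage

variable {p q : ℕ}

/-- The edges `xy ∈ T`. -/
def edges (T : Marriage p q) : Set (Fin p × Fin q) := {e | e.2 ∈ T.xs e.1}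

/-- `y >_x y'` in `T` (both `y` and `y'` are then on the list of `x`). -/
def XPref (T : Marriage p q) (x : Fin p) (y y' : Fin q) : Prop :=
  y' ∈ T.xs x ∧ (T.xs x).idxOf y < (T.xs x).idxOf y'

/-- `x >_y x'` in `T`. -/
def YPref (T : Marriage p q) (y : Fin q) (x x' : Fin p) : Prop :=
  x' ∈ T.ys y ∧ (T.ys y).idxOf x < (T.ys y).idxOf x'

/-- `T' ⊆ T`: every preference list of `T'` is obtained from that of `T` by deleting entries. -/
def Subtable (T' T : Marriage p q) : Prop :=
  (∀ x, (T'.xs x).Sublist (T.xs x)) ∧ (∀ y, (T'.ys y).Sublist (T.ys y))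

open Classical in
/-- The subtable of `T` consisting of the edges of `T` that lie in `E`. -/
noncomputable def restrict (T : Marriage p q) (E : Set (Fin p × Fin q)) : Marriage p q where
  xs x := (T.xs x).filter (fun y => decide ((x, y) ∈ E))
  ys y := (T.ys y).filter (fun x => decide ((x, y) ∈ E))
  xs_nodup x := (T.xs_nodup x).filter _
  ys_nodup y := (T.ys_nodup y).filter _
  symm x y := by simp [T.symm x y]

/-! ## Matchings and stability -/

/-- `M` is a matching of `T`. -/
def IsMatching (T : Marriage p q) (M : Set (Fin p × Fin q)) : Prop :=
  M ⊆ T.edges ∧ (∀ x y y', (x, y) ∈ M → (x, y') ∈ M → y = y') ∧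
    (∀ x x' y, (x, y) ∈ M → (x', y) ∈ M → x = x')

/-- The edge `xy ∈ T` blocks `M`: `y >_x M(x)` and `x >_y M(y)`, where every acceptable partner is
preferred to being unmatched. -/
def Blocks (T : Marriage p q) (M : Set (Fin p × Fin q)) (x : Fin p) (y : Fin q) : Prop :=
  (x, y) ∈ T.edges ∧ (∀ y', (x, y') ∈ M → T.XPref x y y') ∧ (∀ x', (x', y) ∈ M → T.YPref y x x')

/-- `M ∈ 𝒮(T)`. -/
def IsStable (T : Marriage p q) (M : Set (Fin p × Fin q)) : Prop :=
  T.IsMatching M ∧ ∀ x y, ¬ T.Blocks M x y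

/-- `T` is a stable table: each of its edges lies in a stable matching of `T`. -/
def StableTable (T : Marriage p q) : Prop :=
  ∀ e ∈ T.edges, ∃ M, T.IsStable M ∧ e ∈ M

/-- `M ⪯_X M'`: every `X`-agent weakly prefers `M'` to `M`. -/
def XLe (T : Marriage p q) (M M' : Set (Fin p × Fin q)) : Prop :=
  ∀ x y, (x, y) ∈ M → ∃ y', (x, y') ∈ M' ∧ (y' = y ∨ T.XPref x y' y)

/-- `M` is the `X`-optimal stable matching of `T`. -/
def IsXOptimal (T : Marriage p q) (M : Set (Fin p × Fin q)) : Prop :=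
  T.IsStable M ∧ ∀ M', T.IsStable M' → T.XLe M' M

end Marriage

/-! ## Rotations -/

/-- `b` comes right after `a` in the cyclic sequence `c`. -/
def Follows {α : Type*} (c : Cycle α) (a b : α) : Prop :=
  ∃ l : List α, c = ((a :: l : List α) : Cycle α) ∧ b = l.headD a

/-- A cyclic sequence of pairs `(x_0, y_0), …, (x_{r-1}, y_{r-1})`, up to a shift of the indices. -/
abbrev Rot (p q : ℕ) := Cycle (Fin p × Fin q)

namespace Rot

variable {p q : ℕ}

/-- The pairs `x_i y_i`. -/
def pairs (ρ : Rot p q) : Set (Fin p × Fin q) := {e | e ∈ ρ}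

/-- The pairs `x_i y_{i+1}`. -/
def shifted (ρ : Rot p q) : Set (Fin p × Fin q) := {e | ∃ a b, Follows ρ a b ∧ e = (a.1, b.2)}

/-- `E(ρ)`. -/
def E (ρ : Rot p q) : Set (Fin p × Fin q) := pairs ρ ∪ shifted ρ

/-- `M / ρ`: the agents `x_i` are matched to `y_{i+1}`, the other `X`-agents as in `M`. -/
def elim (M : Set (Fin p × Fin q)) (ρ : Rot p q) : Set (Fin p × Fin q) :=
  {e ∈ M | ∀ a ∈ ρ, a.1 ≠ e.1} ∪ shifted ρ

end Rot

namespace Marriage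

variable {p q : ℕ}

/-- `ρ` is a classical `X`-rotation exposed in the stable matching `M` of `T`. -/
def Exposed (T : Marriage p q) (M : Set (Fin p × Fin q)) (ρ : Rot p q) : Prop :=
  T.IsStable M ∧ ρ ≠ Cycle.nil ∧ ρ.Nodup ∧ (∀ a ∈ ρ, a ∈ M) ∧
    ∀ a b, Follows ρ a b →
      T.YPref b.2 a.1 b.1 ∧ T.XPref a.1 a.2 b.2 ∧
      ∀ y, T.XPref a.1 a.2 y → T.XPref a.1 y b.2 → ∃ x, (x, y) ∈ M ∧ T.YPref y x a.1

/-- `R_X(T)`: the `X`-rotations exposed in some stable matching of `T`. -/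
def RX (T : Marriage p q) : Set (Rot p q) := {ρ | ∃ M, T.Exposed M ρ}

/-- `M' = (((M / ρ_1) / ρ_2) / …) / ρ_k`, where in `T` each `ρ_i` is exposed in the matching that it
is eliminated from. -/
def ElimSeq (T : Marriage p q) : Set (Fin p × Fin q) → List (Rot p q) → Set (Fin p × Fin q) → Prop
  | M, [], M' => M' = M
  | M, ρ :: L, M' => T.Exposed M ρ ∧ T.ElimSeq (Rot.elim M ρ) L M'

/-- `M' = M / R` for a (finite) set `R`: the elimination of the elements of `R` in some order. -/
def ElimSet (T : Marriage p q) (M : Set (Fin p × Fin q)) (R : Set (Rot p q))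
    (M' : Set (Fin p × Fin q)) : Prop :=
  ∃ L : List (Rot p q), L.Nodup ∧ (∀ ρ, ρ ∈ L ↔ ρ ∈ R) ∧ T.ElimSeq M L M'

/-- `ρ' ⊏ ρ`: in every sequence of eliminations that starts from the `X`-optimal stable matching
and contains both, `ρ'` is eliminated before `ρ`. -/
def Precedes (T : Marriage p q) (ρ' ρ : Rot p q) : Prop :=
  ρ' ≠ ρ ∧ ∀ MX L M, T.IsXOptimal MX → T.ElimSeq MX L M → ρ ∈ L → ρ' ∈ L → [ρ', ρ].Sublist L

/-- `R(ρ)`: the strict predecessors of `ρ` in `R_X(T)`. -/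
def Pred (T : Marriage p q) (ρ : Rot p q) : Set (Rot p q) := {ρ' ∈ T.RX | T.Precedes ρ' ρ}

/-- `M⁰ = M_X^T / R(ρ)`. -/
def IsBase (T : Marriage p q) (ρ : Rot p q) (M0 : Set (Fin p × Fin q)) : Prop :=
  ∃ MX, T.IsXOptimal MX ∧ T.ElimSet MX (T.Pred ρ) M0

end Marriage

/-! ## Dissecting a rotation -/

section Dissection

variable {p q : ℕ}

/-- The valid inputs `(T, T', ρ)`: `T' ⊆ T`, `T'` is a stable table and `ρ ∈ R_X(T')`. -/
def ValidInput (T T' : Marriage p q) (ρ : Rot p q) : Prop :=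
  T'.Subtable T ∧ T'.StableTable ∧ ρ ∈ T'.RX

/-- `T' ∪ E(R)`, as a subtable of `T`. -/
noncomputable def addRots (T T' : Marriage p q) (R : Set (Rot p q)) : Marriage p q :=
  T.restrict (T'.edges ∪ ⋃ σ ∈ R, Rot.E σ)

/-- `R` is a dissecting set for `(T, T', ρ)`: its elements are rotations of `T* = T' ∪ E(R) ⊆ T`
but not of `T'`, and `M_X^{T'} / R(ρ) / ρ = M_X^{T'} / R(ρ) / R`. -/
def IsDissectingSet (T T' : Marriage p q) (ρ : Rot p q) (R : Set (Rot p q)) : Prop :=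
  (∀ σ ∈ R, Rot.E σ ⊆ T.edges) ∧ R ⊆ (addRots T T' R).RX \ T'.RX ∧
    ∃ M0, T'.IsBase ρ M0 ∧ T'.Exposed M0 ρ ∧ (addRots T T' R).ElimSet M0 R (Rot.elim M0 ρ)

/-- `R` is a correct answer to the problem `DR(T, T', ρ)`. -/
def SolvesDR (T T' : Marriage p q) (ρ : Rot p q) (R : Set (Rot p q)) : Prop :=
  ((∃ R', IsDissectingSet T T' ρ R') → IsDissectingSet T T' ρ R) ∧
    ((¬ ∃ R', IsDissectingSet T T' ρ R') → R = {ρ})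

/-! ## The algorithm -/

/-- The arcs of the generalized `X`-rotation digraph `D_X(M, T)`: `x → y` if `xy ∈ T`, `x >_y M(y)`
and `M(x) >_x y`; `y → x` if `M(y) = x`. -/
def RotArc (T : Marriage p q) (M : Set (Fin p × Fin q)) : Fin p ⊕ Fin q → Fin p ⊕ Fin q → Prop
  | .inl x, .inr y => (x, y) ∈ T.edges ∧ (∀ x', (x', y) ∈ M → T.YPref y x x') ∧
      ∃ y', (x, y') ∈ M ∧ T.XPref x y' y
  | .inr y, .inl x => (x, y) ∈ M
  | _, _ => False

/-- `C` is a directed cycle of the digraph with the arcs `A`. -/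
def IsDicycle {α : Type*} (A : α → α → Prop) (C : Cycle α) : Prop :=
  C ≠ Cycle.nil ∧ C.Nodup ∧ ∀ u v, Follows C u v → A u v

/-- The directed cycle `y_0 → x_0 → y_1 → x_1 → ⋯ → y_{r-1} → x_{r-1} → y_0` corresponds to
`ρ = (x_0, y_0), …, (x_{r-1}, y_{r-1})`. -/
def Corresponds (C : Cycle (Fin p ⊕ Fin q)) (ρ : Rot p q) : Prop :=
  ∃ l : List (Fin p × Fin q), ρ = (l : Cycle (Fin p × Fin q)) ∧
    C = ((l.flatMap fun a => [Sum.inr a.2, Sum.inl a.1] : List (Fin p ⊕ Fin q)) :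
      Cycle (Fin p ⊕ Fin q))

/-- The subtable of the edges `xy ∈ T` with `M⁰(x) ≥_x y ≥_x M*(x)` and `M*(y) ≥_y x ≥_y M⁰(y)`. -/
noncomputable def midTable (T : Marriage p q) (M0 Ms : Set (Fin p × Fin q)) : Marriage p q :=
  T.restrict {e |
    (∃ y, (e.1, y) ∈ M0 ∧ (y = e.2 ∨ T.XPref e.1 y e.2)) ∧
    (∀ y, (e.1, y) ∈ Ms → (e.2 = y ∨ T.XPref e.1 e.2 y)) ∧
    (∃ x, (x, e.2) ∈ Ms ∧ (x = e.1 ∨ T.YPref e.2 x e.1)) ∧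
    (∀ x, (x, e.2) ∈ M0 → (e.1 = x ∨ T.YPref e.2 e.1 x))}

/-- `σ = (x_0, y_0), …, (x_{r-1}, y_{r-1})` describes a cycle `x_0, y_1, x_1, …, y_0, x_0` of the
graph `G[M¹ △ M*]`, with `x_i y_i ∈ M¹` and `x_i y_{i+1} ∈ M*`. -/
def IsAltCycle (M1 Ms : Set (Fin p × Fin q)) (σ : Rot p q) : Prop :=
  σ ≠ Cycle.nil ∧ σ.Nodup ∧ Rot.pairs σ ⊆ M1 \ Ms ∧ Rot.shifted σ ⊆ Ms \ M1

/-- `R` is a possible output of the algorithm Dissect_Rotation on `(T, T', ρ)`; the algorithm is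
free to choose the cycle `C₁`. -/
def DissectRotation (T T' : Marriage p q) (ρ : Rot p q) (R : Set (Rot p q)) : Prop :=
  ∃ M0 Ms, T'.IsBase ρ M0 ∧ T'.Exposed M0 ρ ∧ Ms = Rot.elim M0 ρ ∧
    (((∃! C, IsDicycle (RotArc (midTable T M0 Ms) M0) C) ∧ R = {ρ}) ∨
     ((¬ ∃! C, IsDicycle (RotArc (midTable T M0 Ms) M0) C) ∧
        ∃ C₁ ρ₁, IsDicycle (RotArc (midTable T M0 Ms) M0) C₁ ∧ Corresponds C₁ ρ₁ ∧ ρ₁ ≠ ρ ∧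
          R = insert ρ₁ {σ | IsAltCycle (Rot.elim M0 ρ₁) Ms σ}))

end Dissection

/-! ## The machine model

A random access machine, programmed in a language with integer variables, two-dimensional arrays and
loops.  Every operation costs one step.  The only arithmetic is the successor and truncated
subtraction, so that in a run of `t` steps no number exceeds the largest number of the input and
the program by more than `t`: unit cost hides no long-number arithmetic. -/

namespace RAM

structure State where
  var : ℕ → ℕ
  arr : ℕ → ℕ → ℕ → ℕ

inductive Expr where
  | lit (k : ℕ)
  | var (v : ℕ)
  | get (a : ℕ) (i j : Expr)
  | succ (e : Expr)
  | sub (e f : Expr)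
  | lt (e f : Expr)
  | eq (e f : Expr)

def Expr.eval (s : State) : Expr → ℕ
  | lit k => k
  | var v => s.var v
  | get a i j => s.arr a (i.eval s) (j.eval s)
  | succ e => e.eval s + 1
  | sub e f => e.eval s - f.eval s
  | lt e f => if e.eval s < f.eval s then 1 else 0
  | eq e f => if e.eval s = f.eval s then 1 else 0

/-- The number of steps for the evaluation of an expression. -/
def Expr.cost : Expr → ℕ
  | lit _ => 1
  | var _ => 1
  | get _ i j => i.cost + j.cost + 1
  | succ e => e.cost + 1
  | sub e f => e.cost + f.cost + 1
  | lt e f => e.cost + f.cost + 1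
  | eq e f => e.cost + f.cost + 1

inductive Prog where
  | skip
  | assign (v : ℕ) (e : Expr)
  | put (a : ℕ) (i j e : Expr)
  | seq (P Q : Prog)
  | ite (b : Expr) (P Q : Prog)
  | loop (b : Expr) (P : Prog)

def State.setVar (s : State) (v k : ℕ) : State :=
  { s with var := fun w => if w = v then k else s.var w }

def State.setArr (s : State) (a i j k : ℕ) : State :=
  { s with arr := fun a' i' j' => if a' = a ∧ i' = i ∧ j' = j then k else s.arr a' i' j' }

/-- `Run P s t s'`: started in `s`, the program `P` halts after `t` steps in `s'`. -/
inductive Run : Prog → State → ℕ → State → Prop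
  | skip (s) : Run .skip s 1 s
  | assign (v e s) : Run (.assign v e) s (e.cost + 1) (s.setVar v (e.eval s))
  | put (a i j e s) : Run (.put a i j e) s (i.cost + j.cost + e.cost + 1)
      (s.setArr a (i.eval s) (j.eval s) (e.eval s))
  | seq {P Q s s' s'' t t'} : Run P s t s' → Run Q s' t' s'' → Run (.seq P Q) s (t + t' + 1) s''
  | ite_true {b P Q s s' t} : b.eval s ≠ 0 → Run P s t s' → Run (.ite b P Q) s (b.cost + t + 1) s'
  | ite_false {b P Q s s' t} : b.eval s = 0 → Run Q s t s' → Run (.ite b P Q) s (b.cost + t + 1) s'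
  | loop_true {b P s s' s'' t t'} : b.eval s ≠ 0 → Run P s t s' → Run (.loop b P) s' t' s'' →
      Run (.loop b P) s (b.cost + t + t' + 1) s''
  | loop_false {b P s} : b.eval s = 0 → Run (.loop b P) s (b.cost + 1) s

/-- An array row that holds a list: its length, its entries, and then zeros. -/
def row {n : ℕ} (l : List (Fin n)) (k : ℕ) : ℕ := (l.length :: l.map Fin.val).getD k 0

/-- An array whose `i`-th row, for `i < m`, holds the `i`-th list; zeros elsewhere. -/
def rows {m n : ℕ} (f : Fin m → List (Fin n)) (i k : ℕ) : ℕ :=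
  if h : i < m then row (f ⟨i, h⟩) k else 0

variable {p q : ℕ}

/-- The initial state on the input `(T, T', ρ)`, with `ρ` written as the list `l`: the variables 0
and 1 hold the numbers of agents, the arrays 0 to 3 the preference lists of `T` and of `T'`, and the
rows 0 of the arrays 4 and 5 the `X`- and the `Y`-agents of `ρ`; all the rest is zero. -/
def input (T T' : Marriage p q) (l : List (Fin p × Fin q)) : State where
  var
    | 0 => p
    | 1 => q
    | _ => 0
  arr
    | 0 => rows T.xs
    | 1 => rows T.ys
    | 2 => rows T'.xs
    | 3 => rows T'.ys
    | 4 => rows (fun _ : Fin 1 => l.map Prod.fst)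
    | 5 => rows (fun _ : Fin 1 => l.map Prod.snd)
    | _ => fun _ _ => 0

/-- The final state `s` holds the set `R`, listed without repetition: the variable 2 holds the
number `k` of its elements, and the rows `j < k` of the arrays 6 and 7 hold the `X`- and the
`Y`-agents of the `j`-th element. -/
def Outputs (s : State) (R : Set (Rot p q)) : Prop :=
  ∃ Ls : List (List (Fin p × Fin q)),
    (Ls.map (fun l => (l : Cycle (Fin p × Fin q)))).Nodup ∧
    (∀ σ : Rot p q, σ ∈ R ↔ ∃ l ∈ Ls, σ = (l : Cycle (Fin p × Fin q))) ∧
    s.var 2 = Ls.length ∧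
    ∀ (j : ℕ) (h : j < Ls.length), ∀ k ≤ Ls[j].length,
      s.arr 6 j k = row (Ls[j].map Prod.fst) k ∧ s.arr 7 j k = row (Ls[j].map Prod.snd) k

end RAM

/-! ## Cyclic sequences -/

/-! Correctness. In a stable table `T'` consecutive pairs of a rotation are adjacent on the lists:
no edge of `T'` lies strictly between `y_i` and `y_{i+1}` for `x_i`, nor between `x_i` and `x_{i+1}`
for `y_{i+1}` (`Exposed.not_between_x`, `Exposed.not_between_y`). Hence a pair lies in at most one
rotation, a rotation is exposed in every stable matching that contains its pairs, and no elimination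
jumps over an edge of the table. This makes `M⁰` exist (`StableTable.exists_isBase`): it is the best
stable matching for `X` among those containing the pairs of `ρ`. It is unique because the result of
eliminating a set does not depend on the order.

A cycle of the digraph is a cyclic sequence `σ` of pairs of `ρ` in which each `x` moves down, at
most to its partner in `M*`, and each `y` moves up, at most to its partner in `M*` (`IsRhoCycle`).
One such sequence is `ρ`. If `ρ₁` is another, then `M¹ = M⁰/ρ₁` lies between `M⁰` and `M*`. Adding
`M¹` to `T'` gives each agent at most one new edge in the gap between `M⁰` and `M*`, so `ρ₁` is
exposed in `M⁰`, and the alternating cycles of `M¹ △ M*` are disjoint rotations all exposed in `M¹`,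
with elimination result `M*` (`isDissectingSet_of_isRhoCycle`). Conversely, agents move
monotonically during eliminations, so the first rotation eliminated from a dissecting set stays
between `M⁰` and `M*` and is a cycle of the digraph. If `ρ` is the only cycle, that rotation is `ρ`,
which is excluded as a rotation of `T'` (`not_exists_isDissectingSet`).

Running time. Neither `M⁰` nor the digraph has to be computed. All arcs `x → y` join agents of `ρ`,
so a second cycle exists exactly when some arc `x_i → y_{j+1}` is a chord, that is, not an arc of
`ρ`. A chord closes a part of `ρ` to a cycle `ρ₁`, and the rest, together with the chord, is the
only alternating cycle of `M¹ △ M*` (`chord_dissects`). The program tabulates ranks, tests all index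
pairs `(i, j)` for a chord, and writes `ρ` or the two parts. Since `ρ` has at most `p` pairs, this
is quadratic. -/

section Cycles

variable {α : Type*}

/-- Translates a rotation of the list that brings `a` to the front into indices modulo the length.
In a cycle with one element the element follows itself, which is why `Follows` uses `headD a`. -/
theorem follows_coe_iff (l : List α) (a b : α) :
    Follows (l : Cycle α) a b ↔
      ∃ i < l.length, l[i]? = some a ∧ l[(i + 1) % l.length]? = some b := by
  constructor
  · rintro ⟨l', h, rfl⟩
    obtain ⟨n, hn⟩ := Cycle.coe_eq_coe.1 h
    have hlen : l.length = l'.length + 1 := by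
      rw [← List.length_rotate l n, hn]; simp
    have hpos : 0 < l.length := by omega
    have key : ∀ k < l.length, l[(k + n) % l.length]? = (a :: l')[k]? := by
      intro k hk
      rw [← hn, List.getElem?_rotate hk]
    refine ⟨n % l.length, Nat.mod_lt _ hpos, ?_, ?_⟩
    · have := key 0 hpos
      simpa using this
    · rcases l' with _ | ⟨c, l'⟩
      · simp at hlen
        have := key 0 hpos
        simpa [hlen, Nat.mod_one] using this
      · have := key 1 (by simp at hlen; omega)
        rw [Nat.mod_add_mod, add_comm n 1, this]
        simp
  · rintro ⟨i, hi, ha, hb⟩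
    obtain ⟨_, rfl⟩ := List.getElem?_eq_some_iff.1 ha
    have hrot : l.rotate i = l[i] :: (l.drop (i + 1) ++ l.take i) := by
      rw [List.rotate_eq_drop_append_take hi.le, List.drop_eq_getElem_cons hi, List.cons_append]
    refine ⟨l.drop (i + 1) ++ l.take i, Cycle.coe_eq_coe.2 ⟨i, hrot⟩, ?_⟩
    rcases lt_or_ge (i + 1) l.length with h | h
    · rw [Nat.mod_eq_of_lt h] at hb
      obtain ⟨_, rfl⟩ := List.getElem?_eq_some_iff.1 hb
      rw [List.drop_eq_getElem_cons h, List.cons_append, List.headD_cons]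
    · have h' : i + 1 = l.length := by omega
      rw [h', Nat.mod_self] at hb
      rw [List.drop_eq_nil_of_le h]
      rcases l with _ | ⟨c, l⟩
      · simp at hi
      · rcases i with _ | i
        · simpa using hb.symm
        · simpa using hb.symm

theorem Follows.left_mem {c : Cycle α} {a b : α} (h : Follows c a b) : a ∈ c := by
  obtain ⟨l, rfl, -⟩ := h
  simp

theorem Follows.right_mem {c : Cycle α} {a b : α} (h : Follows c a b) : b ∈ c := by
  obtain ⟨l, rfl, rfl⟩ := h
  rcases l with _ | ⟨c, l⟩ <;> simp

theorem exists_follows_right {c : Cycle α} {a : α} (h : a ∈ c) : ∃ b, Follows c a b := by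
  induction c using Quotient.inductionOn' with
  | h l =>
    obtain ⟨i, hi, rfl⟩ := List.getElem_of_mem (show a ∈ l from h)
    have hm : (i + 1) % l.length < l.length := Nat.mod_lt _ (by omega)
    exact ⟨l[(i + 1) % l.length], (follows_coe_iff l _ _).2
      ⟨i, hi, List.getElem?_eq_getElem hi, List.getElem?_eq_getElem hm⟩⟩

theorem exists_follows_left {c : Cycle α} {b : α} (h : b ∈ c) : ∃ a, Follows c a b := by
  induction c using Quotient.inductionOn' with
  | h l =>
    obtain ⟨i, hi, rfl⟩ := List.getElem_of_mem (show b ∈ l from h)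
    rcases i with _ | i
    · refine ⟨l[l.length - 1], (follows_coe_iff l _ _).2
        ⟨l.length - 1, by omega, List.getElem?_eq_getElem _, ?_⟩⟩
      rw [Nat.sub_add_cancel hi, Nat.mod_self, List.getElem?_eq_getElem hi]
    · refine ⟨l[i], (follows_coe_iff l _ _).2 ⟨i, by omega, List.getElem?_eq_getElem _, ?_⟩⟩
      rw [Nat.mod_eq_of_lt hi, List.getElem?_eq_getElem hi]

theorem Follows.right_unique {c : Cycle α} (hc : c.Nodup) {a b b' : α} (h : Follows c a b)
    (h' : Follows c a b') : b = b' := by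
  induction c using Quotient.inductionOn' with
  | h l =>
    obtain ⟨i, hi, ha, hb⟩ := (follows_coe_iff l _ _).1 h
    obtain ⟨j, hj, ha', hb'⟩ := (follows_coe_iff l _ _).1 h'
    have : i = j := (List.getElem?_inj hi (show l.Nodup from hc)).1 (ha.trans ha'.symm)
    subst this
    exact Option.some.inj (hb.symm.trans hb')

theorem Follows.left_unique {c : Cycle α} (hc : c.Nodup) {a a' b : α} (h : Follows c a b)
    (h' : Follows c a' b) : a = a' := by
  induction c using Quotient.inductionOn' with
  | h l =>
    obtain ⟨i, hi, ha, hb⟩ := (follows_coe_iff l _ _).1 h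
    obtain ⟨j, hj, ha', hb'⟩ := (follows_coe_iff l _ _).1 h'
    have hm := (List.getElem?_inj (Nat.mod_lt (i + 1) (by omega))
      (show l.Nodup from hc)).1 (hb.trans hb'.symm)
    have : i = j := by
      rcases Nat.lt_or_ge (i + 1) l.length with h1 | h1 <;>
      rcases Nat.lt_or_ge (j + 1) l.length with h2 | h2
      · rw [Nat.mod_eq_of_lt h1, Nat.mod_eq_of_lt h2] at hm; omega
      · rw [Nat.mod_eq_of_lt h1, show j + 1 = l.length by omega, Nat.mod_self] at hm; omega
      · rw [Nat.mod_eq_of_lt h2, show i + 1 = l.length by omega, Nat.mod_self] at hm; omega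
      · omega
    subst this
    exact Option.some.inj (ha.symm.trans ha')

theorem exists_mem_of_ne_nil {c : Cycle α} (h : c ≠ Cycle.nil) : ∃ a, a ∈ c := by
  induction c using Quotient.inductionOn' with
  | h l =>
    rcases l with _ | ⟨a, l⟩
    · exact absurd rfl h
    · exact ⟨a, Cycle.mem_coe_iff.2 (by simp)⟩

theorem exists_eq_cons_of_mem {c : Cycle α} {a : α} (h : a ∈ c) :
    ∃ l : List α, c = ((a :: l : List α) : Cycle α) := by
  obtain ⟨b, l, h, -⟩ := exists_follows_right h
  exact ⟨l, h⟩

/-- Walk along both lists from the common head: equal successors give equal entries as long as both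
lists last. If the first list ended earlier, its return to `a` would force a second `a` into the
other list, which has no repetitions. -/
theorem eq_of_follows_aux {a : α} {l l' : List α}
    (hd : ((a :: l' : List α) : Cycle α).Nodup)
    (hf : ∀ u v v', Follows ((a :: l : List α) : Cycle α) u v →
      Follows ((a :: l' : List α) : Cycle α) u v' → v = v') :
    (∀ k < (a :: l).length, k < (a :: l').length → (a :: l)[k]? = (a :: l')[k]?) ∧
      (a :: l').length ≤ (a :: l).length := by
  have key : ∀ k < (a :: l).length, k < (a :: l').length → (a :: l)[k]? = (a :: l')[k]? := by
    intro k
    induction k with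
    | zero => simp
    | succ k ih =>
      intro h h'
      have e := ih (by omega) (by omega)
      have e1 := List.getElem?_eq_getElem h
      have e2 := List.getElem?_eq_getElem h'
      have e3 := List.getElem?_eq_getElem (show k < (a :: l).length by omega)
      have e4 := hf _ _ _
        ((follows_coe_iff _ _ _).2 ⟨k, by omega, e3, by rwa [Nat.mod_eq_of_lt h]⟩)
        ((follows_coe_iff _ _ _).2 ⟨k, by omega, e ▸ e3, by rwa [Nat.mod_eq_of_lt h']⟩)
      rw [e1, e2, e4]
  refine ⟨key, ?_⟩
  by_contra! hlt
  have hn : l.length < (a :: l).length := by simp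
  have hn' : l.length < (a :: l').length := by simp at hlt ⊢; omega
  have hn1 : l.length + 1 < (a :: l').length := by simpa using hlt
  have e := key l.length hn hn'
  have e3 := List.getElem?_eq_getElem hn
  have e4 := List.getElem?_eq_getElem hn1
  have := hf _ a _ ((follows_coe_iff _ _ _).2 ⟨l.length, hn, e3, by simp⟩)
    ((follows_coe_iff _ _ _).2 ⟨l.length, hn', e ▸ e3, by rwa [Nat.mod_eq_of_lt hn1]⟩)
  have h0 : (a :: l')[0]? = (a :: l')[l.length + 1]? := by
    rw [e4, ← this]; simp
  exact absurd ((List.getElem?_inj (by simp) (Cycle.nodup_coe_iff.1 hd)).1 h0) (by omega)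

/-- Two cyclic sequences with a common element and the same successors are equal. -/
theorem eq_of_follows {c c' : Cycle α} (hc : c.Nodup) (hc' : c'.Nodup) {a : α} (ha : a ∈ c)
    (ha' : a ∈ c') (hf : ∀ u v v', Follows c u v → Follows c' u v' → v = v') : c = c' := by
  obtain ⟨l, rfl⟩ := exists_eq_cons_of_mem ha
  obtain ⟨l', rfl⟩ := exists_eq_cons_of_mem ha'
  obtain ⟨h1, h2⟩ := eq_of_follows_aux hc' hf
  obtain ⟨-, h3⟩ := eq_of_follows_aux hc fun u v v' h h' => (hf u v' v h' h).symm
  congr 1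
  apply List.ext_getElem?
  intro k
  rcases lt_or_ge k (a :: l).length with h | h
  · exact h1 k h (by omega)
  · rw [List.getElem?_eq_none h, List.getElem?_eq_none (by omega)]

/-- A relation that is total on a finite set `P` has a cycle in `P`. -/
theorem exists_cycle [Finite α] {P : Set α} {r : α → α → Prop} (hP : ∀ a ∈ P, ∃ b ∈ P, r a b)
    {a₀ : α} (h₀ : a₀ ∈ P) :
    ∃ c : Cycle α, c ≠ Cycle.nil ∧ c.Nodup ∧ (∀ a ∈ c, a ∈ P) ∧ (∀ a b, Follows c a b → r a b) ∧
      ((∀ a ∈ P, ∀ a' ∈ P, ∀ b, r a b → r a' b → a = a') → a₀ ∈ c) := by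
  classical
  choose! f hfP hf using hP
  have hit : ∀ n, f^[n] a₀ ∈ P := by
    intro n
    induction n with
    | zero => exact h₀
    | succ n ih => rw [Function.iterate_succ_apply']; exact hfP _ ih
  -- By finiteness the iterates of `a₀` become periodic; the cycle is the orbit entered at the least
  -- such time `m`.
  have hex : ∃ m, f^[m] a₀ ∈ Function.periodicPts f := by
    obtain ⟨m, n, hne, he⟩ := Finite.exists_ne_map_eq_of_infinite fun n => f^[n] a₀
    wlog hlt : m < n generalizing m n
    · exact this n m hne.symm he.symm (by omega)
    refine ⟨m, n - m, by omega, ?_⟩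
    change f^[n - m] (f^[m] a₀) = _
    rw [← Function.iterate_add_apply, Nat.sub_add_cancel hlt.le]
    exact he.symm
  have hm := Nat.find_spec hex
  set m := Nat.find hex with hmdef
  set x := f^[m] a₀ with hx
  have hfol : ∀ a b, Follows (Function.periodicOrbit f x) a b → b = f a := by
    intro a b h
    obtain ⟨i, hi, h1, h2⟩ := (follows_coe_iff _ _ _).1 h
    simp only [List.length_map, List.length_range] at hi h2
    have hpos : 0 < Function.minimalPeriod f x := by omega
    rw [List.getElem?_map, List.getElem?_range hi] at h1
    rw [List.getElem?_map, List.getElem?_range (Nat.mod_lt _ hpos)] at h2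
    simp only [Option.map_some, Option.some.injEq] at h1 h2
    rw [Function.iterate_mod_minimalPeriod_eq] at h2
    rw [← h1, ← h2, Function.iterate_succ_apply']
  have hmem : ∀ a ∈ Function.periodicOrbit f x, a ∈ P := by
    intro a ha
    obtain ⟨n, rfl⟩ := (Function.mem_periodicOrbit_iff hm).1 ha
    rw [hx, ← Function.iterate_add_apply]
    exact hit _
  have hself := Function.self_mem_periodicOrbit hm
  refine ⟨Function.periodicOrbit f x, fun h => ?_, Function.nodup_periodicOrbit, hmem,
    fun a b h => ?_, fun hinj => ?_⟩
  · rw [h] at hself; exact absurd hself (Cycle.notMem_nil _)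
  · rw [hfol a b h]; exact hf _ (hmem _ h.left_mem)
  -- If `r` has unique predecessors in `P`, the orbit has no tail: for `m = k + 1`, the entry point
  -- would have as predecessors both the `k`-th iterate and an element of the cycle, so the `k`-th
  -- iterate would already be periodic.
  · rcases hm0 : m with _ | k
    · rw [hm0] at hx; rw [hx] at hself; rw [hx]; exact hself
    · exfalso
      obtain ⟨a, ha⟩ := exists_follows_left hself
      have h1 := hfol _ _ ha
      have h2 : a = f^[k] a₀ := by
        refine hinj _ (hmem _ ha.left_mem) _ (hit k) x ?_ ?_
        · rw [h1]; exact hf _ (hmem _ ha.left_mem)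
        · rw [hx, hm0, Function.iterate_succ_apply']; exact hf _ (hit k)
      have h3 : f^[k] a₀ ∈ Function.periodicPts f := by
        obtain ⟨n, hn⟩ := (Function.mem_periodicOrbit_iff hm).1 ha.left_mem
        rw [← h2, ← hn]
        obtain ⟨N, hN, hN'⟩ := hm
        exact ⟨N, hN, hN'.apply_iterate n⟩
      exact Nat.find_min hex (show k < Nat.find hex by omega) h3

end Cycles

/-! ## Directed cycles and cyclic sequences of pairs -/

section Correspondence

variable {p q : ℕ}

/-- The vertices `y_0, x_0, y_1, x_1, …` of the directed cycle that corresponds to a list. -/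
abbrev dicycleList (l : List (Fin p × Fin q)) : List (Fin p ⊕ Fin q) :=
  l.flatMap fun a => [Sum.inr a.2, Sum.inl a.1]

theorem isRotated_dicycleList {l l' : List (Fin p × Fin q)} (h : l ~r l') :
    dicycleList l ~r dicycleList l' := by
  obtain ⟨n, rfl⟩ := h
  rw [List.rotate_eq_drop_append_take_mod]
  conv_lhs => rw [← List.take_append_drop (n % l.length) l]
  rw [dicycleList, dicycleList, List.flatMap_append, List.flatMap_append]
  exact List.isRotated_append

theorem Corresponds.eq_coe {C : Cycle (Fin p ⊕ Fin q)} {l : List (Fin p × Fin q)}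
    (h : Corresponds C (l : Cycle (Fin p × Fin q))) : C = (dicycleList l : Cycle _) := by
  obtain ⟨l', h, rfl⟩ := h
  exact Cycle.coe_eq_coe.2 (isRotated_dicycleList (Cycle.coe_eq_coe.1 h).symm)

theorem Corresponds.left_unique {C C' : Cycle (Fin p ⊕ Fin q)} {ρ : Rot p q}
    (h : Corresponds C ρ) (h' : Corresponds C' ρ) : C = C' := by
  induction ρ using Quotient.inductionOn' with
  | h l => exact (Corresponds.eq_coe h).trans (Corresponds.eq_coe h').symm

theorem exists_corresponds (ρ : Rot p q) : ∃ C, Corresponds C ρ := by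
  induction ρ using Quotient.inductionOn' with
  | h l => exact ⟨_, l, rfl, rfl⟩

theorem Corresponds.follows {C : Cycle (Fin p ⊕ Fin q)} {ρ : Rot p q} (h : Corresponds C ρ)
    {a b : Fin p × Fin q} (hab : Follows ρ a b) :
    Follows C (Sum.inr a.2) (Sum.inl a.1) ∧ Follows C (Sum.inl a.1) (Sum.inr b.2) := by
  obtain ⟨l, rfl, rfl⟩ := hab
  have hC := h.eq_coe
  refine ⟨⟨Sum.inl a.1 :: dicycleList l, by simpa [dicycleList] using hC, by simp⟩,
    ⟨dicycleList l ++ [Sum.inr a.2], ?_, ?_⟩⟩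
  · rw [hC]
    exact Cycle.coe_eq_coe.2 ⟨1, by simp [dicycleList]⟩
  · rcases l with _ | ⟨c, l⟩ <;> simp [dicycleList]

theorem Corresponds.exists_of_follows {C : Cycle (Fin p ⊕ Fin q)} {ρ : Rot p q}
    (h : Corresponds C ρ) (hC : C.Nodup) {u v : Fin p ⊕ Fin q} (huv : Follows C u v) :
    ∃ a b, Follows ρ a b ∧
      (u = Sum.inr a.2 ∧ v = Sum.inl a.1 ∨ u = Sum.inl a.1 ∧ v = Sum.inr b.2) := by
  have hu := huv.left_mem
  have h' := h
  obtain ⟨l, rfl, rfl⟩ := h'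
  obtain ⟨a, ha, hu⟩ := List.mem_flatMap.1 (Cycle.mem_coe_iff.1 hu)
  obtain ⟨b, hb⟩ := exists_follows_right (Cycle.mem_coe_iff.2 ha)
  obtain ⟨h1, h2⟩ := h.follows hb
  refine ⟨a, b, hb, ?_⟩
  simp only [List.mem_cons, List.not_mem_nil, or_false] at hu
  rcases hu with rfl | rfl
  · exact Or.inl ⟨rfl, huv.right_unique hC h1⟩
  · exact Or.inr ⟨rfl, huv.right_unique hC h2⟩

theorem Corresponds.nodup {C : Cycle (Fin p ⊕ Fin q)} {ρ : Rot p q} (h : Corresponds C ρ)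
    (hρ : ρ.Nodup) (h1 : ∀ a ∈ ρ, ∀ b ∈ ρ, a.1 = b.1 → a = b)
    (h2 : ∀ a ∈ ρ, ∀ b ∈ ρ, a.2 = b.2 → a = b) : C.Nodup := by
  obtain ⟨l, rfl, rfl⟩ := h
  rw [Cycle.nodup_coe_iff, List.nodup_flatMap]
  refine ⟨fun a _ => by simp, ?_⟩
  refine List.Nodup.pairwise_of_forall_ne (Cycle.nodup_coe_iff.1 hρ) fun a ha b hb hne => ?_
  simp only [Function.onFun, List.disjoint_cons_left, List.mem_cons, List.not_mem_nil]
  refine ⟨?_, ?_, by simp⟩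
  · rintro (h | h | h)
    · exact hne (h2 a ha b hb (Sum.inr.inj h))
    · simp at h
    · exact h
  · rintro (h | h | h)
    · simp at h
    · exact hne (h1 a ha b hb (Sum.inl.inj h))
    · exact h

/-- Arcs only cross between the two sides, so a chain alternates; one that starts in `Y` and ends in
`X` is cut into pairs without remainder. -/
theorem exists_dicycleList_eq {A : Fin p ⊕ Fin q → Fin p ⊕ Fin q → Prop}
    (hl : ∀ x x', ¬ A (.inl x) (.inl x')) (hr : ∀ y y', ¬ A (.inr y) (.inr y')) :
    ∀ L : List (Fin p ⊕ Fin q), L.IsChain A → (∀ u ∈ L.head?, u.isRight) →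
      (∀ u ∈ L.getLast?, u.isLeft) → ∃ l : List (Fin p × Fin q), L = dicycleList l
  | [], _, _, _ => ⟨[], rfl⟩
  | [u], _, h1, h2 => by
    have h1 := h1 u (by simp)
    have h2 := h2 u (by simp)
    rcases u with x | y <;> simp_all
  | u :: v :: L, hc, h1, h2 => by
    have h1 := h1 u (by simp)
    rcases u with x | y
    · simp at h1
    rw [List.isChain_cons_cons] at hc
    rcases v with x | y'
    swap
    · exact absurd hc.1 (hr _ _)
    obtain ⟨l, rfl⟩ := exists_dicycleList_eq hl hr L hc.2.of_cons
      (by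
        intro u hu
        rcases L with _ | ⟨w, L⟩
        · simp at hu
        · obtain rfl : w = u := by simpa using hu
          rcases w with x' | y'
          · exact absurd (List.isChain_cons_cons.1 hc.2).1 (hl _ _)
          · rfl)
      (by
        intro u hu
        rcases L with _ | ⟨w, L⟩
        · simp at hu
        · exact h2 u (by simpa using hu))
    exact ⟨(x, y) :: l, by simp [dicycleList]⟩

theorem IsDicycle.exists_corresponds {T : Marriage p q} {M : Set (Fin p × Fin q)}
    {C : Cycle (Fin p ⊕ Fin q)} (hC : IsDicycle (RotArc T M) C) : ∃ ρ, Corresponds C ρ := by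
  obtain ⟨hne, -, hA⟩ := hC
  have hl : ∀ x x' : Fin p, ¬ RotArc T M (.inl x) (.inl x') := fun _ _ h => h
  have hr : ∀ y y' : Fin q, ¬ RotArc T M (.inr y) (.inr y') := fun _ _ h => h
  obtain ⟨y, hy⟩ : ∃ y : Fin q, Sum.inr y ∈ C := by
    obtain ⟨u, hu⟩ := exists_mem_of_ne_nil hne
    rcases u with x | y
    · obtain ⟨v, hv⟩ := exists_follows_right hu
      rcases v with x' | y
      · exact absurd (hA _ _ hv) (hl _ _)
      · exact ⟨y, hv.right_mem⟩
    · exact ⟨y, hu⟩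
  obtain ⟨L, rfl⟩ := exists_eq_cons_of_mem hy
  obtain ⟨l, hl⟩ := exists_dicycleList_eq hl hr (Sum.inr y :: L)
    (by
      rw [List.isChain_iff_getElem]
      intro i hi
      refine hA _ _ ((follows_coe_iff _ _ _).2 ⟨i, by omega, List.getElem?_eq_getElem _, ?_⟩)
      rw [Nat.mod_eq_of_lt hi, List.getElem?_eq_getElem hi])
    (by simp)
    (by
      intro u hu
      have : Follows ((Sum.inr y :: L : List _) : Cycle (Fin p ⊕ Fin q)) u (Sum.inr y) := by
        refine (follows_coe_iff _ _ _).2 ⟨L.length, by simp, ?_, by simp⟩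
        rw [List.getLast?_eq_getElem?] at hu
        simpa using hu
      have := hA _ _ this
      rcases u with x | y'
      · rfl
      · exact absurd this (hr _ _))
  exact ⟨l, l, rfl, by rw [hl]⟩

end Correspondence

/-! ## Comparing two stable matchings -/

section Opposition

variable {α β : Type*}

/-- `M` is a stable matching of the graph `E`, where the preferences are given by ranks. -/
structure Stab (rx : α → β → ℕ) (ry : β → α → ℕ) (E M : α → β → Prop) : Prop where
  xinj : ∀ {x y y'}, E x y → E x y' → rx x y = rx x y' → y = y'
  yinj : ∀ {y x x'}, E x y → E x' y → ry y x = ry y x' → x = x'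
  sub : ∀ {x y}, M x y → E x y
  xuniq : ∀ {x y y'}, M x y → M x y' → y = y'
  yuniq : ∀ {x x' y}, M x y → M x' y → x = x'
  stable : ∀ {x y}, E x y →
    (∃ y', M x y' ∧ rx x y' ≤ rx x y) ∨ ∃ x', M x' y ∧ ry y x' ≤ ry y x

/-- The agent `x` strictly prefers `M` to `N`. -/
def Prefers (r : α → β → ℕ) (M N : α → β → Prop) (x : α) : Prop :=
  ∃ y, M x y ∧ ∀ y', N x y' → r x y < r x y'

namespace Stab

variable {rx : α → β → ℕ} {ry : β → α → ℕ} {E M N : α → β → Prop}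

theorem symm (h : Stab rx ry E M) : Stab ry rx (flip E) (flip M) where
  xinj := h.yinj
  yinj := h.xinj
  sub := h.sub
  xuniq := h.yuniq
  yuniq := h.xuniq
  stable e := (h.stable e).symm

/-- The edge `xy` does not block `N`, so `y` has in `N` a partner at least as good as `x`; equality
would match `x` to `y` in `N`, contrary to the strict preference of `x`. -/
theorem prefers_flip (hM : Stab rx ry E M) (hN : Stab rx ry E N) {x : α} {y : β}
    (hx : Prefers rx M N x) (hxy : M x y) : Prefers ry (flip N) (flip M) y := by
  obtain ⟨y₁, h1, h2⟩ := hx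
  obtain rfl := hM.xuniq h1 hxy
  rcases hN.stable (hM.sub hxy) with ⟨y', h3, h4⟩ | ⟨x', h3, h4⟩
  · exact absurd (h2 _ h3) (by omega)
  · refine ⟨x', h3, fun x'' h5 => ?_⟩
    obtain rfl := hM.yuniq hxy h5
    refine lt_of_le_of_ne h4 fun he => ?_
    obtain rfl := hM.yinj (hN.sub h3) (hM.sub hxy) he
    exact absurd (h2 _ h3) (by omega)

/-- The `M`-partner maps the `X`-agents that prefer `M` into the `Y`-agents that prefer `N`, and the
`N`-partner maps these back, both injectively by `prefers_flip`. On a finite set the composition is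
onto. An agent matched in `M` alone counts as preferring `M`, so this also shows that all stable
matchings cover the same agents. -/
theorem exists_of_prefers [Finite α] (hM : Stab rx ry E M) (hN : Stab rx ry E N) {x : α}
    (hx : Prefers rx M N x) : ∃ y, N x y ∧ Prefers ry (flip N) (flip M) y := by
  have hf : ∀ a : {x // Prefers rx M N x}, ∃ b : {y // Prefers ry (flip N) (flip M) y},
      M a.1 b.1 := by
    rintro ⟨a, ha⟩
    obtain ⟨b, hb, -⟩ := id ha
    exact ⟨⟨b, prefers_flip hM hN ha hb⟩, hb⟩
  have hg : ∀ b : {y // Prefers ry (flip N) (flip M) y}, ∃ a : {x // Prefers rx M N x},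
      N a.1 b.1 := by
    rintro ⟨b, hb⟩
    obtain ⟨a, ha, -⟩ := id hb
    exact ⟨⟨a, prefers_flip hN.symm hM.symm hb ha⟩, ha⟩
  choose f hf using hf
  choose g hg using hg
  have hinj : Function.Injective (g ∘ f) := by
    intro a a' h
    have h1 : f a = f a' := Subtype.ext (hN.xuniq (hg (f a)) (by
      have := hg (f a'); rwa [← show g (f a) = g (f a') from h] at this))
    exact Subtype.ext (hM.yuniq (hf a) (h1 ▸ hf a'))
  obtain ⟨a, ha⟩ := Finite.injective_iff_surjective.1 hinj ⟨x, hx⟩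
  refine ⟨f a, ?_, (f a).2⟩
  have := hg (f a)
  rwa [show g (f a) = _ from ha] at this

theorem exists_of_prefers_flip [Finite β] (hM : Stab rx ry E M) (hN : Stab rx ry E N) {y : β}
    (hy : Prefers ry (flip N) (flip M) y) : ∃ x, M x y ∧ Prefers rx M N x :=
  exists_of_prefers hN.symm hM.symm hy

theorem exists_right [Finite α] (hM : Stab rx ry E M) (hN : Stab rx ry E N) {x : α} {y : β}
    (h : M x y) : ∃ y', N x y' := by
  by_contra! hc
  obtain ⟨y', h', -⟩ := exists_of_prefers hM hN ⟨y, h, fun y' h' => absurd h' (hc y')⟩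
  exact hc y' h'

theorem exists_left [Finite β] (hM : Stab rx ry E M) (hN : Stab rx ry E N) {x : α} {y : β}
    (h : M x y) : ∃ x', N x' y :=
  exists_right hM.symm hN.symm h

/-- If `x` prefers `M` to `N`, then the partner of `x` in `N` prefers `N` to `M`. -/
theorem prefers_of_lt [Finite α] (hM : Stab rx ry E M) (hN : Stab rx ry E N) {x : α} {y z : β}
    (hy : M x y) (hz : N x z) (hlt : rx x y < rx x z) : Prefers ry (flip N) (flip M) z := by
  obtain ⟨w, h1, h2⟩ := exists_of_prefers hM hN ⟨y, hy, fun w hw => by rwa [hN.xuniq hw hz]⟩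
  rwa [hN.xuniq hz h1]

/-- The supremum of a nonempty family of stable matchings is stable. -/
theorem sup [Finite α] [Finite β] {F : Set (α → β → Prop)} (hne : F.Nonempty)
    (hF : ∀ M ∈ F, Stab rx ry E M) :
    Stab rx ry E fun x y => (∃ M ∈ F, M x y) ∧ ∀ M ∈ F, ∀ y', M x y' → rx x y ≤ rx x y' := by
  obtain ⟨M₀, h₀⟩ := hne
  have S₀ := hF M₀ h₀
  refine ⟨S₀.xinj, S₀.yinj, ?_, ?_, ?_, ?_⟩
  · rintro x y ⟨⟨M, hM, h⟩, -⟩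
    exact (hF M hM).sub h
  · rintro x y y' ⟨⟨M, hM, h⟩, h1⟩ ⟨⟨M', hM', h'⟩, h1'⟩
    exact S₀.xinj ((hF M hM).sub h) ((hF M' hM').sub h')
      (le_antisymm (h1 _ hM' _ h') (h1' _ hM _ h))
  · rintro x x' y ⟨⟨M, hM, h⟩, h1⟩ ⟨⟨M', hM', h'⟩, h1'⟩
    have SM := hF M hM
    have SM' := hF M' hM'
    by_contra hxx
    -- If two agents both had `y` as best partner, each would prefer its own matching to the
    -- other's, so by opposition `y` would strictly prefer each matching to the other.
    have key : ∀ {N N' : α → β → Prop} {z z' : α}, N ∈ F → N' ∈ F → z ≠ z' → N z y → N' z' y →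
        (∀ M ∈ F, ∀ y', M z y' → rx z y ≤ rx z y') → Prefers ry (flip N') (flip N) y := by
      intro N N' z z' hN hN' hz h h' hmin
      refine prefers_flip (hF N hN) (hF N' hN') ⟨y, h, fun w hw => ?_⟩ h
      refine lt_of_le_of_ne (hmin N' hN' w hw) fun he => hz ?_
      obtain rfl := S₀.xinj ((hF N hN).sub h) ((hF N' hN').sub hw) he
      exact (hF N' hN').yuniq hw h'
    obtain ⟨a, ha, h2⟩ := key hM hM' hxx h h' h1
    obtain ⟨b, hb, h3⟩ := key hM' hM (Ne.symm hxx) h' h h1'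
    exact lt_asymm (h2 _ hb) (h3 _ ha)
  · intro x y hxy
    by_cases hx : ∃ M ∈ F, ∃ y', M x y' ∧ rx x y' ≤ rx x y
    · left
      obtain ⟨M, hM, y', h, hle⟩ := hx
      obtain ⟨z, ⟨N, hN, hz⟩, hmin⟩ := Set.exists_min_image {y' | ∃ M ∈ F, M x y'} (rx x)
        (Set.toFinite _) ⟨y', M, hM, h⟩
      exact ⟨z, ⟨⟨N, hN, hz⟩, fun M hM y' h => hmin y' ⟨M, hM, h⟩⟩,
        (hmin y' ⟨M, hM, h⟩).trans hle⟩
    · right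
      push Not at hx
      have hy : ∀ M ∈ F, ∃ x', M x' y ∧ ry y x' ≤ ry y x := by
        intro M hM
        rcases (hF M hM).stable hxy with ⟨y', h, hle⟩ | h
        · exact absurd hle (not_le.2 (hx M hM y' h))
        · exact h
      obtain ⟨x₀, hx₀, -⟩ := hy M₀ h₀
      -- In the supremum `y` gets its worst partner `z` over the family. If `z` had a better partner
      -- in some `M`, then `y` would prefer `z` to its partner in `M`, which would be a still worse
      -- one.
      obtain ⟨z, ⟨N, hN, hz⟩, hmax⟩ := Set.exists_max_image {x' | ∃ M ∈ F, M x' y} (ry y)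
        (Set.toFinite _) ⟨x₀, M₀, h₀, hx₀⟩
      have hzle : ry y z ≤ ry y x := by
        obtain ⟨x', h, hle⟩ := hy N hN
        rwa [(hF N hN).yuniq hz h]
      refine ⟨z, ⟨⟨N, hN, hz⟩, fun M hM y' h => ?_⟩, hzle⟩
      by_contra! hlt
      obtain ⟨a, ha, h2⟩ := prefers_of_lt (hF M hM) (hF N hN) h hz hlt
      obtain rfl := (hF N hN).yuniq ha hz
      obtain ⟨w, hw⟩ := exists_left (hF N hN) (hF M hM) hz
      exact absurd (h2 w hw) (not_lt.2 (hmax w ⟨M, hM, hw⟩))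

end Stab

end Opposition

namespace Marriage

variable {p q : ℕ}

/-! ## Ranks -/

/-- The position of `y` on the list of `x`. -/
def rx (T : Marriage p q) (x : Fin p) (y : Fin q) : ℕ := (T.xs x).idxOf y

/-- The position of `x` on the list of `y`. -/
def ry (T : Marriage p q) (y : Fin q) (x : Fin p) : ℕ := (T.ys y).idxOf x

theorem mem_edges {T : Marriage p q} {x : Fin p} {y : Fin q} :
    (x, y) ∈ T.edges ↔ y ∈ T.xs x := Iff.rfl

theorem mem_edges' {T : Marriage p q} {x : Fin p} {y : Fin q} :
    (x, y) ∈ T.edges ↔ x ∈ T.ys y := T.symm x y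

theorem rx_inj {T : Marriage p q} {x : Fin p} {y y' : Fin q} (h : (x, y) ∈ T.edges)
    (he : T.rx x y = T.rx x y') : y = y' := (List.idxOf_inj (mem_edges.1 h)).1 he

theorem ry_inj {T : Marriage p q} {y : Fin q} {x x' : Fin p} (h : (x, y) ∈ T.edges)
    (he : T.ry y x = T.ry y x') : x = x' := (List.idxOf_inj (mem_edges'.1 h)).1 he

theorem _root_.List.Sublist.idxOf_lt_iff {α : Type*} [DecidableEq α] {l' l : List α}
    (h : l'.Sublist l) (hl : l.Nodup) {a b : α} (ha : a ∈ l') (hb : b ∈ l') :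
    l'.idxOf a < l'.idxOf b ↔ l.idxOf a < l.idxOf b := by
  induction h with
  | slnil => simp at ha
  | cons c h ih =>
    rw [List.nodup_cons] at hl
    rw [ih hl.2 ha hb,
      List.idxOf_cons_ne _ fun e : c = a => hl.1 (e ▸ h.subset ha),
      List.idxOf_cons_ne _ fun e : c = b => hl.1 (e ▸ h.subset hb)]
    omega
  | cons_cons c h ih =>
    rw [List.nodup_cons] at hl
    rcases eq_or_ne c b with rfl | hcb
    · simp
    rcases eq_or_ne c a with rfl | hca
    · simp [List.idxOf_cons_ne _ hcb]
    rw [List.idxOf_cons_ne _ hcb, List.idxOf_cons_ne _ hca, List.idxOf_cons_ne _ hcb,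
      List.idxOf_cons_ne _ hca, Nat.succ_lt_succ_iff, Nat.succ_lt_succ_iff]
    exact ih hl.2 (by simpa [hca.symm] using ha) (by simpa [hcb.symm] using hb)

theorem Subtable.refl (T : Marriage p q) : T.Subtable T :=
  ⟨fun _ => List.Sublist.refl _, fun _ => List.Sublist.refl _⟩

theorem restrict_subtable (T : Marriage p q) (E : Set (Fin p × Fin q)) :
    (T.restrict E).Subtable T :=
  ⟨fun _ => List.filter_sublist, fun _ => List.filter_sublist⟩

theorem mem_edges_restrict {T : Marriage p q} {E : Set (Fin p × Fin q)} {e : Fin p × Fin q} :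
    e ∈ (T.restrict E).edges ↔ e ∈ T.edges ∧ e ∈ E := by
  simp [edges, restrict]

/-! ### Subtables of one ambient table and its ranks -/

section Subtable

variable {S T : Marriage p q} {M N Z : Set (Fin p × Fin q)} {ρ σ : Rot p q}

theorem Subtable.edges_subset (hS : S.Subtable T) : S.edges ⊆ T.edges :=
  fun e he => (hS.1 e.1).subset he

/-- Deleting edges keeps the order, so the ranks in the ambient table `T` serve all its subtables at
once. This makes `T'` and `T* = T' ∪ E(R)` comparable. -/
theorem Subtable.xpref_iff (hS : S.Subtable T) {x : Fin p} {y y' : Fin q} :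
    S.XPref x y y' ↔ (x, y) ∈ S.edges ∧ (x, y') ∈ S.edges ∧ T.rx x y < T.rx x y' := by
  constructor
  · rintro ⟨h1, h2⟩
    have h3 : y ∈ S.xs x := List.idxOf_lt_length_iff.1 (h2.trans_le List.idxOf_le_length)
    exact ⟨h3, h1, ((hS.1 x).idxOf_lt_iff (T.xs_nodup x) h3 h1).1 h2⟩
  · rintro ⟨h3, h1, h2⟩
    exact ⟨h1, ((hS.1 x).idxOf_lt_iff (T.xs_nodup x) h3 h1).2 h2⟩

theorem Subtable.ypref_iff (hS : S.Subtable T) {y : Fin q} {x x' : Fin p} :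
    S.YPref y x x' ↔ (x, y) ∈ S.edges ∧ (x', y) ∈ S.edges ∧ T.ry y x < T.ry y x' := by
  rw [mem_edges', mem_edges']
  constructor
  · rintro ⟨h1, h2⟩
    have h3 : x ∈ S.ys y := List.idxOf_lt_length_iff.1 (h2.trans_le List.idxOf_le_length)
    exact ⟨h3, h1, ((hS.2 y).idxOf_lt_iff (T.ys_nodup y) h3 h1).1 h2⟩
  · rintro ⟨h3, h1, h2⟩
    exact ⟨h1, ((hS.2 y).idxOf_lt_iff (T.ys_nodup y) h3 h1).2 h2⟩

theorem Subtable.isStable_iff (hS : S.Subtable T) :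
    S.IsStable M ↔ S.IsMatching M ∧ ∀ x y, (x, y) ∈ S.edges →
      (∃ y', (x, y') ∈ M ∧ T.rx x y' ≤ T.rx x y) ∨
        ∃ x', (x', y) ∈ M ∧ T.ry y x' ≤ T.ry y x := by
  refine and_congr_right fun hM => forall₂_congr fun x y => ?_
  constructor
  · intro h hxy
    by_contra! hc
    exact h ⟨hxy, fun y' h' => hS.xpref_iff.2 ⟨hxy, hM.1 h', hc.1 y' h'⟩,
      fun x' h' => hS.ypref_iff.2 ⟨hxy, hM.1 h', hc.2 x' h'⟩⟩
  · rintro h ⟨hxy, h1, h2⟩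
    rcases h hxy with ⟨y', h', hle⟩ | ⟨x', h', hle⟩
    · exact absurd (hS.xpref_iff.1 (h1 _ h')).2.2 (not_lt.2 hle)
    · exact absurd (hS.ypref_iff.1 (h2 _ h')).2.2 (not_lt.2 hle)

/-- A set of pairs as a relation. -/
abbrev rel (M : Set (Fin p × Fin q)) : Fin p → Fin q → Prop := fun x y => (x, y) ∈ M

theorem Subtable.isStable_iff_stab (hS : S.Subtable T) :
    S.IsStable M ↔ Stab T.rx T.ry (rel S.edges) (rel M) := by
  rw [hS.isStable_iff]
  constructor
  · rintro ⟨⟨h1, h2, h3⟩, h4⟩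
    exact ⟨fun h _ => rx_inj (hS.edges_subset h), fun h _ => ry_inj (hS.edges_subset h),
      fun h => h1 h, h2 _ _ _, h3 _ _ _, h4 _ _⟩
  · intro h
    exact ⟨⟨fun _ => h.sub, fun _ _ _ => h.xuniq, fun _ _ _ => h.yuniq⟩, fun _ _ => h.stable⟩

theorem IsStable.mem_edges (h : S.IsStable M) {e : Fin p × Fin q} (he : e ∈ M) : e ∈ S.edges :=
  h.1.1 he

theorem IsMatching.eq_of_fst_eq (h : S.IsMatching M) {a b : Fin p × Fin q} (ha : a ∈ M)
    (hb : b ∈ M) (hab : a.1 = b.1) : a = b :=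
  Prod.ext hab (h.2.1 a.1 _ _ ha (hab ▸ hb))

theorem IsMatching.eq_of_snd_eq (h : S.IsMatching M) {a b : Fin p × Fin q} (ha : a ∈ M)
    (hb : b ∈ M) (hab : a.2 = b.2) : a = b :=
  Prod.ext (h.2.2 _ _ a.2 ha (hab ▸ hb)) hab

theorem Subtable.exposed_iff (hS : S.Subtable T) :
    S.Exposed M ρ ↔ S.IsStable M ∧ ρ ≠ Cycle.nil ∧ ρ.Nodup ∧ (∀ a ∈ ρ, a ∈ M) ∧
      ∀ a b, Follows ρ a b → (a.1, b.2) ∈ S.edges ∧ T.ry b.2 a.1 < T.ry b.2 b.1 ∧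
        T.rx a.1 a.2 < T.rx a.1 b.2 ∧ ∀ y, (a.1, y) ∈ S.edges → T.rx a.1 a.2 < T.rx a.1 y →
          T.rx a.1 y < T.rx a.1 b.2 → ∃ x, (x, y) ∈ M ∧ T.ry y x < T.ry y a.1 := by
  refine and_congr_right fun hM => and_congr_right fun _ => and_congr_right fun _ =>
    and_congr_right fun hρ => forall₂_congr fun a b => imp_congr_right fun hab => ?_
  have ha := hM.mem_edges (hρ a hab.left_mem)
  have hb := hM.mem_edges (hρ b hab.right_mem)
  rw [hS.xpref_iff, hS.ypref_iff]
  constructor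
  · rintro ⟨⟨h1, -, h2⟩, ⟨-, -, h3⟩, h4⟩
    refine ⟨h1, h2, h3, fun y hy h5 h6 => ?_⟩
    obtain ⟨x, hx, hlt⟩ := h4 y (hS.xpref_iff.2 ⟨ha, hy, h5⟩) (hS.xpref_iff.2 ⟨hy, h1, h6⟩)
    exact ⟨x, hx, (hS.ypref_iff.1 hlt).2.2⟩
  · rintro ⟨h1, h2, h3, h4⟩
    refine ⟨⟨h1, hb, h2⟩, ⟨ha, h1, h3⟩, fun y h5 h6 => ?_⟩
    have hy := (hS.xpref_iff.1 h5).2.1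
    obtain ⟨x, hx, hlt⟩ := h4 y hy (hS.xpref_iff.1 h5).2.2 (hS.xpref_iff.1 h6).2.2
    exact ⟨x, hx, hS.ypref_iff.2 ⟨hM.mem_edges hx, hy, hlt⟩⟩

theorem Subtable.xle_iff (hS : S.Subtable T) (hM : M ⊆ S.edges) (hN : N ⊆ S.edges) :
    S.XLe M N ↔ ∀ x y, (x, y) ∈ M → ∃ y', (x, y') ∈ N ∧ T.rx x y' ≤ T.rx x y := by
  refine forall₂_congr fun x y => imp_congr_right fun h => exists_congr fun y' =>
    and_congr_right fun h' => ?_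
  rw [hS.xpref_iff]
  constructor
  · rintro (rfl | h1)
    · exact le_rfl
    · exact h1.2.2.le
  · intro h1
    rcases h1.lt_or_eq with h1 | h1
    · exact Or.inr ⟨hN h', hM h, h1⟩
    · exact Or.inl (rx_inj (hS.edges_subset (hN h')) h1)

/-! ## Elimination of a rotation -/

theorem mem_elim_iff (hu : ∀ x y y', (x, y) ∈ M → (x, y') ∈ M → y = y') (hρ : ∀ a ∈ ρ, a ∈ M)
    {e : Fin p × Fin q} : e ∈ Rot.elim M ρ ↔ (e ∈ M ∧ e ∉ ρ) ∨ e ∈ Rot.shifted ρ := by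
  refine or_congr_left (and_congr_right fun he => ?_)
  constructor
  · exact fun h h' => h e h' rfl
  · rintro h ⟨x, y⟩ ha rfl
    obtain rfl : y = e.2 := hu _ _ _ (hρ _ ha) he
    exact h ha

theorem elim_unique (hM : S.IsMatching M) (hρ : ∀ a ∈ ρ, a ∈ M) (hnd : ρ.Nodup) :
    (∀ x y y', (x, y) ∈ Rot.elim M ρ → (x, y') ∈ Rot.elim M ρ → y = y') ∧
      ∀ x x' y, (x, y) ∈ Rot.elim M ρ → (x', y) ∈ Rot.elim M ρ → x = x' := by
  simp only [mem_elim_iff hM.2.1 hρ]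
  constructor
  · rintro x y y' (h1 | ⟨a, b, hab, h1⟩) (h2 | ⟨a', b', hab', h2⟩)
    · exact hM.2.1 _ _ _ h1.1 h2.1
    · obtain ⟨rfl, rfl⟩ := Prod.mk.inj h2
      have := hM.eq_of_fst_eq h1.1 (hρ _ hab'.left_mem) rfl
      exact absurd (this ▸ hab'.left_mem) h1.2
    · obtain ⟨rfl, rfl⟩ := Prod.mk.inj h1
      have := hM.eq_of_fst_eq h2.1 (hρ _ hab.left_mem) rfl
      exact absurd (this ▸ hab.left_mem) h2.2
    · obtain ⟨rfl, rfl⟩ := Prod.mk.inj h1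
      obtain ⟨h3, rfl⟩ := Prod.mk.inj h2
      obtain rfl := hM.eq_of_fst_eq (hρ _ hab.left_mem) (hρ _ hab'.left_mem) h3
      rw [hab.right_unique hnd hab']
  · rintro x x' y (h1 | ⟨a, b, hab, h1⟩) (h2 | ⟨a', b', hab', h2⟩)
    · exact hM.2.2 _ _ _ h1.1 h2.1
    · obtain ⟨rfl, rfl⟩ := Prod.mk.inj h2
      have := hM.eq_of_snd_eq h1.1 (hρ _ hab'.right_mem) rfl
      exact absurd (this ▸ hab'.right_mem) h1.2
    · obtain ⟨rfl, rfl⟩ := Prod.mk.inj h1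
      have := hM.eq_of_snd_eq h2.1 (hρ _ hab.right_mem) rfl
      exact absurd (this ▸ hab.right_mem) h2.2
    · obtain ⟨rfl, rfl⟩ := Prod.mk.inj h1
      obtain ⟨rfl, h3⟩ := Prod.mk.inj h2
      obtain rfl := hM.eq_of_snd_eq (hρ _ hab.right_mem) (hρ _ hab'.right_mem) h3
      rw [hab.left_unique hnd hab']

theorem Exposed.mem_elim_iff (h : S.Exposed M ρ) {e : Fin p × Fin q} :
    e ∈ Rot.elim M ρ ↔ (e ∈ M ∧ e ∉ ρ) ∨ e ∈ Rot.shifted ρ :=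
  Marriage.mem_elim_iff h.1.1.2.1 h.2.2.2.1

theorem Exposed.exists_x (h : S.Exposed M ρ) (hS : S.Subtable T) {x : Fin p} {y : Fin q}
    (hxy : (x, y) ∈ M) : ∃ y', (x, y') ∈ Rot.elim M ρ ∧ T.rx x y ≤ T.rx x y' := by
  by_cases hm : (x, y) ∈ ρ
  · obtain ⟨b, hb⟩ := exists_follows_right hm
    exact ⟨b.2, h.mem_elim_iff.2 (Or.inr ⟨_, b, hb, rfl⟩),
      ((hS.exposed_iff.1 h).2.2.2.2 _ _ hb).2.2.1.le⟩
  · exact ⟨y, h.mem_elim_iff.2 (Or.inl ⟨hxy, hm⟩), le_rfl⟩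

theorem Exposed.exists_y (h : S.Exposed M ρ) (hS : S.Subtable T) {x : Fin p} {y : Fin q}
    (hxy : (x, y) ∈ M) : ∃ x', (x', y) ∈ Rot.elim M ρ ∧ T.ry y x' ≤ T.ry y x := by
  by_cases hm : (x, y) ∈ ρ
  · obtain ⟨a, ha⟩ := exists_follows_left hm
    exact ⟨a.1, h.mem_elim_iff.2 (Or.inr ⟨a, _, ha, rfl⟩),
      ((hS.exposed_iff.1 h).2.2.2.2 _ _ ha).2.1.le⟩
  · exact ⟨x, h.mem_elim_iff.2 (Or.inl ⟨hxy, hm⟩), le_rfl⟩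

theorem Exposed.exists_of_mem_elim (h : S.Exposed M ρ) (hS : S.Subtable T) {x : Fin p} {y : Fin q}
    (hxy : (x, y) ∈ Rot.elim M ρ) : ∃ y', (x, y') ∈ M ∧ T.rx x y' ≤ T.rx x y := by
  rcases h.mem_elim_iff.1 hxy with h1 | ⟨a, b, hab, he⟩
  · exact ⟨y, h1.1, le_rfl⟩
  · obtain ⟨rfl, rfl⟩ := Prod.mk.inj he
    exact ⟨a.2, h.2.2.2.1 _ hab.left_mem, ((hS.exposed_iff.1 h).2.2.2.2 _ _ hab).2.2.1.le⟩

/-- `Y`-agents only gain, so an edge can become dangerous only if its `X`-agent is moved past it.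
For `y` strictly between `y_i` and `y_{i+1}` the last condition of exposure gives `y` a better
partner already in `M`. -/
theorem Exposed.isStable_elim (h : S.Exposed M ρ) : S.IsStable (Rot.elim M ρ) := by
  have hS := Subtable.refl S
  have h' := hS.exposed_iff.1 h
  obtain ⟨hM, -, hnd, hρ, hf⟩ := h'
  refine hS.isStable_iff.2 ⟨⟨?_, elim_unique hM.1 hρ hnd⟩, ?_⟩
  · intro e he
    rcases h.mem_elim_iff.1 he with h1 | ⟨a, b, hab, rfl⟩
    · exact hM.mem_edges h1.1
    · exact (hf _ _ hab).1
  · intro x y hxy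
    have hy : ∀ x', (x', y) ∈ M → S.ry y x' ≤ S.ry y x →
        ∃ x', (x', y) ∈ Rot.elim M ρ ∧ S.ry y x' ≤ S.ry y x := by
      intro x' h1 h2
      obtain ⟨x'', h3, h4⟩ := h.exists_y hS h1
      exact ⟨x'', h3, h4.trans h2⟩
    rcases (hS.isStable_iff.1 hM).2 x y hxy with ⟨y', h1, hle⟩ | ⟨x', h1, hle⟩
    swap
    · exact Or.inr (hy x' h1 hle)
    by_cases hm : (x, y') ∈ ρ
    swap
    · exact Or.inl ⟨y', h.mem_elim_iff.2 (Or.inl ⟨h1, hm⟩), hle⟩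
    obtain ⟨b, hb⟩ := exists_follows_right hm
    rcases le_or_gt (S.rx x b.2) (S.rx x y) with h2 | h2
    · exact Or.inl ⟨b.2, h.mem_elim_iff.2 (Or.inr ⟨_, b, hb, rfl⟩), h2⟩
    right
    rcases hle.eq_or_lt with h3 | h3
    · obtain rfl := rx_inj (hM.mem_edges h1) h3
      exact hy x h1 le_rfl
    · obtain ⟨x', h4, h5⟩ := (hf _ _ hb).2.2.2 y hxy h3 h2
      exact hy x' h4 h5.le

/-! ## Sequences of eliminations -/

theorem elimSeq_append {M Z : Set (Fin p × Fin q)} {L L' : List (Rot p q)} :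
    S.ElimSeq M (L ++ L') Z ↔ ∃ K, S.ElimSeq M L K ∧ S.ElimSeq K L' Z := by
  induction L generalizing M with
  | nil => simp [ElimSeq]
  | cons σ L ih =>
    simp only [List.cons_append, ElimSeq, ih]
    constructor
    · rintro ⟨h, K, h1, h2⟩; exact ⟨K, ⟨h, h1⟩, h2⟩
    · rintro ⟨K, ⟨h, h1⟩, h2⟩; exact ⟨h, K, h1, h2⟩

theorem ElimSeq.isStable {L : List (Rot p q)} (h : S.ElimSeq M L Z) (hM : S.IsStable M) :
    S.IsStable Z := by
  induction L generalizing M with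
  | nil => rwa [show Z = M from h]
  | cons σ L ih => exact ih h.2 h.1.isStable_elim

theorem ElimSeq.mem_RX {L : List (Rot p q)} (h : S.ElimSeq M L Z) (hσ : σ ∈ L) : σ ∈ S.RX := by
  induction L generalizing M with
  | nil => simp at hσ
  | cons τ L ih =>
    rcases List.mem_cons.1 hσ with rfl | hσ
    · exact ⟨M, h.1⟩
    · exact ih h.2 hσ

theorem ElimSeq.exists_x {L : List (Rot p q)} (h : S.ElimSeq M L Z) (hS : S.Subtable T) {x : Fin p}
    {y : Fin q} (hxy : (x, y) ∈ M) : ∃ z, (x, z) ∈ Z ∧ T.rx x y ≤ T.rx x z := by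
  induction L generalizing M y with
  | nil => exact ⟨y, by rwa [show Z = M from h], le_rfl⟩
  | cons τ L ih =>
    obtain ⟨y', h1, h2⟩ := h.1.exists_x hS hxy
    obtain ⟨z, h3, h4⟩ := ih h.2 h1
    exact ⟨z, h3, h2.trans h4⟩

theorem ElimSeq.exists_y {L : List (Rot p q)} (h : S.ElimSeq M L Z) (hS : S.Subtable T) {x : Fin p}
    {y : Fin q} (hxy : (x, y) ∈ M) : ∃ x', (x', y) ∈ Z ∧ T.ry y x' ≤ T.ry y x := by
  induction L generalizing M x with
  | nil => exact ⟨x, by rwa [show Z = M from h], le_rfl⟩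
  | cons τ L ih =>
    obtain ⟨x', h1, h2⟩ := h.1.exists_y hS hxy
    obtain ⟨z, h3, h4⟩ := ih h.2 h1
    exact ⟨z, h3, h4.trans h2⟩

theorem ElimSeq.rx_le_of_mem {L : List (Rot p q)} (h : S.ElimSeq M L Z) (hM : S.IsStable M)
    (hS : S.Subtable T) (hσ : σ ∈ L) {a : Fin p × Fin q} (ha : a ∈ σ) {y : Fin q}
    (hy : (a.1, y) ∈ M) : T.rx a.1 y ≤ T.rx a.1 a.2 := by
  induction L generalizing M y with
  | nil => simp at hσ
  | cons τ L ih =>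
    rcases List.mem_cons.1 hσ with rfl | hσ
    · rw [hM.1.2.1 _ _ _ hy (h.1.2.2.2.1 _ ha)]
    · obtain ⟨y', h1, h2⟩ := h.1.exists_x hS hy
      exact h2.trans (ih h.2 h.1.isStable_elim hσ h1)

theorem ElimSeq.le_rx_of_mem {L : List (Rot p q)} (h : S.ElimSeq M L Z) (hM : S.IsStable M)
    (hS : S.Subtable T) (hσ : σ ∈ L) {a b : Fin p × Fin q} (hab : Follows σ a b) {z : Fin q}
    (hz : (a.1, z) ∈ Z) : T.rx a.1 b.2 ≤ T.rx a.1 z := by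
  induction L generalizing M with
  | nil => simp at hσ
  | cons τ L ih =>
    rcases List.mem_cons.1 hσ with rfl | hσ
    · obtain ⟨z', h1, h2⟩ := h.2.exists_x hS (h.1.mem_elim_iff.2 (Or.inr ⟨a, b, hab, rfl⟩))
      rwa [(h.2.isStable h.1.isStable_elim).1.2.1 _ _ _ hz h1]
    · exact ih h.2 h.1.isStable_elim hσ

/-- Once a rotation is eliminated, its `X`-agents are strictly below the partners it requires and
never climb back. -/
theorem ElimSeq.nodup {L : List (Rot p q)} (h : S.ElimSeq M L Z) : L.Nodup := by
  induction L generalizing M with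
  | nil => simp
  | cons τ L ih =>
    refine List.nodup_cons.2 ⟨fun hτ => ?_, ih h.2⟩
    obtain ⟨a, ha⟩ := exists_mem_of_ne_nil h.1.2.1
    obtain ⟨b, hab⟩ := exists_follows_right ha
    have := h.2.rx_le_of_mem h.1.isStable_elim (Subtable.refl S) hτ ha
      (h.1.mem_elim_iff.2 (Or.inr ⟨a, b, hab, rfl⟩))
    exact absurd (((Subtable.refl S).exposed_iff.1 h.1).2.2.2.2 _ _ hab).2.2.1 (not_lt.2 this)

theorem ElimSeq.mem_or {L : List (Rot p q)} (h : S.ElimSeq M L Z) {e : Fin p × Fin q} (he : e ∈ Z) :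
    e ∈ M ∨ ∃ σ ∈ L, e ∈ Rot.shifted σ := by
  induction L generalizing M with
  | nil => exact Or.inl ((show Z = M from h) ▸ he)
  | cons τ L ih =>
    rcases ih h.2 with h1 | ⟨σ, h1, h2⟩
    · rcases h.1.mem_elim_iff.1 h1 with h1 | h1
      · exact Or.inl h1.1
      · exact Or.inr ⟨τ, by simp, h1⟩
    · exact Or.inr ⟨σ, by simp [h1], h2⟩

/-- The final partner of `x` under `L` is its initial one or was assigned by some rotation of `L`;
since `L'` also eliminates that rotation, it moves `x` at least as far. Applied both ways, it shows
that the result depends only on the set eliminated. -/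
theorem ElimSeq.xle_of_subset {L L' : List (Rot p q)} {Z' : Set (Fin p × Fin q)}
    (h : S.ElimSeq M L Z) (h' : S.ElimSeq M L' Z') (hM : S.IsStable M) (hL : ∀ σ ∈ L, σ ∈ L') :
    S.XLe Z' Z := by
  have hS := Subtable.refl S
  refine (hS.xle_iff (h'.isStable hM).1.1 (h.isStable hM).1.1).2 fun x z' hz' => ?_
  have st {K} (hK : S.IsStable K) := hS.isStable_iff_stab.1 hK
  obtain ⟨z, hz⟩ := (st (h'.isStable hM)).exists_right (st (h.isStable hM)) hz'
  refine ⟨z, hz, ?_⟩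
  rcases h.mem_or hz with h1 | ⟨σ, h1, a, b, hab, h2⟩
  · obtain ⟨z'', h2, h3⟩ := h'.exists_x hS h1
    rwa [(h'.isStable hM).1.2.1 _ _ _ hz' h2]
  · obtain ⟨rfl, rfl⟩ := Prod.mk.inj h2
    exact h'.le_rx_of_mem hM hS (hL _ h1) hab hz'

/-! ### Uniqueness of the base matching -/

theorem XLe.antisymm (h : S.XLe M N) (h' : S.XLe N M) (hM : S.IsStable M) (hN : S.IsStable N) :
    M = N := by
  have hS := Subtable.refl S
  rw [hS.xle_iff hM.1.1 hN.1.1] at h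
  rw [hS.xle_iff hN.1.1 hM.1.1] at h'
  ext ⟨x, y⟩
  constructor
  · intro hxy
    obtain ⟨y', h1, h2⟩ := h x y hxy
    obtain ⟨y'', h3, h4⟩ := h' x y' h1
    obtain rfl := hM.1.2.1 _ _ _ hxy h3
    rwa [rx_inj (hM.mem_edges hxy) (le_antisymm h4 h2)]
  · intro hxy
    obtain ⟨y', h1, h2⟩ := h' x y hxy
    obtain ⟨y'', h3, h4⟩ := h x y' h1
    obtain rfl := hN.1.2.1 _ _ _ hxy h3
    rwa [rx_inj (hN.mem_edges hxy) (le_antisymm h4 h2)]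

theorem IsXOptimal.unique (hM : S.IsXOptimal M) (hN : S.IsXOptimal N) : M = N :=
  (hN.2 M hM.1).antisymm (hM.2 N hN.1) hM.1 hN.1

theorem ElimSet.unique {R : Set (Rot p q)} {Z Z' : Set (Fin p × Fin q)} (hM : S.IsStable M)
    (h : S.ElimSet M R Z) (h' : S.ElimSet M R Z') : Z = Z' := by
  obtain ⟨L, -, hL, h⟩ := h
  obtain ⟨L', -, hL', h'⟩ := h'
  exact (h'.xle_of_subset h hM fun σ hσ => (hL σ).2 ((hL' σ).1 hσ)).antisymm
    (h.xle_of_subset h' hM fun σ hσ => (hL' σ).2 ((hL σ).1 hσ)) (h.isStable hM) (h'.isStable hM)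

theorem IsBase.unique (h : S.IsBase ρ M) (h' : S.IsBase ρ N) : M = N := by
  obtain ⟨MX, hX, h⟩ := h
  obtain ⟨MX', hX', h'⟩ := h'
  obtain rfl := hX.unique hX'
  exact h.unique hX.1 h'

end Subtable

end Marriage

namespace Marriage

variable {p q : ℕ} {S T : Marriage p q} {M N Z : Set (Fin p × Fin q)} {ρ σ : Rot p q}

/-! ## Rotations of a stable table -/

/-- In a stable table, `y_{i+1}` comes right after `y_i` on the list of `x_i`. -/
theorem Exposed.not_between_x (h : S.Exposed M ρ) (hS : S.Subtable T) (hst : S.StableTable)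
    {a b : Fin p × Fin q} (hab : Follows ρ a b) {y : Fin q} (hy : (a.1, y) ∈ S.edges)
    (h1 : T.rx a.1 a.2 < T.rx a.1 y) (h2 : T.rx a.1 y < T.rx a.1 b.2) : False := by
  obtain ⟨hM, -, -, hρ, hf⟩ := hS.exposed_iff.1 h
  obtain ⟨N, hN, hyN⟩ := hst _ hy
  obtain ⟨x, hx, hlt⟩ := (hf _ _ hab).2.2.2 y hy h1 h2
  -- The edge between lies in a stable `N`. As `x_i` prefers `M` to `N`, its partner `y` in `N`
  -- prefers `x_i` to `M(y)`, against exposure.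
  obtain ⟨x', hx', h3⟩ := Stab.prefers_of_lt (hS.isStable_iff_stab.1 hM)
    (hS.isStable_iff_stab.1 hN) (hρ _ hab.left_mem) hyN h1
  obtain rfl : x' = a.1 := hN.1.2.2 _ _ _ hx' hyN
  exact lt_asymm hlt (h3 x hx)

/-- In a stable table, `x_{i+1}` comes right after `x_i` on the list of `y_{i+1}`. -/
theorem Exposed.not_between_y (h : S.Exposed M ρ) (hS : S.Subtable T) (hst : S.StableTable)
    {a b : Fin p × Fin q} (hab : Follows ρ a b) {z : Fin p} (hz : (z, b.2) ∈ S.edges)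
    (h1 : T.ry b.2 a.1 < T.ry b.2 z) (h2 : T.ry b.2 z < T.ry b.2 b.1) : False := by
  obtain ⟨hM, -, -, hρ, hf⟩ := hS.exposed_iff.1 h
  obtain ⟨N, hN, hzN⟩ := hst _ hz
  have sM := hS.isStable_iff_stab.1 hM
  have sN := hS.isStable_iff_stab.1 hN
  have sM' := hS.isStable_iff_stab.1 h.isStable_elim
  have hbM := hρ _ hab.right_mem
  have haM' : (a.1, b.2) ∈ Rot.elim M ρ := h.mem_elim_iff.2 (Or.inr ⟨a, b, hab, rfl⟩)
  -- Opposition is used twice, for `N` against `M` and against `M/ρ`: `z` prefers `M(z)` to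
  -- `y_{i+1}` and `y_{i+1}` to its partner in `M/ρ`. So `ρ` would move `z` past an edge of the
  -- table, which `not_between_x` forbids.
  obtain ⟨w, hw, hwlt⟩ := Stab.prefers_flip sN.symm sM.symm
    ⟨z, hzN, fun x' hx' => by rwa [hM.1.2.2 _ _ _ hx' hbM]⟩ hzN
  obtain ⟨y', hy', hlt⟩ := Stab.prefers_of_lt sM'.symm sN.symm haM' hzN h1
  obtain rfl : y' = b.2 := hN.1.2.1 _ _ _ hy' hzN
  have hwb := hwlt _ hzN
  by_cases hm : (z, w) ∈ ρ
  · obtain ⟨c, hc⟩ := exists_follows_right hm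
    exact h.not_between_x hS hst hc hz hwb
      (hlt _ (h.mem_elim_iff.2 (Or.inr ⟨_, c, hc, rfl⟩)))
  · exact lt_asymm hwb (hlt _ (h.mem_elim_iff.2 (Or.inl ⟨hw, hm⟩)))

theorem Exposed.mem_edges_E (h : S.Exposed M ρ) {e : Fin p × Fin q} (he : e ∈ Rot.E ρ) :
    e ∈ S.edges := by
  rcases he with he | ⟨a, b, hab, rfl⟩
  · exact h.1.mem_edges (h.2.2.2.1 _ he)
  · exact (((Subtable.refl S).exposed_iff.1 h).2.2.2.2 _ _ hab).1

/-- The table alone determines the successor: `y_{i+1}` is next after `y_i` on the list of `x_i`,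
and `x_{i+1}` next after `x_i` on the list of `y_{i+1}`. -/
theorem StableTable.follows_unique (hst : S.StableTable) (hρ : ρ ∈ S.RX) (hσ : σ ∈ S.RX)
    {a b c : Fin p × Fin q} (hb : Follows ρ a b) (hc : Follows σ a c) : b = c := by
  obtain ⟨M, hM⟩ := hρ
  obtain ⟨N, hN⟩ := hσ
  have hS := Subtable.refl S
  have h1 := (hS.exposed_iff.1 hM).2.2.2.2 _ _ hb
  have h2 := (hS.exposed_iff.1 hN).2.2.2.2 _ _ hc
  have e2 : b.2 = c.2 := by
    refine rx_inj h1.1 (le_antisymm ?_ ?_)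
    · by_contra! hlt
      exact hM.not_between_x hS hst hb h2.1 h2.2.2.1 hlt
    · by_contra! hlt
      exact hN.not_between_x hS hst hc h1.1 h1.2.2.1 hlt
  have hbe := hM.mem_edges_E (Or.inl hb.right_mem)
  have hce := hN.mem_edges_E (Or.inl hc.right_mem)
  refine Prod.ext (ry_inj (y := b.2) hbe (le_antisymm ?_ ?_)) e2
  · by_contra! hlt
    refine hM.not_between_y hS hst hb (z := c.1) ?_ ?_ hlt <;> rw [e2]
    · exact hce
    · exact h2.2.1
  · rw [e2]
    by_contra! hlt
    refine hN.not_between_y hS hst hc (z := b.1) ?_ ?_ hlt <;> rw [← e2]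
    · exact hbe
    · exact h1.2.1

theorem StableTable.eq_of_mem (hst : S.StableTable) (hρ : ρ ∈ S.RX) (hσ : σ ∈ S.RX)
    {a : Fin p × Fin q} (ha : a ∈ ρ) (ha' : a ∈ σ) : ρ = σ := by
  obtain ⟨M, hM⟩ := id hρ
  obtain ⟨N, hN⟩ := id hσ
  exact eq_of_follows hM.2.2.1 hN.2.2.1 ha ha' fun _ _ _ h h' => hst.follows_unique hρ hσ h h'

theorem StableTable.exposed_of_subset (hst : S.StableTable) (hρ : ρ ∈ S.RX) (hN : S.IsStable N)
    (h : ∀ a ∈ ρ, a ∈ N) : S.Exposed N ρ := by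
  obtain ⟨M, hM⟩ := hρ
  have hS := Subtable.refl S
  have hM' := hS.exposed_iff.1 hM
  refine hS.exposed_iff.2 ⟨hN, hM'.2.1, hM'.2.2.1, h, fun a b hab => ?_⟩
  obtain ⟨h1, h2, h3, -⟩ := hM'.2.2.2.2 _ _ hab
  exact ⟨h1, h2, h3, fun y hy h4 h5 => (hM.not_between_x hS hst hab hy h4 h5).elim⟩

/-- If some `x` prefers `M` to `N`, then a rotation is exposed in `M` whose elimination leaves its
`X`-agents no worse off than in `N`. -/
theorem StableTable.exists_exposed (hst : S.StableTable) (hM : S.IsStable M) (hN : S.IsStable N)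
    {x₀ : Fin p} (h₀ : Prefers S.rx (rel M) (rel N) x₀) :
    ∃ ρ, S.Exposed M ρ ∧ ∀ a b, Follows ρ a b → ∀ y, (a.1, y) ∈ N → S.rx a.1 b.2 ≤ S.rx a.1 y := by
  have hS := Subtable.refl S
  have sM := hS.isStable_iff_stab.1 hM
  have sN := hS.isStable_iff_stab.1 hN
  obtain ⟨y₀, hy₀, -⟩ := id h₀
  obtain ⟨c, hc1, hc2, hc3, hc4, -⟩ := exists_cycle
    (P := {e | e ∈ M ∧ Prefers S.rx (rel M) (rel N) e.1})
    (r := fun a b => (a.1, b.2) ∈ S.edges ∧ S.ry b.2 a.1 < S.ry b.2 b.1 ∧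
      S.rx a.1 a.2 < S.rx a.1 b.2 ∧
      (∀ y, (a.1, y) ∈ S.edges → S.rx a.1 a.2 < S.rx a.1 y → S.rx a.1 b.2 ≤ S.rx a.1 y))
    (a₀ := (x₀, y₀)) (by
      rintro ⟨x, y⟩ ⟨hm, hpr⟩
      obtain ⟨yN, hyN, hprN⟩ := sM.exists_of_prefers sN hpr
      have hlt : S.rx x y < S.rx x yN := by
        obtain ⟨y', hy', hlt⟩ := hpr
        rw [hM.1.2.1 _ _ _ hm hy']
        exact hlt _ hyN
      -- The next `Y`-agent is the first one after `M(x)` on the list of `x`. The edge `xy'` lies in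
      -- a stable matching `K`; opposition between `M` and `K` gives `y'` a partner in `M` that it
      -- likes less than `x`.
      obtain ⟨y', ⟨h1, h2⟩, hmin⟩ := Set.exists_min_image
        {y' | (x, y') ∈ S.edges ∧ S.rx x y < S.rx x y'} (S.rx x) (Set.toFinite _)
        ⟨yN, hN.mem_edges hyN, hlt⟩
      obtain ⟨K, hK, hyK⟩ := hst _ h1
      have sK := hS.isStable_iff_stab.1 hK
      obtain ⟨x', hx', hprM⟩ := sM.exists_of_prefers_flip sK (Stab.prefers_of_lt sM sK hm hyK h2)
      have hry : S.ry y' x < S.ry y' x' := by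
        obtain ⟨z, hz, hlt'⟩ := Stab.prefers_of_lt sM sK hm hyK h2
        obtain rfl := hK.1.2.2 _ _ _ hyK hz
        exact hlt' _ hx'
      -- Stability of `N` on `xy'`: since `N(x)` does not come before `y'`, the agent `y'` does at
      -- least as well as `x` in `N`. So `y'` prefers `N` to `M`, its `M`-partner prefers `M` to
      -- `N`, and the walk continues.
      have hy'N : ∃ z, (z, y') ∈ N ∧ S.ry y' z ≤ S.ry y' x := by
        rcases sN.stable h1 with ⟨w, hw, hle⟩ | h
        · obtain rfl := hN.1.2.1 _ _ _ hw hyN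
          have := rx_inj h1 (le_antisymm (hmin w ⟨hN.mem_edges hyN, hlt⟩) hle)
          subst this
          exact ⟨x, hyN, le_rfl⟩
        · exact h
      obtain ⟨z, hz, hzle⟩ := hy'N
      obtain ⟨x'', hx'', hpr''⟩ := sM.exists_of_prefers_flip sN (y := y')
        ⟨z, hz, fun w hw => by rw [hM.1.2.2 _ _ _ hw hx']; omega⟩
      obtain rfl := hM.1.2.2 _ _ _ hx'' hx'
      exact ⟨(x'', y'), ⟨hx'', hpr''⟩, h1, hry, h2, fun w hw h => hmin w ⟨hw, h⟩⟩) ⟨hy₀, h₀⟩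
  refine ⟨c, hS.exposed_iff.2 ⟨hM, hc1, hc2, fun a ha => (hc3 a ha).1, fun a b hab => ?_⟩,
    fun a b hab y hy => ?_⟩
  · obtain ⟨h1, h2, h3, h4⟩ := hc4 a b hab
    exact ⟨h1, h2, h3, fun y hy h5 h6 => absurd (h4 y hy h5) (not_le.2 h6)⟩
  · obtain ⟨hm, y', hy', hlt⟩ := hc3 a hab.left_mem
    obtain rfl := hM.1.2.1 _ _ _ hy' hm
    exact (hc4 a b hab).2.2.2 y (hN.mem_edges hy) (hlt y hy)

/-- The edges below `M` on the lists of the `X`-agents. -/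
def below (S : Marriage p q) (M : Set (Fin p × Fin q)) : Set (Fin p × Fin q) :=
  {e | e ∈ S.edges ∧ ∃ y, (e.1, y) ∈ M ∧ S.rx e.1 y < S.rx e.1 e.2}

theorem Exposed.below_elim (h : S.Exposed M ρ) :
    (S.below (Rot.elim M ρ)).ncard < (S.below M).ncard := by
  have hS := Subtable.refl S
  refine Set.ncard_lt_ncard ⟨?_, fun hsub => ?_⟩ (Set.toFinite _)
  · rintro e ⟨he, y, hy, hlt⟩
    obtain ⟨y', hy', hle⟩ := h.exists_of_mem_elim hS hy
    exact ⟨he, y', hy', by omega⟩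
  · obtain ⟨a, ha⟩ := exists_mem_of_ne_nil h.2.1
    obtain ⟨b, hab⟩ := exists_follows_right ha
    have hf := (hS.exposed_iff.1 h).2.2.2.2 _ _ hab
    obtain ⟨-, y, hy, hlt⟩ := hsub
      (show (a.1, b.2) ∈ S.below M from ⟨hf.1, a.2, h.2.2.2.1 _ ha, hf.2.2.1⟩)
    rw [h.isStable_elim.1.2.1 _ _ _ hy (h.mem_elim_iff.2 (Or.inr ⟨a, b, hab, rfl⟩))] at hlt
    exact lt_irrefl _ hlt

/-- As long as some agent prefers the current matching, `exists_exposed` supplies a rotation that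
does not overshoot `N`, so a descent starting above `N` ends at `N` exactly. Each elimination
shrinks `below`. -/
theorem StableTable.exists_elimSeq (hst : S.StableTable) (hM : S.IsStable M) (hN : S.IsStable N) :
    ∃ L Z, S.ElimSeq M L Z ∧ S.XLe Z N ∧ (S.XLe N M → Z = N) := by
  have hS := Subtable.refl S
  have sN := hS.isStable_iff_stab.1 hN
  induction hn : (S.below M).ncard using Nat.strong_induction_on generalizing M with
  | h n ih =>
    have sM := hS.isStable_iff_stab.1 hM
    by_cases hp : ∃ x, Prefers S.rx (rel M) (rel N) x
    · obtain ⟨x, hx⟩ := hp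
      obtain ⟨ρ, hρ, hle⟩ := hst.exists_exposed hM hN hx
      obtain ⟨L, Z, h1, h2, h3⟩ := ih _ (hn ▸ hρ.below_elim) hρ.isStable_elim rfl
      refine ⟨ρ :: L, Z, ⟨hρ, h1⟩, h2, fun h => h3 ?_⟩
      rw [hS.xle_iff hN.1.1 hM.1.1] at h
      rw [hS.xle_iff hN.1.1 hρ.isStable_elim.1.1]
      intro x y hxy
      obtain ⟨y', h4, h5⟩ := h x y hxy
      by_cases hm : (x, y') ∈ ρ
      · obtain ⟨b, hb⟩ := exists_follows_right hm
        exact ⟨b.2, hρ.mem_elim_iff.2 (Or.inr ⟨_, b, hb, rfl⟩), hle _ _ hb y hxy⟩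
      · exact ⟨y', hρ.mem_elim_iff.2 (Or.inl ⟨h4, hm⟩), h5⟩
    · have hle : S.XLe M N := by
        rw [hS.xle_iff hM.1.1 hN.1.1]
        intro x y hxy
        obtain ⟨y', hy'⟩ := sM.exists_right sN hxy
        refine ⟨y', hy', ?_⟩
        by_contra! hlt
        exact hp ⟨x, y, hxy, fun z hz => by rwa [hN.1.2.1 _ _ _ hz hy']⟩
      exact ⟨[], M, rfl, hle, fun h => hle.antisymm h hM hN⟩

/-- No elimination moves an agent over an edge of a stable table. On its way down the agent
therefore stops at the partner given by `a`, and the only rotation containing `a` is `σ`. -/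
theorem StableTable.mem_of_passed (hst : S.StableTable) {L : List (Rot p q)} (h : S.ElimSeq M L Z)
    (hM : S.IsStable M) (hσ : σ ∈ S.RX) {a b : Fin p × Fin q} (hab : Follows σ a b) {y z : Fin q}
    (hy : (a.1, y) ∈ M) (hz : (a.1, z) ∈ Z) (hle : S.rx a.1 y ≤ S.rx a.1 a.2)
    (hle' : S.rx a.1 b.2 ≤ S.rx a.1 z) : σ ∈ L := by
  have hS := Subtable.refl S
  obtain ⟨K, hK⟩ := id hσ
  have hlt := ((hS.exposed_iff.1 hK).2.2.2.2 _ _ hab).2.2.1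
  induction L generalizing M y with
  | nil =>
    obtain rfl := show Z = M from h
    rw [hM.1.2.1 _ _ _ hy hz] at hle
    omega
  | cons τ L ih =>
    by_cases ha : a ∈ τ
    · rw [hst.eq_of_mem hσ ⟨M, h.1⟩ hab.left_mem ha]
      simp
    refine List.mem_cons_of_mem _ ?_
    by_cases hm : (a.1, y) ∈ τ
    · obtain ⟨d, hd⟩ := exists_follows_right hm
      refine ih h.2 h.1.isStable_elim (h.1.mem_elim_iff.2 (Or.inr ⟨_, d, hd, rfl⟩)) ?_
      by_contra! hlt'
      rcases hle.eq_or_lt with he | hlt''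
      · have := rx_inj (hM.mem_edges hy) he
        subst this
        exact ha hm
      · exact h.1.not_between_x hS hst hd (hK.mem_edges_E (Or.inl hab.left_mem)) hlt'' hlt'
    · exact ih h.2 h.1.isStable_elim (h.1.mem_elim_iff.2 (Or.inl ⟨hy, hm⟩)) hle

/-- Among the stable matchings that contain `P`, one is the best for all `X`-agents. -/
theorem exists_greatest {P : Set (Fin p × Fin q)} (h : ∃ M, S.IsStable M ∧ P ⊆ M) :
    ∃ N, S.IsStable N ∧ P ⊆ N ∧ ∀ M, S.IsStable M → P ⊆ M → S.XLe M N := by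
  have hS := Subtable.refl S
  obtain ⟨M₀, hM₀, hP₀⟩ := h
  have hst := Stab.sup (F := {f | ∃ M, S.IsStable M ∧ P ⊆ M ∧ f = rel M})
    ⟨rel M₀, M₀, hM₀, hP₀, rfl⟩
    (by rintro _ ⟨M, hM, -, rfl⟩; exact hS.isStable_iff_stab.1 hM)
  set N : Set (Fin p × Fin q) := {e |
    (∃ f ∈ {f | ∃ M, S.IsStable M ∧ P ⊆ M ∧ f = rel M}, f e.1 e.2) ∧
    ∀ f ∈ {f | ∃ M, S.IsStable M ∧ P ⊆ M ∧ f = rel M}, ∀ y, f e.1 y → S.rx e.1 e.2 ≤ S.rx e.1 y}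
    with hNdef
  have hN : S.IsStable N := hS.isStable_iff_stab.2 hst
  refine ⟨N, hN, fun e he => ⟨⟨_, ⟨M₀, hM₀, hP₀, rfl⟩, hP₀ he⟩, ?_⟩, fun M hM hPM => ?_⟩
  · rintro _ ⟨M, hM, hPM, rfl⟩ y hy
    exact le_of_eq (by rw [hM.1.2.1 _ _ _ hy (hPM he)])
  · refine (hS.xle_iff hM.1.1 hN.1.1).2 fun x y hxy => ?_
    obtain ⟨y', hy'⟩ := (hS.isStable_iff_stab.1 hM).exists_right (hS.isStable_iff_stab.1 hN) hxy
    exact ⟨y', hy', hy'.2 _ ⟨M, hM, hPM, rfl⟩ _ hxy⟩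

/-- The predecessors of a rotation `ρ` of a stable table can be eliminated from the `X`-optimal
stable matching, and then `ρ` is exposed. -/
theorem StableTable.exists_isBase (hst : S.StableTable) (hρ : ρ ∈ S.RX) :
    ∃ M₀, S.IsBase ρ M₀ ∧ S.Exposed M₀ ρ := by
  have hS := Subtable.refl S
  obtain ⟨M, hM⟩ := id hρ
  obtain ⟨MX, hX, -, hXmax⟩ := exists_greatest (S := S) (P := ∅) ⟨M, hM.1, by simp⟩
  replace hXmax : ∀ M, S.IsStable M → S.XLe M MX := fun M hM => hXmax M hM (by simp)
  -- This `N` turns out to be `M⁰`: the rotations eliminated on a way from the `X`-optimal matching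
  -- to `N` are exactly the predecessors of `ρ`.
  obtain ⟨N, hN, hPN, hNmax⟩ := exists_greatest (S := S) (P := Rot.pairs ρ) ⟨M, hM.1, hM.2.2.2.1⟩
  have hexp := hst.exposed_of_subset hρ hN hPN
  obtain ⟨L, N', hL, -, hN'⟩ := hst.exists_elimSeq hX hN
  obtain rfl := hN' (hXmax N hN)
  have hstart : ∀ {MX σ a y}, S.IsXOptimal MX → σ ∈ S.RX → a ∈ σ → (a.1, y) ∈ MX →
      S.rx a.1 y ≤ S.rx a.1 a.2 := by
    rintro MX σ a y hX ⟨K, hK⟩ ha hy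
    obtain ⟨y', h1, h2⟩ := (hS.xle_iff hK.1.1.1 hX.1.1.1).1 (hX.2 K hK.1) a.1 a.2 (hK.2.2.2.1 a ha)
    rwa [hX.1.1.2.1 _ _ _ hy h1]
  have hXopt : S.IsXOptimal MX := ⟨hX, hXmax⟩
  have hright : ∀ {K K' : Set (Fin p × Fin q)} {x y}, S.IsStable K → S.IsStable K' → (x, y) ∈ K →
      ∃ y', (x, y') ∈ K' := fun hK hK' h =>
    (hS.isStable_iff_stab.1 hK).exists_right (hS.isStable_iff_stab.1 hK') h
  refine ⟨N', ⟨MX, hXopt, L, hL.nodup, fun σ => ⟨fun hσ => ?_, ?_⟩, hL⟩, hexp⟩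
  · have hσX := hL.mem_RX hσ
    obtain ⟨J, hJ⟩ := id hσX
    obtain ⟨a, ha⟩ := exists_mem_of_ne_nil hJ.2.1
    obtain ⟨b, hab⟩ := exists_follows_right ha
    have haJ := hJ.2.2.2.1 a ha
    refine ⟨hσX, ?_, fun MX' L' Z hX' hL' hρL _ => ?_⟩
    · rintro rfl
      have h1 := hL.le_rx_of_mem hX hS hσ hab (hPN ha)
      have h2 := ((hS.exposed_iff.1 hexp).2.2.2.2 _ _ hab).2.2.1
      omega
    -- The matching `K` from which any sequence eliminates `ρ` contains the pairs of `ρ`, so it is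
    -- weakly below `N`. What is passed on the way to `N` has been passed on the way to `K`.
    · obtain ⟨A, B, rfl⟩ := List.append_of_mem hρL
      obtain ⟨K, hA, hK⟩ := elimSeq_append.1 hL'
      obtain ⟨y, hy⟩ := hright hJ.1 hX'.1 haJ
      obtain ⟨k, hk⟩ := hright hJ.1 hK.1.1 haJ
      obtain ⟨n, hn, hnk⟩ := (hS.xle_iff hK.1.1.1.1 hN.1.1).1
        (hNmax K hK.1.1 hK.1.2.2.2.1) a.1 k hk
      have : σ ∈ A := hst.mem_of_passed hA hX'.1 hσX hab hy hk (hstart hX' hσX ha hy)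
        ((hL.le_rx_of_mem hX hS hσ hab hn).trans hnk)
      exact (List.singleton_sublist.2 this).append (List.singleton_sublist.2 (by simp))
  · rintro ⟨hσX, hne, hprec⟩
    obtain ⟨J, hJ⟩ := id hσX
    obtain ⟨a, ha⟩ := exists_mem_of_ne_nil hJ.2.1
    obtain ⟨b, hab⟩ := exists_follows_right ha
    have haJ := hJ.2.2.2.1 a ha
    -- Conversely, continue beyond `ρ` until `σ` must have been eliminated. A predecessor precedes
    -- `ρ` in this particular sequence, and since `ρ` occurs only once, it lies in `L`.
    obtain ⟨L₂, Z, hL₂, hZ, -⟩ := hst.exists_elimSeq hexp.isStable_elim hJ.isStable_elim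
    have hall : S.ElimSeq MX (L ++ ρ :: L₂) Z := elimSeq_append.2 ⟨N', hL, hexp, hL₂⟩
    have hZs := hall.isStable hX
    obtain ⟨y, hy⟩ := hright hJ.1 hX haJ
    obtain ⟨z, hz⟩ := hright hJ.1 hZs haJ
    obtain ⟨w, hw, hwz⟩ := (hS.xle_iff hZs.1.1 hJ.isStable_elim.1.1).1 hZ a.1 z hz
    rw [hJ.isStable_elim.1.2.1 _ _ _ hw (hJ.mem_elim_iff.2 (Or.inr ⟨a, b, hab, rfl⟩))] at hwz
    have hmem := hst.mem_of_passed hall hX hσX hab hy hz (hstart hXopt hσX ha hy) hwz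
    have hsub := hprec MX _ Z hXopt hall (by simp) hmem
    obtain ⟨l₁, l₂, he, h1, h2⟩ := List.sublist_append_iff.1 hsub
    rcases l₁ with _ | ⟨c, l₁⟩
    · obtain rfl : [σ, ρ] = l₂ := by simpa using he
      rw [List.sublist_cons_iff] at h2
      rcases h2 with h2 | ⟨r, h2, -⟩
      · have hρL₂ : ρ ∈ L₂ := h2.subset (by simp)
        exact absurd hρL₂ (List.nodup_cons.1 (List.nodup_append.1 hall.nodup).2.1).1
      · exact absurd (List.cons.inj h2).1 hne
    · obtain rfl : σ = c := (List.cons.inj he).1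
      exact h1.subset (by simp)

end Marriage

open Marriage

/-! ## The cycles of the rotation digraph -/

section Digraph

variable {p q : ℕ} {T T' : Marriage p q} {M₀ : Set (Fin p × Fin q)} {ρ σ : Rot p q}

/-- The arcs `x → y` of the rotation digraph of the algorithm, in terms of `ρ` alone. -/
def RhoArc (T : Marriage p q) (ρ : Rot p q) (x : Fin p) (y : Fin q) : Prop :=
  (x, y) ∈ T.edges ∧ ∃ a b c d, Follows ρ a b ∧ Follows ρ c d ∧ x = a.1 ∧ y = d.2 ∧
    T.rx x a.2 < T.rx x y ∧ T.rx x y ≤ T.rx x b.2 ∧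
    T.ry y c.1 ≤ T.ry y x ∧ T.ry y x < T.ry y d.1

/-- The cyclic sequences that correspond to the cycles of the rotation digraph. -/
def IsRhoCycle (T : Marriage p q) (M₀ : Set (Fin p × Fin q)) (ρ σ : Rot p q) : Prop :=
  σ ≠ Cycle.nil ∧ σ.Nodup ∧ (∀ a ∈ σ, a ∈ M₀) ∧ ∀ a b, Follows σ a b → RhoArc T ρ a.1 b.2

theorem xle_of_eq_or_xpref {x : Fin p} {y y' : Fin q} (h : y = y' ∨ T.XPref x y y') :
    T.rx x y ≤ T.rx x y' := by
  rcases h with rfl | h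
  · exact le_rfl
  · exact h.2.le

theorem yle_of_eq_or_ypref {y : Fin q} {x x' : Fin p} (h : x = x' ∨ T.YPref y x x') :
    T.ry y x ≤ T.ry y x' := by
  rcases h with rfl | h
  · exact le_rfl
  · exact h.2.le

theorem eq_or_xpref {x : Fin p} {y y' : Fin q} (h : (x, y) ∈ T.edges) (h' : (x, y') ∈ T.edges)
    (hle : T.rx x y ≤ T.rx x y') : y = y' ∨ T.XPref x y y' := by
  rcases hle.eq_or_lt with he | hlt
  · exact Or.inl (rx_inj h he)
  · exact Or.inr ⟨h', hlt⟩

theorem eq_or_ypref {y : Fin q} {x x' : Fin p} (h : (x, y) ∈ T.edges) (h' : (x', y) ∈ T.edges)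
    (hle : T.ry y x ≤ T.ry y x') : x = x' ∨ T.YPref y x x' := by
  rcases hle.eq_or_lt with he | hlt
  · exact Or.inl (ry_inj h he)
  · exact Or.inr ⟨mem_edges'.1 h', hlt⟩

theorem mem_midTable_of_follows (hS : T'.Subtable T) (hρ : T'.Exposed M₀ ρ)
    {a b c d : Fin p × Fin q} (hab : Follows ρ a b) (hcd : Follows ρ c d)
    (he : (a.1, d.2) ∈ T.edges) (h1 : T.rx a.1 a.2 ≤ T.rx a.1 d.2)
    (h2 : T.rx a.1 d.2 ≤ T.rx a.1 b.2) (h3 : T.ry d.2 c.1 ≤ T.ry d.2 a.1)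
    (h4 : T.ry d.2 a.1 ≤ T.ry d.2 d.1) :
    (a.1, d.2) ∈ (midTable T M₀ (Rot.elim M₀ ρ)).edges := by
  have hM := hρ.1
  have hMs := hρ.isStable_elim
  have hab' : (a.1, b.2) ∈ Rot.elim M₀ ρ := hρ.mem_elim_iff.2 (Or.inr ⟨a, b, hab, rfl⟩)
  have hcd' : (c.1, d.2) ∈ Rot.elim M₀ ρ := hρ.mem_elim_iff.2 (Or.inr ⟨c, d, hcd, rfl⟩)
  have ha := hρ.2.2.2.1 _ hab.left_mem
  have hd := hρ.2.2.2.1 _ hcd.right_mem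
  have hT : ∀ {e}, e ∈ M₀ → e ∈ T.edges := fun h => hS.edges_subset (hM.mem_edges h)
  have hT' : ∀ {e}, e ∈ Rot.elim M₀ ρ → e ∈ T.edges := fun h => hS.edges_subset (hMs.mem_edges h)
  refine mem_edges_restrict.2 ⟨he, ⟨a.2, ha, eq_or_xpref (hT ha) he h1⟩, fun y hy => ?_,
    ⟨c.1, hcd', eq_or_ypref (hT' hcd') he h3⟩, fun x hx => ?_⟩
  · obtain rfl := hMs.1.2.1 _ _ _ hy hab'
    exact eq_or_xpref he (hT' hab') h2
  · obtain rfl := hM.1.2.2 _ _ _ hx hd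
    exact eq_or_ypref he (hT hd) h4

/-- An arc makes `x` strictly worse and `y` strictly better, but not beyond `M*`. Agents with the
same partner in `M⁰` and `M*` leave no room for this, so both ends of the arc belong to `ρ`. -/
theorem rotArc_iff (hS : T'.Subtable T) (hρ : T'.Exposed M₀ ρ) {x : Fin p} {y : Fin q} :
    RotArc (midTable T M₀ (Rot.elim M₀ ρ)) M₀ (.inl x) (.inr y) ↔ RhoArc T ρ x y := by
  have hmid : (midTable T M₀ (Rot.elim M₀ ρ)).Subtable T := restrict_subtable _ _
  have hM := hρ.1
  have hf := (hS.exposed_iff.1 hρ).2.2.2.2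
  constructor
  · rintro ⟨he, h1, y', hy', h2⟩
    obtain ⟨he, -, h3, ⟨x', hx', h4⟩, -⟩ := mem_edges_restrict.1 he
    replace h2 := (hmid.xpref_iff.1 h2).2.2
    replace h3 := fun y hy => xle_of_eq_or_xpref (h3 y hy)
    replace h4 := yle_of_eq_or_ypref h4
    replace h1 := fun x' hx' => (hmid.ypref_iff.1 (h1 x' hx')).2.2
    dsimp only at h3 h4 hx'
    have ha : (x, y') ∈ ρ := by
      by_contra hn
      exact absurd (h3 _ (hρ.mem_elim_iff.2 (Or.inl ⟨hy', hn⟩))) (not_le.2 h2)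
    obtain ⟨b, hab⟩ := exists_follows_right ha
    rcases hρ.mem_elim_iff.1 hx' with h5 | ⟨c, d, hcd, h5⟩
    · exact absurd (h1 _ h5.1) (not_lt.2 h4)
    · obtain ⟨rfl, rfl⟩ := Prod.mk.inj h5
      exact ⟨he, _, b, c, d, hab, hcd, rfl, rfl, h2,
        h3 _ (hρ.mem_elim_iff.2 (Or.inr ⟨_, b, hab, rfl⟩)), h4,
        h1 _ (hρ.2.2.2.1 _ hcd.right_mem)⟩
  · rintro ⟨he, a, b, c, d, hab, hcd, rfl, rfl, h1, h2, h3, h4⟩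
    have hm := mem_midTable_of_follows hS hρ hab hcd he h1.le h2 h3 h4.le
    have hself : ∀ e ∈ ρ, e ∈ (midTable T M₀ (Rot.elim M₀ ρ)).edges := by
      intro e he
      obtain ⟨u, hu⟩ := exists_follows_right he
      obtain ⟨v, hv⟩ := exists_follows_left he
      exact mem_midTable_of_follows hS hρ hu hv (hS.edges_subset (hM.mem_edges (hρ.2.2.2.1 e he)))
        le_rfl (hf _ _ hu).2.2.1.le (hf _ _ hv).2.1.le le_rfl
    refine ⟨hm, fun x' hx' => ?_, a.2, hρ.2.2.2.1 _ hab.left_mem,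
      hmid.xpref_iff.2 ⟨hself _ hab.left_mem, hm, h1⟩⟩
    obtain rfl := hM.1.2.2 _ _ _ hx' (hρ.2.2.2.1 _ hcd.right_mem)
    exact hmid.ypref_iff.2 ⟨hm, hself _ hcd.right_mem, h4⟩

theorem isDicycle_iff (hS : T'.Subtable T) (hρ : T'.Exposed M₀ ρ) {C : Cycle (Fin p ⊕ Fin q)}
    (hC : Corresponds C σ) :
    IsDicycle (RotArc (midTable T M₀ (Rot.elim M₀ ρ)) M₀) C ↔ IsRhoCycle T M₀ ρ σ := by
  constructor
  · rintro ⟨h1, h2, h3⟩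
    refine ⟨?_, ?_, fun a ha => ?_, fun a b hab => (rotArc_iff hS hρ).1 (h3 _ _ (hC.follows hab).2)⟩
    · rintro rfl
      exact h1 (Corresponds.eq_coe (l := []) hC)
    · obtain ⟨l, rfl, rfl⟩ := hC
      refine ((List.nodup_flatMap.1 (Cycle.nodup_coe_iff.1 h2)).2).imp ?_
      rintro a b h rfl
      simp [Function.onFun] at h
    · obtain ⟨b, hab⟩ := exists_follows_right ha
      exact h3 _ _ (hC.follows hab).1
  · rintro ⟨h1, h2, h3, h4⟩
    have hnd : C.Nodup := hC.nodup h2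
      (fun a ha b hb hab => hρ.1.1.eq_of_fst_eq (h3 a ha) (h3 b hb) hab)
      (fun a ha b hb hab => hρ.1.1.eq_of_snd_eq (h3 a ha) (h3 b hb) hab)
    refine ⟨?_, hnd, fun u v huv => ?_⟩
    · obtain ⟨a, ha⟩ := exists_mem_of_ne_nil h1
      obtain ⟨b, hab⟩ := exists_follows_right ha
      rintro rfl
      exact Cycle.notMem_nil _ (hC.follows hab).1.left_mem
    · obtain ⟨a, b, hab, ⟨rfl, rfl⟩ | ⟨rfl, rfl⟩⟩ := hC.exists_of_follows hnd huv
      · exact h3 a hab.left_mem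
      · exact (rotArc_iff hS hρ).2 (h4 a b hab)

theorem Corresponds.right_unique {C : Cycle (Fin p ⊕ Fin q)} (h : Corresponds C ρ)
    (h' : Corresponds C σ) (hC : C.Nodup) (hM : T.IsMatching M₀) (hρ : IsRhoCycle T M₀ ρ ρ)
    (hσ : IsRhoCycle T M₀ ρ σ) : ρ = σ := by
  obtain ⟨a, ha⟩ := exists_mem_of_ne_nil hρ.1
  obtain ⟨b, hab⟩ := exists_follows_right ha
  have ha' : a ∈ σ := by
    obtain ⟨a', b', hab', ⟨h1, h2⟩ | ⟨h1, h2⟩⟩ := h'.exists_of_follows hC (h.follows hab).1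
    · rw [Prod.ext (Sum.inl.inj h2) (Sum.inr.inj h1)]
      exact hab'.left_mem
    · simp at h1
  refine eq_of_follows hρ.2.1 hσ.2.1 ha ha' fun u v v' huv huv' => ?_
  exact hM.eq_of_snd_eq (hρ.2.2.1 _ huv.right_mem) (hσ.2.2.1 _ huv'.right_mem)
    (Sum.inr.inj ((h.follows huv).2.right_unique hC (h'.follows huv').2))

theorem isRhoCycle_self (hS : T'.Subtable T) (hρ : T'.Exposed M₀ ρ) : IsRhoCycle T M₀ ρ ρ := by
  obtain ⟨-, h1, h2, h3, h4⟩ := hS.exposed_iff.1 hρ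
  refine ⟨h1, h2, h3, fun a b hab => ?_⟩
  obtain ⟨h5, h6, h7, -⟩ := h4 a b hab
  exact ⟨hS.edges_subset h5, a, b, a, b, hab, hab, rfl, rfl, h7, le_rfl, le_rfl, h6⟩

theorem existsUnique_isDicycle_iff (hS : T'.Subtable T) (hρ : T'.Exposed M₀ ρ) :
    (∃! C, IsDicycle (RotArc (midTable T M₀ (Rot.elim M₀ ρ)) M₀) C) ↔
      ∀ σ, IsRhoCycle T M₀ ρ σ → σ = ρ := by
  have hself := isRhoCycle_self hS hρ
  obtain ⟨C₀, hC₀⟩ := exists_corresponds ρ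
  have hdi := (isDicycle_iff hS hρ hC₀).2 hself
  constructor
  · intro hu σ hσ
    obtain ⟨C, hC⟩ := exists_corresponds σ
    obtain rfl := hu.unique ((isDicycle_iff hS hρ hC).2 hσ) hdi
    exact (hC₀.right_unique hC hdi.2.1
      ⟨hρ.1.1.1.trans hS.edges_subset, hρ.1.1.2⟩ hself hσ).symm
  · intro h
    refine ⟨C₀, hdi, fun C hC => ?_⟩
    obtain ⟨σ, hσ⟩ := hC.exists_corresponds
    obtain rfl := h σ ((isDicycle_iff hS hρ hσ).1 hC)
    exact hσ.left_unique hC₀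

/-- The pairs of `σ` and of `ρ` lie in the same matching, so the pairs of `ρ` that witness an arc
are the pairs of `σ` themselves. -/
theorem IsRhoCycle.arc (hρ : T'.Exposed M₀ ρ) (hσ : IsRhoCycle T M₀ ρ σ) {a b : Fin p × Fin q}
    (hab : Follows σ a b) :
    (a.1, b.2) ∈ T.edges ∧ ∃ b' c, Follows ρ a b' ∧ Follows ρ c b ∧
      T.rx a.1 a.2 < T.rx a.1 b.2 ∧ T.rx a.1 b.2 ≤ T.rx a.1 b'.2 ∧
      T.ry b.2 c.1 ≤ T.ry b.2 a.1 ∧ T.ry b.2 a.1 < T.ry b.2 b.1 := by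
  obtain ⟨he, a', b', c, d, h1, h2, h3, h4, h5, h6, h7, h8⟩ := hσ.2.2.2 a b hab
  obtain rfl := hρ.1.1.eq_of_fst_eq (hσ.2.2.1 _ hab.left_mem) (hρ.2.2.2.1 _ h1.left_mem) h3
  obtain rfl := hρ.1.1.eq_of_snd_eq (hσ.2.2.1 _ hab.right_mem) (hρ.2.2.2.1 _ h2.right_mem) h4
  exact ⟨he, b', c, h1, h2, h5, h6, h7, h8⟩

end Digraph

/-! ## Dissecting sets -/

section Dissecting

variable {p q : ℕ} {S T T' : Marriage p q} {M₀ : Set (Fin p × Fin q)} {ρ σ : Rot p q}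

theorem mem_edges_addRots {R : Set (Rot p q)} {e : Fin p × Fin q} :
    e ∈ (addRots T T' R).edges ↔ e ∈ T.edges ∧ (e ∈ T'.edges ∨ ∃ σ ∈ R, e ∈ Rot.E σ) := by
  simp [addRots, mem_edges_restrict]

theorem addRots_subtable (T T' : Marriage p q) (R : Set (Rot p q)) :
    (addRots T T' R).Subtable T := restrict_subtable _ _

/-- Disjoint rotations that are exposed at the same time can be eliminated one after another. -/
theorem exists_elimSeq_of_disjoint (hS : S.Subtable T) {L : List (Rot p q)}
    {K : Set (Fin p × Fin q)} (hK : S.IsStable K) (hnd : L.Nodup)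
    (hL : ∀ σ ∈ L, σ ≠ Cycle.nil ∧ σ.Nodup ∧ (∀ a ∈ σ, a ∈ K) ∧ ∀ a b, Follows σ a b →
      (a.1, b.2) ∈ S.edges ∧ T.ry b.2 a.1 < T.ry b.2 b.1 ∧ T.rx a.1 a.2 < T.rx a.1 b.2 ∧
      ∀ y, (a.1, y) ∈ S.edges → T.rx a.1 a.2 < T.rx a.1 y → T.rx a.1 b.2 ≤ T.rx a.1 y)
    (hdisj : ∀ σ ∈ L, ∀ τ ∈ L, ∀ a ∈ σ, a ∈ τ → σ = τ) :
    ∃ K', S.ElimSeq K L K' ∧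
      ∀ e, e ∈ K' ↔ (e ∈ K ∧ ∀ σ ∈ L, e ∉ σ) ∨ ∃ σ ∈ L, e ∈ Rot.shifted σ := by
  induction L generalizing K with
  | nil => exact ⟨K, rfl, by simp⟩
  | cons τ L ih =>
    obtain ⟨h1, h2, h3, h4⟩ := hL τ (by simp)
    have hτ : S.Exposed K τ := hS.exposed_iff.2 ⟨hK, h1, h2, h3, fun a b hab => by
      obtain ⟨h5, h6, h7, h8⟩ := h4 a b hab
      exact ⟨h5, h6, h7, fun y hy h9 h10 => absurd (h8 y hy h9) (not_le.2 h10)⟩⟩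
    rw [List.nodup_cons] at hnd
    obtain ⟨K', hK', hmem⟩ := ih hτ.isStable_elim hnd.2
      (fun σ hσ => by
        obtain ⟨h5, h6, h7, h8⟩ := hL σ (by simp [hσ])
        refine ⟨h5, h6, fun a ha => hτ.mem_elim_iff.2 (Or.inl ⟨h7 a ha, fun ha' => ?_⟩), h8⟩
        exact hnd.1 (hdisj σ (by simp [hσ]) τ (by simp) a ha ha' ▸ hσ))
      (fun σ hσ τ hτ => hdisj σ (by simp [hσ]) τ (by simp [hτ]))
    refine ⟨K', ⟨hτ, hK'⟩, fun e => ?_⟩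
    rw [hmem, hτ.mem_elim_iff]
    -- A pair created by `τ` is not in `K`, because `τ` moves its `X`-agent strictly down, whereas
    -- the pairs of the other rotations are in `K`.
    have hsh : e ∈ Rot.shifted τ → ∀ σ ∈ L, e ∉ σ := by
      rintro ⟨a, b, hab, rfl⟩ σ hσ he
      have h5 := (hL σ (by simp [hσ])).2.2.1 _ he
      have h6 := hK.1.2.1 _ _ _ h5 (h3 a hab.left_mem)
      have h7 := (h4 a b hab).2.2.1
      rw [h6] at h7
      exact lt_irrefl _ h7
    simp only [List.mem_cons, forall_eq_or_imp, exists_eq_or_imp]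
    tauto

theorem IsAltCycle.eq_of_mem {M₁ Ms : Set (Fin p × Fin q)} {τ : Rot p q}
    (h1 : ∀ x x' y, (x, y) ∈ M₁ → (x', y) ∈ M₁ → x = x')
    (hs : ∀ x y y', (x, y) ∈ Ms → (x, y') ∈ Ms → y = y')
    (hσ : IsAltCycle M₁ Ms σ) (hτ : IsAltCycle M₁ Ms τ) {a : Fin p × Fin q} (ha : a ∈ σ)
    (ha' : a ∈ τ) : σ = τ := by
  refine eq_of_follows hσ.2.1 hτ.2.1 ha ha' fun u v v' h h' => ?_
  have e2 : v.2 = v'.2 := hs u.1 _ _ (hσ.2.2.2 ⟨u, v, h, rfl⟩).1 (hτ.2.2.2 ⟨u, v', h', rfl⟩).1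
  refine Prod.ext (h1 v.1 v'.1 v.2 (hσ.2.2.1 h.right_mem).1 ?_) e2
  rw [e2]
  exact (hτ.2.2.1 h'.right_mem).1

/-- The alternating cycles cover the symmetric difference of two matchings of the same agents. -/
theorem exists_isAltCycle {M₁ Ms : Set (Fin p × Fin q)} (hM₁ : T.IsMatching M₁)
    (hMs : T.IsMatching Ms) (hx : ∀ x y, (x, y) ∈ M₁ → ∃ y', (x, y') ∈ Ms)
    (hy : ∀ x y, (x, y) ∈ Ms → ∃ x', (x', y) ∈ M₁) {e : Fin p × Fin q} (he : e ∈ M₁ \ Ms) :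
    ∃ σ, IsAltCycle M₁ Ms σ ∧ e ∈ σ := by
  obtain ⟨c, h1, h2, h3, h4, h5⟩ := exists_cycle (P := M₁ \ Ms)
    (r := fun a b => (a.1, b.2) ∈ Ms \ M₁) (a₀ := e) (by
      rintro ⟨x, y⟩ ⟨h, h'⟩
      obtain ⟨y', h1⟩ := hx x y h
      obtain ⟨x', h2⟩ := hy x y' h1
      have h3 : (x, y') ∉ M₁ := fun h3 => h' (hM₁.2.1 _ _ _ h h3 ▸ h1)
      exact ⟨(x', y'), ⟨h2, fun h4 => h3 (hMs.2.2 _ _ _ h4 h1 ▸ h2)⟩, h1, h3⟩) he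
  refine ⟨c, ⟨h1, h2, h3, ?_⟩, h5 fun a ha a' ha' b h h' => ?_⟩
  · rintro _ ⟨a, b, hab, rfl⟩
    exact h4 a b hab
  · exact hM₁.eq_of_fst_eq ha.1 ha'.1 (hMs.2.2 _ _ _ h.1 h'.1)

theorem Cycle.finite_nodup {α : Type*} [Finite α] : {c : Cycle α | c.Nodup}.Finite := by
  classical
  have := Fintype.ofFinite α
  exact Set.finite_coe_iff.1 (inferInstanceAs (Finite {c : Cycle α // c.Nodup}))

/-- `M¹` is sandwiched between `M⁰` and `M*`, and apart from `M¹` the table `T*` has no edges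
strictly inside the gaps on the lists of the `X`-agents. So every step down, first to `M¹` and then
to `M*`, goes to the next available edge. -/
theorem isDissectingSet_of_isRhoCycle (hS : T'.Subtable T) (hst : T'.StableTable)
    (hbase : T'.IsBase ρ M₀) (hρ : T'.Exposed M₀ ρ) {ρ₁ : Rot p q} (h₁ : IsRhoCycle T M₀ ρ ρ₁)
    (hne : ρ₁ ≠ ρ) :
    IsDissectingSet T T' ρ
      (insert ρ₁ {σ | IsAltCycle (Rot.elim M₀ ρ₁) (Rot.elim M₀ ρ) σ}) := by
  set M₁ := Rot.elim M₀ ρ₁ with hM₁def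
  set Ms := Rot.elim M₀ ρ with hMsdef
  set R : Set (Rot p q) := insert ρ₁ {σ | IsAltCycle M₁ Ms σ} with hR
  obtain ⟨hM₀, -, hnd, hρM, hf⟩ := hS.exposed_iff.1 hρ
  have hMs : T'.IsStable Ms := hρ.isStable_elim
  have memMs : ∀ {e}, e ∈ Ms ↔ (e ∈ M₀ ∧ e ∉ ρ) ∨ e ∈ Rot.shifted ρ := hρ.mem_elim_iff
  have memM₁ : ∀ {e}, e ∈ M₁ ↔ (e ∈ M₀ ∧ e ∉ ρ₁) ∨ e ∈ Rot.shifted ρ₁ :=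
    Marriage.mem_elim_iff hM₀.1.2.1 h₁.2.2.1
  have hM₁T : M₁ ⊆ T.edges := by
    intro e he
    rcases memM₁.1 he with h | ⟨a, b, hab, rfl⟩
    · exact hS.edges_subset (hM₀.mem_edges h.1)
    · exact (h₁.arc hρ hab).1
  have hE : ∀ σ ∈ R, ∀ e ∈ Rot.E σ, e ∈ T'.edges ∨ e ∈ M₁ := by
    rintro σ (rfl | hσ) e (he | he)
    · exact Or.inl (hM₀.mem_edges (h₁.2.2.1 e he))
    · exact Or.inr (memM₁.2 (Or.inr he))
    · exact Or.inr (hσ.2.2.1 he).1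
    · exact Or.inl (hMs.mem_edges (hσ.2.2.2 he).1)
  have hET : ∀ σ ∈ R, Rot.E σ ⊆ T.edges := by
    intro σ hσ e he
    rcases hE σ hσ e he with h | h
    · exact hS.edges_subset h
    · exact hM₁T h
  set Ts := addRots T T' R with hTs
  have hsub : Ts.Subtable T := addRots_subtable T T' R
  -- The new edges of `T*` are only those of `M¹`: the remaining edges of the rotations belong to
  -- `M⁰`, `M¹` or `M*`.
  have memTs : ∀ {e}, e ∈ Ts.edges ↔ e ∈ T'.edges ∨ e ∈ M₁ := by
    intro e
    rw [mem_edges_addRots]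
    constructor
    · rintro ⟨-, h | ⟨σ, hσ, h⟩⟩
      · exact Or.inl h
      · exact hE σ hσ e h
    · rintro (h | h)
      · exact ⟨hS.edges_subset h, Or.inl h⟩
      · refine ⟨hM₁T h, ?_⟩
        rcases memM₁.1 h with h | h
        · exact Or.inl (hM₀.mem_edges h.1)
        · exact Or.inr ⟨ρ₁, by simp [hR], Or.inr h⟩
  have gap : ∀ {x y y₀ ys}, (x, y₀) ∈ M₀ → (x, ys) ∈ Ms → (x, y) ∈ T'.edges →
      T.rx x y₀ < T.rx x y → T.rx x y < T.rx x ys → False := by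
    intro x y y₀ ys h0 hs hy hlt hlt'
    rcases memMs.1 hs with h | ⟨a, b, hab, h⟩
    · rw [hM₀.1.2.1 _ _ _ h0 h.1] at hlt
      omega
    · obtain ⟨rfl, rfl⟩ := Prod.mk.inj h
      rw [hM₀.1.2.1 _ _ _ h0 (hρM _ hab.left_mem)] at hlt
      exact hρ.not_between_x hS hst hab hy hlt hlt'
  have v01 : ∀ {x y₀ y₁}, (x, y₀) ∈ M₀ → (x, y₁) ∈ M₁ → T.rx x y₀ ≤ T.rx x y₁ := by
    intro x y₀ y₁ h0 h1
    rcases memM₁.1 h1 with h | ⟨a, b, hab, h⟩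
    · rw [hM₀.1.2.1 _ _ _ h0 h.1]
    · obtain ⟨rfl, rfl⟩ := Prod.mk.inj h
      obtain ⟨-, b', c, -, -, h2, -⟩ := h₁.arc hρ hab
      rw [hM₀.1.2.1 _ _ _ h0 (h₁.2.2.1 _ hab.left_mem)]
      exact h2.le
  have v1s : ∀ {x y₁ ys}, (x, y₁) ∈ M₁ → (x, ys) ∈ Ms → T.rx x y₁ ≤ T.rx x ys := by
    intro x y₁ ys h1 hs
    rcases memM₁.1 h1 with h | ⟨a, b, hab, h⟩
    · obtain ⟨y', h2, h3⟩ := hρ.exists_x hS h.1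
      rwa [hMs.1.2.1 _ _ _ hs h2]
    · obtain ⟨rfl, rfl⟩ := Prod.mk.inj h
      obtain ⟨-, b', c, h2, -, -, h3, -⟩ := h₁.arc hρ hab
      rwa [hMs.1.2.1 _ _ _ hs (memMs.2 (Or.inr ⟨a, b', h2, rfl⟩))]
  have w1s : ∀ {x₁ xs y}, (x₁, y) ∈ M₁ → (xs, y) ∈ Ms → T.ry y xs ≤ T.ry y x₁ := by
    intro x₁ xs y h1 hs
    rcases memM₁.1 h1 with h | ⟨a, b, hab, h⟩
    · obtain ⟨x', h2, h3⟩ := hρ.exists_y hS h.1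
      rwa [hMs.1.2.2 _ _ _ hs h2]
    · obtain ⟨rfl, rfl⟩ := Prod.mk.inj h
      obtain ⟨-, b', c, -, h2, -, -, h3, -⟩ := h₁.arc hρ hab
      rwa [hMs.1.2.2 _ _ _ hs (memMs.2 (Or.inr ⟨c, b, h2, rfl⟩))]
  have hM₀s : Ts.IsStable M₀ := by
    refine hsub.isStable_iff.2 ⟨⟨fun e he => memTs.2 (Or.inl (hM₀.mem_edges he)), hM₀.1.2⟩, ?_⟩
    intro x y hxy
    rcases memTs.1 hxy with h | h
    · exact (hS.isStable_iff.1 hM₀).2 x y h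
    · left
      rcases memM₁.1 h with h' | ⟨a, b, hab, h'⟩
      · exact ⟨y, h'.1, le_rfl⟩
      · obtain ⟨rfl, rfl⟩ := Prod.mk.inj h'
        exact ⟨a.2, h₁.2.2.1 _ hab.left_mem, v01 (h₁.2.2.1 _ hab.left_mem) h⟩
  -- The last condition of exposure is vacuous: an edge strictly between is not in `T'` by `gap`,
  -- and the only `M¹`-edge of `x_i` is the target of the step itself.
  have hexp₁ : Ts.Exposed M₀ ρ₁ := by
    refine hsub.exposed_iff.2 ⟨hM₀s, h₁.1, h₁.2.1, h₁.2.2.1, fun a b hab => ?_⟩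
    obtain ⟨-, b', c, h2, h3, h4, h5, h6, h7⟩ := h₁.arc hρ hab
    have ha := h₁.2.2.1 _ hab.left_mem
    refine ⟨memTs.2 (Or.inr (memM₁.2 (Or.inr ⟨a, b, hab, rfl⟩))), h7, h4, fun y hy h8 h9 => ?_⟩
    exfalso
    rcases memTs.1 hy with h | h
    · exact gap ha (memMs.2 (Or.inr ⟨a, b', h2, rfl⟩)) h h8 (by omega)
    · rcases memM₁.1 h with h | ⟨a', b'', hab', h⟩
      · rw [hM₀.1.2.1 _ _ _ ha h.1] at h8
        exact lt_irrefl _ h8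
      · obtain ⟨h10, rfl⟩ := Prod.mk.inj h
        obtain rfl := hM₀.1.eq_of_fst_eq ha (h₁.2.2.1 _ hab'.left_mem) h10
        rw [hab.right_unique h₁.2.1 hab'] at h9
        exact lt_irrefl _ h9
  have hM₁s : Ts.IsStable M₁ := hexp₁.isStable_elim
  have exMs : ∀ {x y}, (x, y) ∈ M₁ → ∃ y', (x, y') ∈ Ms := by
    intro x y h
    obtain ⟨y₀, h1, -⟩ := hexp₁.exists_of_mem_elim hsub h
    obtain ⟨y', h2, -⟩ := hρ.exists_x hS h1
    exact ⟨y', h2⟩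
  have exM₀ : ∀ {x y}, (x, y) ∈ M₁ → ∃ y', (x, y') ∈ M₀ := by
    intro x y h
    obtain ⟨y₀, h1, -⟩ := hexp₁.exists_of_mem_elim hsub h
    exact ⟨y₀, h1⟩
  have exM₁y : ∀ {x y}, (x, y) ∈ Ms → ∃ x', (x', y) ∈ M₁ := by
    intro x y h
    have : ∃ x', (x', y) ∈ M₀ := by
      rcases memMs.1 h with h | ⟨a, b, hab, h⟩
      · exact ⟨x, h.1⟩
      · obtain ⟨rfl, rfl⟩ := Prod.mk.inj h
        exact ⟨b.1, hρM _ hab.right_mem⟩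
    obtain ⟨x', h'⟩ := this
    obtain ⟨x'', h'', -⟩ := hexp₁.exists_y hsub h'
    exact ⟨x'', h''⟩
  have hMsT : T.IsMatching Ms := ⟨hMs.1.1.trans hS.edges_subset, hMs.1.2⟩
  have hM₁T' : T.IsMatching M₁ := ⟨hM₁T, hM₁s.1.2⟩
  have halt : ∀ σ, IsAltCycle M₁ Ms σ → σ ≠ Cycle.nil ∧ σ.Nodup ∧ (∀ a ∈ σ, a ∈ M₁) ∧
      ∀ a b, Follows σ a b →
      (a.1, b.2) ∈ Ts.edges ∧ T.ry b.2 a.1 < T.ry b.2 b.1 ∧ T.rx a.1 a.2 < T.rx a.1 b.2 ∧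
      ∀ y, (a.1, y) ∈ Ts.edges → T.rx a.1 a.2 < T.rx a.1 y → T.rx a.1 b.2 ≤ T.rx a.1 y := by
    intro σ hσ
    refine ⟨hσ.1, hσ.2.1, fun a ha => (hσ.2.2.1 ha).1, fun a b hab => ?_⟩
    have ha := hσ.2.2.1 hab.left_mem
    have hb := hσ.2.2.1 hab.right_mem
    have hs := hσ.2.2.2 ⟨a, b, hab, rfl⟩
    refine ⟨memTs.2 (Or.inl (hMs.mem_edges hs.1)), lt_of_le_of_ne (w1s hb.1 hs.1) fun he => ?_,
      lt_of_le_of_ne (v1s ha.1 hs.1) fun he => ?_, fun y hy h1 => ?_⟩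
    · have : a.1 = b.1 := ry_inj (hMsT.1 hs.1) he
      exact hb.2 (by have := hs.1; simp_all)
    · have : a.2 = b.2 := rx_inj (hM₁T ha.1) he
      exact ha.2 (by have := hs.1; rwa [← ‹a.2 = b.2›] at this)
    · by_contra! h2
      rcases memTs.1 hy with h | h
      · obtain ⟨y₀, h0⟩ := exM₀ ha.1
        exact gap h0 hs.1 h ((v01 h0 ha.1).trans_lt h1) h2
      · rw [hM₁s.1.2.1 _ _ _ ha.1 h] at h1
        exact lt_irrefl _ h1
  have hρ₁nalt : ¬ IsAltCycle M₁ Ms ρ₁ := by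
    intro h
    obtain ⟨a, ha⟩ := exists_mem_of_ne_nil h₁.1
    obtain ⟨b, hab⟩ := exists_follows_right ha
    have h2 := hM₁s.1.2.1 _ _ _ (h.2.2.1 ha).1 (memM₁.2 (Or.inr ⟨a, b, hab, rfl⟩))
    obtain ⟨-, b', c, -, -, h4, -⟩ := h₁.arc hρ hab
    rw [h2] at h4
    exact lt_irrefl _ h4
  have hfin : {σ | IsAltCycle M₁ Ms σ}.Finite :=
    Cycle.finite_nodup.subset fun σ hσ => hσ.2.1
  obtain ⟨K', hK', hmemK'⟩ := exists_elimSeq_of_disjoint hsub (L := hfin.toFinset.toList) hM₁s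
    (Finset.nodup_toList _) (fun σ hσ => halt σ (by simpa using hσ))
    (fun σ hσ τ hτ a ha ha' => IsAltCycle.eq_of_mem hM₁s.1.2.2 hMs.1.2.1 (by simpa using hσ)
      (by simpa using hτ) ha ha')
  have hcover : ∀ e ∈ M₁, e ∉ Ms → ∃ σ, IsAltCycle M₁ Ms σ ∧ e ∈ σ := fun e he he' =>
    exists_isAltCycle hM₁T' hMsT (fun _ _ => exMs) (fun _ _ => exM₁y) ⟨he, he'⟩
  have hK'Ms : K' = Ms := by
    ext e
    simp only [hmemK', Finset.mem_toList, Set.Finite.mem_toFinset, Set.mem_ofPred_eq]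
    constructor
    · rintro (⟨h1, h2⟩ | ⟨σ, h1, h2⟩)
      · by_contra h3
        obtain ⟨σ, h4, h5⟩ := hcover e h1 h3
        exact h2 σ h4 h5
      · exact (h1.2.2.2 h2).1
    · intro he
      by_cases h1 : e ∈ M₁
      · exact Or.inl ⟨h1, fun σ hσ h => (hσ.2.2.1 h).2 he⟩
      · right
        obtain ⟨x, y⟩ := e
        obtain ⟨y₁, hy₁⟩ : ∃ y₁, (x, y₁) ∈ M₁ := by
          obtain ⟨y₀, h0, -⟩ := hρ.exists_of_mem_elim hS he
          obtain ⟨y₁, h2, -⟩ := hexp₁.exists_x hsub h0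
          exact ⟨y₁, h2⟩
        obtain ⟨σ, hσ, hm⟩ := hcover _ hy₁ fun h => h1 (hMs.1.2.1 _ _ _ he h ▸ hy₁)
        obtain ⟨b, hb⟩ := exists_follows_right hm
        refine ⟨σ, hσ, _, b, hb, ?_⟩
        rw [hMs.1.2.1 _ _ _ he (hσ.2.2.2 ⟨_, b, hb, rfl⟩).1]
  have hRX : ∀ σ ∈ R, σ ∈ Ts.RX := by
    rintro σ (rfl | hσ)
    · exact ⟨M₀, hexp₁⟩
    · refine ⟨M₁, hsub.exposed_iff.2 ⟨hM₁s, (halt σ hσ).1, (halt σ hσ).2.1, (halt σ hσ).2.2.1,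
        fun a b hab => ?_⟩⟩
      obtain ⟨h5, h6, h7, h8⟩ := (halt σ hσ).2.2.2 a b hab
      exact ⟨h5, h6, h7, fun y hy h9 h10 => absurd (h8 y hy h9) (not_le.2 h10)⟩
  have hnRX : ∀ σ ∈ R, σ ∉ T'.RX := by
    -- As a rotation of `T'`, either kind of sequence would use only old edges, and by `gap` its
    -- successors would be those of `ρ`. For `ρ₁` this contradicts `ρ₁ ≠ ρ`.
    rintro σ (rfl | hσ) ⟨K, hK⟩
    · obtain ⟨a, ha⟩ := exists_mem_of_ne_nil h₁.1
      have key : ∀ u v, Follows σ u v → Follows ρ u v := by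
        intro u v huv
        obtain ⟨hT, b', c, h2, h3, h4, h5, h6, h7⟩ := h₁.arc hρ huv
        have h8 : v.2 = b'.2 := by
          refine rx_inj hT (le_antisymm h5 ?_)
          by_contra! h9
          exact gap (h₁.2.2.1 _ huv.left_mem) (memMs.2 (Or.inr ⟨u, b', h2, rfl⟩))
            (hK.mem_edges_E (Or.inr ⟨u, v, huv, rfl⟩)) h4 h9
        rwa [hM₀.1.eq_of_snd_eq (h₁.2.2.1 _ huv.right_mem) (hρM _ h2.right_mem) h8]
      obtain ⟨b, hab⟩ := exists_follows_right ha
      exact hne (eq_of_follows h₁.2.1 hnd ha (key _ _ hab).left_mem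
        fun u v v' h h' => (key u v h).right_unique hnd h')
    · have key : ∀ a ∈ σ, a ∈ M₀ := by
        intro a ha
        obtain ⟨b, hab⟩ := exists_follows_right ha
        have haM := hσ.2.2.1 ha
        have hs := hσ.2.2.2 ⟨a, b, hab, rfl⟩
        obtain ⟨y₀, h0⟩ := exM₀ (x := a.1) (y := a.2) haM.1
        rcases (v01 h0 haM.1).eq_or_lt with h | h
        · have h1 : y₀ = a.2 := rx_inj (hS.edges_subset (hM₀.mem_edges h0)) h
          rwa [h1] at h0
        · exact (gap h0 hs.1 (hK.mem_edges_E (Or.inl ha)) h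
            ((halt σ hσ).2.2.2 a b hab).2.2.1).elim
      have key2 : ∀ u v, Follows σ u v → Follows ρ u v := by
        intro u v huv
        have h1 : u ∈ ρ := by
          by_contra hn
          exact (hσ.2.2.1 huv.left_mem).2 (memMs.2 (Or.inl ⟨key _ huv.left_mem, hn⟩))
        obtain ⟨b, hb⟩ := exists_follows_right h1
        have h2 := hMs.1.2.1 _ _ _ (hσ.2.2.2 ⟨u, v, huv, rfl⟩).1
          (memMs.2 (Or.inr ⟨u, b, hb, rfl⟩))
        rwa [hM₀.1.eq_of_snd_eq (key _ huv.right_mem) (hρM _ hb.right_mem) h2]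
      obtain ⟨a, ha⟩ := exists_mem_of_ne_nil hσ.1
      obtain ⟨b, hab⟩ := exists_follows_right ha
      have hσρ : σ = ρ := eq_of_follows hσ.2.1 hnd ha (key2 _ _ hab).left_mem
        fun u v v' h h' => (key2 u v h).right_unique hnd h'
      -- An alternating cycle equal to `ρ` would put all pairs of `ρ` into `M¹`, but `ρ₁` has
      -- removed some of them.
      obtain ⟨c, hc⟩ := exists_mem_of_ne_nil h₁.1
      obtain ⟨d, hcd⟩ := exists_follows_right hc
      obtain ⟨-, b', c', h2, -, h4, -⟩ := h₁.arc hρ hcd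
      have h5 := (hσ.2.2.1 (hσρ ▸ h2.left_mem : c ∈ σ)).1
      rw [hM₁s.1.2.1 _ _ _ h5 (memM₁.2 (Or.inr ⟨c, d, hcd, rfl⟩))] at h4
      exact lt_irrefl _ h4
  refine ⟨hET, fun σ hσ => ⟨hRX σ hσ, hnRX σ hσ⟩, M₀, hbase, hρ,
    ρ₁ :: hfin.toFinset.toList, ?_, ?_, hexp₁, by rw [hK'Ms] at hK'; exact hK'⟩
  · exact List.nodup_cons.2 ⟨by simpa using hρ₁nalt, Finset.nodup_toList _⟩
  · intro σ
    simp [hR]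

/-- Consider the first rotation that is eliminated. Later eliminations only push `X`-agents down and
`Y`-agents up, ending at `M*`, so this rotation respects the bounds of the digraph and must be `ρ`.
-/
theorem not_exists_isDissectingSet (hS : T'.Subtable T) (hbase : T'.IsBase ρ M₀)
    (hρ : T'.Exposed M₀ ρ) (hu : ∀ σ, IsRhoCycle T M₀ ρ σ → σ = ρ) :
    ¬ ∃ R, IsDissectingSet T T' ρ R := by
  rintro ⟨R, hET, hRX, M₀', hbase', -, L, -, hL, hseq⟩
  obtain rfl := hbase.unique hbase'
  obtain ⟨hM₀, hnil, hnd, hρM, hf⟩ := hS.exposed_iff.1 hρ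
  have hMs := hρ.isStable_elim
  have hsub := addRots_subtable T T' R
  rcases L with _ | ⟨σ, L⟩
  · obtain ⟨a, ha⟩ := exists_mem_of_ne_nil hnil
    obtain ⟨b, hab⟩ := exists_follows_right ha
    have h1 : Rot.elim M₀ ρ = M₀ := hseq
    have h2 := hM₀.1.2.1 _ _ _ (hρM a ha)
      (h1 ▸ hρ.mem_elim_iff.2 (Or.inr ⟨a, b, hab, rfl⟩) : (a.1, b.2) ∈ M₀)
    have h3 := (hf a b hab).2.2.1
    rw [h2] at h3
    exact lt_irrefl _ h3
  · obtain ⟨hσ, hseq⟩ := hseq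
    have hσR : σ ∈ R := (hL σ).1 (by simp)
    obtain ⟨hM₀', h1, h2, h3, h4⟩ := hsub.exposed_iff.1 hσ
    have hσρ : σ = ρ := by
      refine hu σ ⟨h1, h2, h3, fun a b hab => ?_⟩
      obtain ⟨h5, h6, h7, -⟩ := h4 a b hab
      have hm : (a.1, b.2) ∈ Rot.elim M₀ σ := hσ.mem_elim_iff.2 (Or.inr ⟨a, b, hab, rfl⟩)
      obtain ⟨z, hz, hz'⟩ := hseq.exists_x hsub hm
      obtain ⟨w, hw, hw'⟩ := hseq.exists_y hsub hm
      have ha : a ∈ ρ := by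
        by_contra hn
        rw [hMs.1.2.1 _ _ _ hz (hρ.mem_elim_iff.2 (Or.inl ⟨h3 a hab.left_mem, hn⟩))] at hz'
        omega
      obtain ⟨b', hab'⟩ := exists_follows_right ha
      rw [hMs.1.2.1 _ _ _ hz (hρ.mem_elim_iff.2 (Or.inr ⟨a, b', hab', rfl⟩))] at hz'
      rcases hρ.mem_elim_iff.1 hw with h | ⟨c, d, hcd, h⟩
      · rw [hM₀.1.2.2 _ _ _ h.1 (h3 b hab.right_mem)] at hw'
        omega
      · obtain ⟨rfl, hd⟩ := Prod.mk.inj h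
        obtain rfl := hM₀.1.eq_of_snd_eq (h3 b hab.right_mem) (hρM _ hcd.right_mem) hd
        exact ⟨hsub.edges_subset h5, a, b', c, b, hab', hcd, rfl, rfl, h7, hz', hw', h6⟩
    exact (hRX hσR).2 (hσρ ▸ ⟨M₀, hρ⟩)

/-! ### Correctness of the algorithm and existence of an output -/

theorem DissectRotation.solvesDR {R : Set (Rot p q)} (hv : ValidInput T T' ρ)
    (h : DissectRotation T T' ρ R) : SolvesDR T T' ρ R := by
  obtain ⟨hS, hst, -⟩ := hv
  obtain ⟨M₀, Ms, hbase, hρ, rfl, ⟨hu, rfl⟩ | ⟨-, C, ρ₁, hC, hCρ, hne, rfl⟩⟩ := h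
  · have := not_exists_isDissectingSet hS hbase hρ ((existsUnique_isDicycle_iff hS hρ).1 hu)
    exact ⟨fun h => absurd h this, fun _ => rfl⟩
  · have := isDissectingSet_of_isRhoCycle hS hst hbase hρ ((isDicycle_iff hS hρ hCρ).1 hC) hne
    exact ⟨fun _ => this, fun h => absurd ⟨_, this⟩ h⟩

theorem exists_dissectRotation (hv : ValidInput T T' ρ) : ∃ R, DissectRotation T T' ρ R := by
  obtain ⟨hS, hst, hρX⟩ := hv
  obtain ⟨M₀, hbase, hρ⟩ := hst.exists_isBase hρX
  by_cases hu : ∃! C, IsDicycle (RotArc (midTable T M₀ (Rot.elim M₀ ρ)) M₀) C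
  · exact ⟨{ρ}, M₀, _, hbase, hρ, rfl, Or.inl ⟨hu, rfl⟩⟩
  · have hn := hu
    rw [existsUnique_isDicycle_iff hS hρ] at hn
    push Not at hn
    obtain ⟨σ, hσ, hne⟩ := hn
    obtain ⟨C, hC⟩ := exists_corresponds σ
    exact ⟨_, M₀, _, hbase, hρ, rfl,
      Or.inr ⟨hu, C, σ, (isDicycle_iff hS hρ hC).2 hσ, hC, hne, rfl⟩⟩

end Dissecting

/-! ## Chords of a rotation -/

section Chords

section Cyc

variable {α : Type*} {l : List α} (hl : 0 < l.length)

/-- The entry of the list `l` at the index `k`, modulo the length. -/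
def cyc (l : List α) (hl : 0 < l.length) (k : ℕ) : α := l[k % l.length]'(Nat.mod_lt k hl)

theorem cyc_add_length (k : ℕ) : cyc l hl (k + l.length) = cyc l hl k := by
  simp [cyc]

theorem cyc_eq_getElem {k : ℕ} (hk : k < l.length) : cyc l hl k = l[k] := by
  simp [cyc, Nat.mod_eq_of_lt hk]

theorem follows_cyc (k : ℕ) : Follows (l : Cycle α) (cyc l hl k) (cyc l hl (k + 1)) := by
  refine (follows_coe_iff _ _ _).2 ⟨k % l.length, Nat.mod_lt k hl, ?_, ?_⟩
  · simp [cyc]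
  · simp [cyc, Nat.mod_lt _ hl]

theorem exists_eq_cyc_of_follows {a b : α} (h : Follows (l : Cycle α) a b) :
    ∃ k < l.length, a = cyc l hl k ∧ b = cyc l hl (k + 1) := by
  obtain ⟨k, hk, h1, h2⟩ := (follows_coe_iff _ _ _).1 h
  refine ⟨k, hk, ?_, ?_⟩
  · rw [cyc_eq_getElem hl hk]
    exact (List.getElem?_eq_some_iff.1 h1).2.symm
  · exact (List.getElem?_eq_some_iff.1 h2).2.symm

theorem cyc_mem (k : ℕ) : cyc l hl k ∈ (l : Cycle α) := (follows_cyc hl k).left_mem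

theorem cyc_inj (hnd : l.Nodup) {k k' : ℕ} (hlt : k < k') (hlt' : k' < k + l.length) :
    cyc l hl k ≠ cyc l hl k' := by
  intro h
  have h1 := (List.Nodup.getElem_inj_iff hnd).1 h
  have h2 : l.length ∣ k' - k := (Nat.modEq_iff_dvd' hlt.le).1 h1
  exact absurd (Nat.le_of_dvd (by omega) h2) (by omega)

/-- The `n` entries of `l` from the index `k` on, cyclically. -/
def arcList (l : List α) (hl : 0 < l.length) (k n : ℕ) : List α :=
  (List.range' k n).map (cyc l hl)

@[simp] theorem length_arcList (k n : ℕ) : (arcList l hl k n).length = n := by simp [arcList]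

theorem getElem?_arcList {k n i : ℕ} (hi : i < n) :
    (arcList l hl k n)[i]? = some (cyc l hl (k + i)) := by
  simp [arcList, hi]

theorem mem_arcList {k n : ℕ} {a : α} :
    a ∈ arcList l hl k n ↔ ∃ i, k ≤ i ∧ i < k + n ∧ a = cyc l hl i := by
  simp only [arcList, List.mem_map, List.mem_range'_1]
  constructor
  · rintro ⟨i, ⟨h1, h2⟩, rfl⟩; exact ⟨i, h1, h2, rfl⟩
  · rintro ⟨i, h1, h2, rfl⟩; exact ⟨i, ⟨h1, h2⟩, rfl⟩

theorem nodup_arcList (hnd : l.Nodup) {k n : ℕ} (hn : n ≤ l.length) :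
    (arcList l hl k n).Nodup := by
  refine List.Nodup.map_on ?_ List.nodup_range'
  intro a ha b hb hab
  rw [List.mem_range'_1] at ha hb
  by_contra hne
  rcases Nat.lt_or_gt_of_ne hne with h | h
  · exact cyc_inj hl hnd h (by omega) hab
  · exact cyc_inj hl hnd h (by omega) hab.symm

theorem cyc_notMem_arcList (hnd : l.Nodup) {k n i : ℕ} (h : i < k) (h' : k + n ≤ i + l.length) :
    cyc l hl i ∉ arcList l hl k n := by
  rw [mem_arcList]
  rintro ⟨j, h1, h2, h3⟩
  exact cyc_inj hl hnd (by omega) (by omega) h3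

end Cyc

variable {p q : ℕ} {T T' : Marriage p q} {M₀ : Set (Fin p × Fin q)} {ρ : Rot p q}

/-- The arc from `a.1` to `d.2` of the rotation digraph is not an arc of `ρ`; here `b` is the
successor of `a`, and `d` that of `c`. -/
def IsChord (T : Marriage p q) (a b c d : Fin p × Fin q) : Prop :=
  T.rx a.1 a.2 < T.rx a.1 d.2 ∧ T.rx a.1 d.2 < T.rx a.1 b.2 ∧
    T.ry d.2 c.1 < T.ry d.2 a.1 ∧ T.ry d.2 a.1 < T.ry d.2 d.1

/-- If one of the two weak bounds on an arc is attained, the arc is an arc of `ρ`; if both are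
strict, it is a chord. -/
theorem eq_of_isRhoCycle_of_no_chord (hS : T'.Subtable T) (hρ : T'.Exposed M₀ ρ)
    (hno : ∀ a b c d, Follows ρ a b → Follows ρ c d → ¬ IsChord T a b c d) {σ : Rot p q}
    (hσ : IsRhoCycle T M₀ ρ σ) : σ = ρ := by
  have hM := hρ.1.1
  have hf := (hS.exposed_iff.1 hρ).2.2.2.2
  have key : ∀ a b, Follows σ a b → Follows ρ a b := by
    intro a b hab
    obtain ⟨he, b', c, h1, h2, h3, h4, h5, h6⟩ := hσ.arc hρ hab
    rcases h4.eq_or_lt with h4 | h4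
    · rwa [hM.eq_of_snd_eq (hρ.2.2.2.1 _ h2.right_mem) (hρ.2.2.2.1 _ h1.right_mem)
        (rx_inj he h4)]
    · rcases h5.eq_or_lt with h5 | h5
      · rwa [← hM.eq_of_fst_eq (hρ.2.2.2.1 _ h2.left_mem) (hρ.2.2.2.1 _ h1.left_mem)
          (ry_inj he h5.symm).symm]
      · exact absurd ⟨h3, h4, h5, h6⟩ (hno a b' c b h1 h2)
  obtain ⟨a, ha⟩ := exists_mem_of_ne_nil hσ.1
  obtain ⟨b, hab⟩ := exists_follows_right ha
  exact eq_of_follows hσ.2.1 hρ.2.2.1 ha (key _ _ hab).left_mem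
    fun u v v' h h' => (key u v h).right_unique hρ.2.2.1 h'

variable {l : List (Fin p × Fin q)} {hl : 0 < l.length} {i j : ℕ}

/-- The first of the two cycles into which a chord divides `ρ`. -/
def chordFst (l : List (Fin p × Fin q)) (hl : 0 < l.length) (i j : ℕ) : List (Fin p × Fin q) :=
  arcList l hl (j + 1) (i + l.length - j)

/-- The second of the two cycles into which a chord divides `ρ`. -/
def chordSnd (l : List (Fin p × Fin q)) (hl : 0 < l.length) (i j : ℕ) : List (Fin p × Fin q) :=
  ((cyc l hl i).1, (cyc l hl (j + 1)).2) :: arcList l hl (i + 1) (j - i)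

theorem follows_chordFst (hj : j < i + l.length) {a b : Fin p × Fin q} :
    Follows (chordFst l hl i j : Cycle (Fin p × Fin q)) a b →
      (∃ k, j < k ∧ k < i + l.length ∧ a = cyc l hl k ∧ b = cyc l hl (k + 1)) ∨
        a = cyc l hl i ∧ b = cyc l hl (j + 1) := by
  intro h
  obtain ⟨k, hk, h1, h2⟩ := (follows_coe_iff _ _ _).1 h
  simp only [chordFst, length_arcList] at hk h1 h2
  rw [getElem?_arcList hl hk] at h1
  rw [getElem?_arcList hl (Nat.mod_lt _ (by omega))] at h2
  rcases Nat.lt_or_ge (k + 1) (i + l.length - j) with h3 | h3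
  · rw [Nat.mod_eq_of_lt h3] at h2
    exact Or.inl ⟨j + 1 + k, by omega, by omega, (Option.some.inj h1).symm,
      (Option.some.inj h2).symm⟩
  · have h4 : k + 1 = i + l.length - j := by omega
    rw [h4, Nat.mod_self] at h2
    rw [show j + 1 + k = i + l.length by omega, cyc_add_length] at h1
    exact Or.inr ⟨(Option.some.inj h1).symm, (Option.some.inj h2).symm⟩

theorem follows_chordFst_last (hj : j < i + l.length) :
    Follows (chordFst l hl i j : Cycle (Fin p × Fin q)) (cyc l hl i) (cyc l hl (j + 1)) := by
  refine (follows_coe_iff _ _ _).2 ⟨i + l.length - j - 1, by simp [chordFst]; omega, ?_, ?_⟩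
  · rw [chordFst, getElem?_arcList hl (by omega),
      show j + 1 + (i + l.length - j - 1) = i + l.length by omega, cyc_add_length]
  · simp only [chordFst, length_arcList]
    rw [show i + l.length - j - 1 + 1 = i + l.length - j by omega, Nat.mod_self,
      getElem?_arcList hl (by omega), add_zero]

/-- The head of `chordSnd` combines the `X`-agent of index `i` with the `Y`-agent of index `j + 1`,
so only the outer coordinates of a step agree with a step of `ρ`. They are all that matters for
shifted pairs. -/
theorem shifted_chordSnd (hij : i < j) {a b : Fin p × Fin q}
    (h : Follows (chordSnd l hl i j : Cycle (Fin p × Fin q)) a b) :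
    ∃ k, i ≤ k ∧ k ≤ j ∧ a.1 = (cyc l hl k).1 ∧ b.2 = (cyc l hl (k + 1)).2 := by
  obtain ⟨k, hk, h1, h2⟩ := (follows_coe_iff _ _ _).1 h
  have hlen : (chordSnd l hl i j).length = j - i + 1 := by simp [chordSnd]
  rw [hlen] at hk h2
  have ha : a.1 = (cyc l hl (i + k)).1 := by
    rcases k with _ | k
    · simp only [chordSnd, List.getElem?_cons_zero, Option.some.injEq] at h1
      rw [← h1, add_zero]
    · rw [chordSnd, List.getElem?_cons_succ, getElem?_arcList hl (by omega)] at h1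
      rw [← Option.some.inj h1, show i + 1 + k = i + (k + 1) by omega]
  refine ⟨i + k, by omega, by omega, ha, ?_⟩
  rcases Nat.lt_or_ge (k + 1) (j - i + 1) with h3 | h3
  · rw [Nat.mod_eq_of_lt h3, chordSnd, List.getElem?_cons_succ,
      getElem?_arcList hl (by omega)] at h2
    rw [← Option.some.inj h2, show i + 1 + k = i + k + 1 by omega]
  · rw [show k + 1 = j - i + 1 by omega, Nat.mod_self] at h2
    simp only [chordSnd, List.getElem?_cons_zero, Option.some.injEq] at h2
    rw [← h2, show i + k = j by omega]

/-- The chord from `x_i` to `y_{j+1}` bypasses the pairs `i + 1, …, j`. The other pairs with the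
chord form `ρ₁`; the bypassed pairs, joined by the chord as an edge of `M¹`, are all of `M¹ \ M*`,
so there is just one alternating cycle. -/
theorem chord_dissects (hS : T'.Subtable T) (hρ : T'.Exposed M₀ (l : Cycle (Fin p × Fin q)))
    (hi : i < l.length) (hij : i < j) (hj : j < i + l.length)
    (hch : IsChord T (cyc l hl i) (cyc l hl (i + 1)) (cyc l hl j) (cyc l hl (j + 1))) :
    IsRhoCycle T M₀ (l : Cycle (Fin p × Fin q)) (chordFst l hl i j : Cycle (Fin p × Fin q)) ∧
    (chordFst l hl i j : Cycle (Fin p × Fin q)) ≠ (l : Cycle (Fin p × Fin q)) ∧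
    (chordFst l hl i j : Cycle (Fin p × Fin q)) ≠ (chordSnd l hl i j : Cycle (Fin p × Fin q)) ∧
    {σ | IsAltCycle (Rot.elim M₀ (chordFst l hl i j : Cycle (Fin p × Fin q)))
      (Rot.elim M₀ (l : Cycle (Fin p × Fin q))) σ} =
        {(chordSnd l hl i j : Cycle (Fin p × Fin q))} := by
  obtain ⟨hM₀, -, hnd, hρM, hf⟩ := hS.exposed_iff.1 hρ
  have hnd' : l.Nodup := hnd
  have hcM : ∀ k, cyc l hl k ∈ M₀ := fun k => hρM _ (cyc_mem hl k)
  have hcf := fun k => hf _ _ (follows_cyc hl k)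
  have hv : IsRhoCycle T M₀ (l : Cycle (Fin p × Fin q))
      (chordFst l hl i j : Cycle (Fin p × Fin q)) := by
    refine ⟨?_, ?_, ?_, ?_⟩
    · intro h
      have := (follows_chordFst_last (hl := hl) hj).left_mem
      rw [h] at this
      exact Cycle.notMem_nil _ this
    · exact nodup_arcList hl hnd' (by omega)
    · intro a ha
      obtain ⟨k, -, -, rfl⟩ := (mem_arcList hl).1 (Cycle.mem_coe_iff.1 ha)
      exact hcM k
    · intro a b hab
      rcases follows_chordFst hj hab with ⟨k, -, -, rfl, rfl⟩ | ⟨rfl, rfl⟩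
      · exact (isRhoCycle_self hS hρ).2.2.2 _ _ (follows_cyc hl k)
      · refine ⟨?_, _, _, _, _, follows_cyc hl i, follows_cyc hl j, rfl, rfl, hch.1, hch.2.1.le,
          hch.2.2.1.le, hch.2.2.2⟩
        -- A strict inequality of ranks already makes the chord an edge of `T`, since an absent
        -- entry has the largest possible index, the length.
        exact List.idxOf_lt_length_iff.1 (hch.2.1.trans_le List.idxOf_le_length)
  have hout : ∀ k, i < k → k ≤ j → cyc l hl k ∉ chordFst l hl i j := fun k h1 h2 =>
    cyc_notMem_arcList hl hnd' (by omega) (by omega)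
  have hsnd : ∀ k, i < k → k ≤ j → cyc l hl k ∈ chordSnd l hl i j := fun k h1 h2 =>
    List.mem_cons_of_mem _ ((mem_arcList hl).2 ⟨k, by omega, by omega, rfl⟩)
  refine ⟨hv, ?_, ?_, ?_⟩
  · intro h
    have := cyc_mem hl (i + 1)
    rw [← h] at this
    exact hout (i + 1) (by omega) (by omega) this
  · intro h
    have h1 : cyc l hl (i + 1) ∈ (chordSnd l hl i j : Cycle (Fin p × Fin q)) :=
      hsnd (i + 1) (by omega) (by omega)
    rw [← h] at h1
    exact hout (i + 1) (by omega) (by omega) h1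
  set M₁ := Rot.elim M₀ (chordFst l hl i j : Cycle (Fin p × Fin q)) with hM₁
  set Ms := Rot.elim M₀ (l : Cycle (Fin p × Fin q)) with hMsdef
  have memM₁ : ∀ {e}, e ∈ M₁ ↔ (e ∈ M₀ ∧ e ∉ (chordFst l hl i j : Cycle (Fin p × Fin q))) ∨
      e ∈ Rot.shifted (chordFst l hl i j : Cycle (Fin p × Fin q)) :=
    Marriage.mem_elim_iff hM₀.1.2.1 hv.2.2.1
  have memMs : ∀ {e}, e ∈ Ms ↔ (e ∈ M₀ ∧ e ∉ (l : Cycle (Fin p × Fin q))) ∨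
      e ∈ Rot.shifted (l : Cycle (Fin p × Fin q)) := hρ.mem_elim_iff
  obtain ⟨u1, u2⟩ := elim_unique hM₀.1 hv.2.2.1 hv.2.1
  have hMs : T'.IsStable Ms := hρ.isStable_elim
  have hcMs : ∀ k, ((cyc l hl k).1, (cyc l hl (k + 1)).2) ∈ Ms := fun k =>
    memMs.2 (Or.inr ⟨_, _, follows_cyc hl k, rfl⟩)
  have hcM₁ : ∀ k, i < k → k ≤ j → cyc l hl k ∈ M₁ := fun k h1 h2 =>
    memM₁.2 (Or.inl ⟨hcM k, hout k h1 h2⟩)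
  have he₀ : ((cyc l hl i).1, (cyc l hl (j + 1)).2) ∈ M₁ :=
    memM₁.2 (Or.inr ⟨_, _, follows_chordFst_last hj, rfl⟩)
  have hw : IsAltCycle M₁ Ms (chordSnd l hl i j : Cycle (Fin p × Fin q)) := by
    refine ⟨?_, ?_, ?_, ?_⟩
    · intro h
      have h1 : cyc l hl (i + 1) ∈ (chordSnd l hl i j : Cycle (Fin p × Fin q)) :=
        hsnd (i + 1) (by omega) (by omega)
      rw [h] at h1
      exact Cycle.notMem_nil _ h1
    · refine List.nodup_cons.2 ⟨fun h => ?_, nodup_arcList hl hnd' (by omega)⟩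
      obtain ⟨k, -, -, hk⟩ := (mem_arcList hl).1 h
      have h1 := hM₀.1.2.1 _ _ _ (hk ▸ hcM k) (hcM i)
      have h2 := hch.1
      rw [h1] at h2
      exact lt_irrefl _ h2
    · intro e he
      rcases List.mem_cons.1 (Cycle.mem_coe_iff.1 he) with rfl | he
      · refine ⟨he₀, fun h => ?_⟩
        have h1 := hMs.1.2.1 _ _ _ h (hcMs i)
        have h2 := hch.2.1
        rw [h1] at h2
        exact lt_irrefl _ h2
      · obtain ⟨k, h1, h2, rfl⟩ := (mem_arcList hl).1 he
        refine ⟨hcM₁ k (by omega) (by omega), fun h => ?_⟩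
        have h1 : (cyc l hl k).2 = _ := hMs.1.2.1 _ _ _ h (hcMs k)
        have h2 := (hcf k).2.2.1
        rw [h1] at h2
        exact lt_irrefl _ h2
    · rintro _ ⟨a, b, hab, rfl⟩
      obtain ⟨k, h1, h2, h3, h4⟩ := shifted_chordSnd hij hab
      rw [h3, h4]
      refine ⟨hcMs k, fun h => ?_⟩
      rcases h1.eq_or_lt with rfl | h1
      · have h1 := u1 _ _ _ h he₀
        have h2 := hch.2.1
        rw [h1] at h2
        exact lt_irrefl _ h2
      · have h1 := u1 _ _ _ h (hcM₁ k h1 h2)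
        have h2 := (hcf k).2.2.1
        rw [h1] at h2
        exact lt_irrefl _ h2
  ext σ
  simp only [Set.mem_ofPred_eq, Set.mem_singleton_iff]
  refine ⟨fun hσ => ?_, fun h => h ▸ hw⟩
  obtain ⟨e, he⟩ := exists_mem_of_ne_nil hσ.1
  obtain ⟨he₁, hes⟩ := hσ.2.2.1 he
  refine hσ.eq_of_mem u2 hMs.1.2.1 hw he ?_
  rcases memM₁.1 he₁ with ⟨h1, h2⟩ | ⟨a, b, hab, rfl⟩
  · have h3 : e ∈ (l : Cycle (Fin p × Fin q)) := by
      by_contra h3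
      exact hes (memMs.2 (Or.inl ⟨h1, h3⟩))
    obtain ⟨b, hb⟩ := exists_follows_right h3
    obtain ⟨k, hk, rfl, -⟩ := exists_eq_cyc_of_follows hl hb
    have hin : ∀ k', j < k' → k' ≤ i + l.length →
        cyc l hl k' ∈ (chordFst l hl i j : Cycle (Fin p × Fin q)) := fun k' h h' =>
      (mem_arcList hl).2 ⟨k', by omega, by omega, rfl⟩
    rcases Nat.lt_or_ge i k with h4 | h4
    · rcases Nat.lt_or_ge j k with h5 | h5
      · exact absurd (hin k h5 (by omega)) h2
      · exact hsnd k h4 h5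
    · rcases Nat.lt_or_ge j (k + l.length) with h5 | h5
      · exact absurd (cyc_add_length hl k ▸ hin (k + l.length) h5 (by omega)) h2
      · have := hsnd (k + l.length) (by omega) h5
        rwa [cyc_add_length] at this
  · rcases follows_chordFst hj hab with ⟨k, -, -, rfl, rfl⟩ | ⟨rfl, rfl⟩
    · exact absurd (hcMs k) hes
    · exact Cycle.mem_coe_iff.2 (by simp [chordSnd])

/-- With a chord, the algorithm may return the two cycles into which the chord divides `ρ`. -/
theorem dissectRotation_of_chord (hv : ValidInput T T' (l : Cycle (Fin p × Fin q)))
    (hi : i < l.length) (hij : i < j) (hj : j < i + l.length)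
    (hch : IsChord T (cyc l hl i) (cyc l hl (i + 1)) (cyc l hl j) (cyc l hl (j + 1))) :
    (chordFst l hl i j : Cycle (Fin p × Fin q)) ≠ (chordSnd l hl i j : Cycle (Fin p × Fin q)) ∧
    DissectRotation T T' (l : Cycle (Fin p × Fin q))
      {(chordFst l hl i j : Cycle (Fin p × Fin q)),
        (chordSnd l hl i j : Cycle (Fin p × Fin q))} := by
  obtain ⟨hS, hst, hρX⟩ := hv
  obtain ⟨M₀, hbase, hρ⟩ := hst.exists_isBase hρX
  obtain ⟨h1, h2, h3, h4⟩ := chord_dissects hS hρ hi hij hj hch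
  obtain ⟨C, hC⟩ := exists_corresponds (chordFst l hl i j : Cycle (Fin p × Fin q))
  refine ⟨h3, M₀, _, hbase, hρ, rfl, Or.inr ⟨?_, C, _, (isDicycle_iff hS hρ hC).2 h1, hC, h2, ?_⟩⟩
  · rw [existsUnique_isDicycle_iff hS hρ]
    exact fun h => h2 (h _ h1)
  · rw [h4]

/-- Without a chord, the algorithm returns `{ρ}`. -/
theorem dissectRotation_of_no_chord (hv : ValidInput T T' (l : Cycle (Fin p × Fin q)))
    (hno : ∀ i j, i < l.length → i < j → j < i + l.length →
      ¬ IsChord T (cyc l hl i) (cyc l hl (i + 1)) (cyc l hl j) (cyc l hl (j + 1))) :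
    DissectRotation T T' (l : Cycle (Fin p × Fin q)) {(l : Cycle (Fin p × Fin q))} := by
  obtain ⟨hS, hst, hρX⟩ := hv
  obtain ⟨M₀, hbase, hρ⟩ := hst.exists_isBase hρX
  refine ⟨M₀, _, hbase, hρ, rfl, Or.inl ⟨?_, rfl⟩⟩
  rw [existsUnique_isDicycle_iff hS hρ]
  refine fun σ hσ => eq_of_isRhoCycle_of_no_chord hS hρ (fun a b c d hab hcd hch => ?_) hσ
  obtain ⟨i, hi, rfl, rfl⟩ := exists_eq_cyc_of_follows hl hab
  obtain ⟨j, hj, rfl, rfl⟩ := exists_eq_cyc_of_follows hl hcd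
  -- For `i = j` the chord inequalities are contradictory; for `j < i` the index `j` is replaced by
  -- `j + l.length`, so searching `i < j < i + l.length` is enough.
  rcases Nat.lt_trichotomy i j with h | rfl | h
  · exact hno i j hi h (by omega) hch
  · exact lt_irrefl _ hch.2.1
  · refine hno i (j + l.length) hi (by omega) (by omega) ?_
    rwa [show j + l.length + 1 = j + 1 + l.length by omega, cyc_add_length, cyc_add_length]

end Chords

namespace RAM

/-! ## Reasoning about programs -/

/-- Started in `s`, the program `P` halts, and `post` holds for the running time and the final
state. -/
def WP (P : Prog) (post : ℕ → State → Prop) (s : State) : Prop := ∃ t s', Run P s t s' ∧ post t s'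

theorem WP.mono {P : Prog} {post post' : ℕ → State → Prop} {s : State} (h : WP P post s)
    (hp : ∀ t s', post t s' → post' t s') : WP P post' s := by
  obtain ⟨t, s', h1, h2⟩ := h
  exact ⟨t, s', h1, hp t s' h2⟩

theorem WP.skip {post : ℕ → State → Prop} {s : State} (h : post 1 s) : WP .skip post s :=
  ⟨1, s, .skip s, h⟩

theorem WP.assign {v : ℕ} {e : Expr} {post : ℕ → State → Prop} {s : State}
    (h : post (e.cost + 1) (s.setVar v (e.eval s))) : WP (.assign v e) post s :=
  ⟨_, _, .assign v e s, h⟩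

theorem WP.put {a : ℕ} {i j e : Expr} {post : ℕ → State → Prop} {s : State}
    (h : post (i.cost + j.cost + e.cost + 1) (s.setArr a (i.eval s) (j.eval s) (e.eval s))) :
    WP (.put a i j e) post s :=
  ⟨_, _, .put a i j e s, h⟩

theorem WP.seq {P Q : Prog} {post : ℕ → State → Prop} {s : State}
    (h : WP P (fun t s' => WP Q (fun t' s'' => post (t + t' + 1) s'') s') s) :
    WP (.seq P Q) post s := by
  obtain ⟨t, s', h1, t', s'', h2, h3⟩ := h
  exact ⟨_, _, .seq h1 h2, h3⟩

theorem WP.ite {b : Expr} {P Q : Prog} {post : ℕ → State → Prop} {s : State}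
    (h1 : b.eval s ≠ 0 → WP P (fun t s' => post (b.cost + t + 1) s') s)
    (h2 : b.eval s = 0 → WP Q (fun t s' => post (b.cost + t + 1) s') s) :
    WP (.ite b P Q) post s := by
  by_cases hb : b.eval s = 0
  · obtain ⟨t, s', h, hp⟩ := h2 hb
    exact ⟨_, _, .ite_false hb h, hp⟩
  · obtain ⟨t, s', h, hp⟩ := h1 hb
    exact ⟨_, _, .ite_true hb h, hp⟩

/-- A loop with an invariant that is run `n` times. -/
theorem WP.loop {b : Expr} {P : Prog} {post : ℕ → State → Prop} {s : State} (n B : ℕ)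
    (I : ℕ → State → Prop) (h0 : I 0 s)
    (hstep : ∀ k < n, ∀ s, I k s → b.eval s ≠ 0 ∧ WP P (fun t s' => t ≤ B ∧ I (k + 1) s') s)
    (hend : ∀ s, I n s → b.eval s = 0)
    (hpost : ∀ t s', t ≤ n * (b.cost + B + 1) + b.cost + 1 → I n s' → post t s') :
    WP (.loop b P) post s := by
  -- Induction on the number `m` of remaining rounds; the last summands of the bound pay for the
  -- final failing test.
  suffices ∀ m k s, k + m = n → I k s →
      ∃ t s', Run (.loop b P) s t s' ∧ t ≤ m * (b.cost + B + 1) + b.cost + 1 ∧ I n s' by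
    obtain ⟨t, s', h1, h2, h3⟩ := this n 0 s (by omega) h0
    exact ⟨t, s', h1, hpost t s' h2 h3⟩
  intro m
  induction m with
  | zero =>
    intro k s hk hI
    obtain rfl : k = n := by omega
    exact ⟨_, s, .loop_false (hend s hI), by omega, hI⟩
  | succ m ih =>
    intro k s hk hI
    obtain ⟨hb, t, s', h1, h2, h3⟩ := hstep k (by omega) s hI
    obtain ⟨t', s'', h4, h5, h6⟩ := ih (k + 1) s' (by omega) h3
    refine ⟨_, s'', .loop_true hb h1 h4, ?_, h6⟩
    rw [Nat.add_mul]
    omega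

@[simp] theorem setVar_var (s : State) (v k w : ℕ) :
    (s.setVar v k).var w = if w = v then k else s.var w := rfl

@[simp] theorem setVar_arr (s : State) (v k : ℕ) : (s.setVar v k).arr = s.arr := rfl

@[simp] theorem setArr_var (s : State) (a i j k : ℕ) : (s.setArr a i j k).var = s.var := rfl

@[simp] theorem setArr_arr (s : State) (a i j k a' i' j' : ℕ) :
    (s.setArr a i j k).arr a' i' j' =
      if a' = a ∧ i' = i ∧ j' = j then k else s.arr a' i' j' := rfl

theorem row_zero {n : ℕ} (l : List (Fin n)) : row l 0 = l.length := rfl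

theorem row_succ {n : ℕ} {l : List (Fin n)} {k : ℕ} (hk : k < l.length) :
    row l (k + 1) = l[k] := by
  simp [row, hk]

theorem rows_eq {m n : ℕ} (f : Fin m → List (Fin n)) (i : Fin m) (k : ℕ) :
    rows f i k = row (f i) k := by
  simp [rows]

/-! ## Tables of ranks -/

/-- The entry of the rank table: the position plus one, and zero for what is not on the list. -/
def rankVal {n : ℕ} (l : List (Fin n)) (y : Fin n) : ℕ := if y ∈ l then l.idxOf y + 1 else 0

theorem rankVal_append_singleton {n : ℕ} {l : List (Fin n)} {a : Fin n} (ha : a ∉ l) (y : Fin n) :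
    rankVal (l ++ [a]) y = if y = a then l.length + 1 else rankVal l y := by
  by_cases hy : y = a
  · subst hy
    rw [rankVal, List.idxOf_append_of_notMem ha]
    simp
  · by_cases hm : y ∈ l
    · rw [rankVal, List.idxOf_append_of_mem hm]
      simp [hm, hy, rankVal]
    · simp [hm, hy, rankVal]

theorem rankVal_take_succ {n : ℕ} {l : List (Fin n)} (hl : l.Nodup) {k : ℕ} (hk : k < l.length)
    (y : Fin n) :
    rankVal (l.take (k + 1)) y = if y = l[k] then k + 1 else rankVal (l.take k) y := by
  have hnd : (l.take (k + 1)).Nodup := hl.sublist (List.take_sublist _ _)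
  rw [List.take_add_one, List.getElem?_eq_getElem hk, Option.toList_some] at hnd ⊢
  rw [rankVal_append_singleton fun h => (List.nodup_append.1 hnd).2.2 _ h _ (by simp) rfl,
    List.length_take_of_le hk.le]

/-- Writes to the array `dst` the ranks of the lists in the rows of the array `src`, whose number is
in the variable `bnd`. -/
def rankProg (src dst bnd : ℕ) : Prog :=
  .seq (.assign 3 (.lit 0))
    (.loop (.lt (.var 3) (.var bnd))
      (.seq (.assign 4 (.lit 0))
        (.seq
          (.loop (.lt (.var 4) (.get src (.var 3) (.lit 0)))
            (.seq (.put dst (.var 3) (.get src (.var 3) (.succ (.var 4))) (.succ (.var 4)))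
              (.assign 4 (.succ (.var 4)))))
          (.assign 3 (.succ (.var 3))))))

theorem wp_rankProg {src dst bnd m n : ℕ} {f : Fin m → List (Fin n)} (hf : ∀ i, (f i).Nodup)
    (hsd : src ≠ dst) (hb3 : bnd ≠ 3) (hb4 : bnd ≠ 4) {s : State} (hs : s.arr src = rows f)
    (hb : s.var bnd = m) (hd : ∀ i j, s.arr dst i j = 0) :
    WP (rankProg src dst bnd) (fun t s' => t ≤ 100 * (m * (n + 1) + 1) ∧
      (∀ v, v ≠ 3 → v ≠ 4 → s'.var v = s.var v) ∧ (∀ a, a ≠ dst → s'.arr a = s.arr a) ∧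
      ∀ (i : Fin m) (y : Fin n), s'.arr dst i y = rankVal (f i) y) s := by
  apply WP.seq
  apply WP.assign
  -- An inner round costs at most 5 for the test, 18 for the body and 1 for the loop. Rows from `k`
  -- on are still zero, which is the right value for absent entries, so these are never written.
  refine WP.loop m (24 * n + 24) (fun k s' => s'.var 3 = k ∧
    (∀ v, v ≠ 3 → v ≠ 4 → s'.var v = s.var v) ∧ (∀ a, a ≠ dst → s'.arr a = s.arr a) ∧
    (∀ i : Fin m, i.val < k → ∀ y : Fin n, s'.arr dst i y = rankVal (f i) y) ∧
    ∀ i j, k ≤ i → s'.arr dst i j = 0) ?_ ?_ ?_ ?_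
  · refine ⟨by simp [Expr.eval], fun v h3 h4 => by simp [h3], fun a _ => by simp, by simp, ?_⟩
    intro i j _
    exact hd i j
  · rintro k hk s₁ ⟨h1, h2, h3, h4, h5⟩
    refine ⟨by simp [Expr.eval, h1, h2 bnd hb3 hb4, hb, hk], ?_⟩
    apply WP.seq
    apply WP.assign
    apply WP.seq
    have hsrc : ∀ s' : State, s'.arr src = s.arr src → ∀ j, s'.arr src k j = row (f ⟨k, hk⟩) j := by
      intro s' h j
      rw [h, hs]
      exact rows_eq f ⟨k, hk⟩ j
    have hlen : (f ⟨k, hk⟩).length ≤ n := by simpa using (hf ⟨k, hk⟩).length_le_card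
    refine WP.loop (f ⟨k, hk⟩).length 18 (fun t s' => s'.var 3 = k ∧ s'.var 4 = t ∧
      (∀ v, v ≠ 3 → v ≠ 4 → s'.var v = s.var v) ∧ (∀ a, a ≠ dst → s'.arr a = s.arr a) ∧
      (∀ i j, i ≠ k → s'.arr dst i j = s₁.arr dst i j) ∧
      ∀ y : Fin n, s'.arr dst k y = rankVal ((f ⟨k, hk⟩).take t) y) ?_ ?_ ?_ ?_
    · refine ⟨by simp [h1], by simp [Expr.eval], fun v h3 h4 => by simp [h2 v h3 h4, h4],
        fun a ha => by simp [h3 a ha], by simp, fun y => ?_⟩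
      simpa [rankVal] using h5 k y le_rfl
    · rintro t ht s₂ ⟨g1, g2, g3, g4, g5, g6⟩
      refine ⟨by simp [Expr.eval, g1, g2, hsrc s₂ (g4 src hsd), row_zero, ht], ?_⟩
      apply WP.seq
      apply WP.put
      apply WP.assign
      have hv : s₂.arr src k (t + 1) = ((f ⟨k, hk⟩)[t] : Fin n).val := by
        rw [hsrc s₂ (g4 src hsd), row_succ ht]
      refine ⟨by simp [Expr.cost], by simp [g1], by simp [Expr.eval, g2], fun v h3 h4 => ?_,
        fun a ha => ?_, fun i j hi => ?_, fun y => ?_⟩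
      · simp [h4, g3 v h3 h4]
      · funext i j
        simp [ha, g4 a ha]
      · simp [Expr.eval, g1, hi, g5 i j hi]
      · rw [rankVal_take_succ (hf _) ht, ← g6 y]
        simp [Expr.eval, g1, g2, hv, Fin.ext_iff]
    · rintro s₂ ⟨g1, g2, g3, g4, g5, g6⟩
      simp [Expr.eval, g1, g2, hsrc s₂ (g4 src hsd), row_zero]
    · rintro t s₂ ht ⟨g1, g2, g3, g4, g5, g6⟩
      apply WP.assign
      refine ⟨?_, by simp [Expr.eval, g1], fun v h3 h4 => by simp [h3, g3 v h3 h4],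
        fun a ha => by simp [g4 a ha], fun i hi y => ?_, fun i j hi => ?_⟩
      · simp only [Expr.cost] at ht ⊢
        omega
      · rcases Nat.lt_succ_iff_lt_or_eq.1 hi with hi | hi
        · simpa [g5 i y (by omega)] using h4 i hi y
        · obtain rfl : i = ⟨k, hk⟩ := Fin.ext hi
          simpa using g6 y
      · simpa [g5 i j (by omega)] using h5 i j (by omega)
  · rintro s₁ ⟨h1, h2, h3, h4, h5⟩
    simp [Expr.eval, h1, h2 bnd hb3 hb4, hb]
  · rintro t s₁ ht ⟨h1, h2, h3, h4, h5⟩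
    refine ⟨?_, h2, h3, fun i y => h4 i i.2 y⟩
    simp only [Expr.cost] at ht ⊢
    nlinarith

end RAM

namespace RAM

variable {p q : ℕ} {l : List (Fin p × Fin q)} {hl : 0 < l.length}

/-! ## Doubling the input sequence -/

/-- The rows 0 of the arrays 4 and 5 hold the first `N` entries of the periodic continuation of
`l`. -/
def HoldsCyc (A : ℕ → ℕ → ℕ → ℕ) (l : List (Fin p × Fin q)) (hl : 0 < l.length) (N : ℕ) : Prop :=
  ∀ k < N, A 4 0 (k + 1) = (cyc l hl k).1 ∧ A 5 0 (k + 1) = (cyc l hl k).2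

/-- Appends to the rows 0 of the arrays 4 and 5 a copy of themselves. -/
def doubleProg : Prog :=
  .seq (.assign 10 (.get 4 (.lit 0) (.lit 0)))
    (.seq (.assign 3 (.lit 0))
      (.seq (.assign 5 (.var 10))
        (.loop (.lt (.var 3) (.var 10))
          (.seq (.put 4 (.lit 0) (.succ (.var 5)) (.get 4 (.lit 0) (.succ (.var 3))))
            (.seq (.put 5 (.lit 0) (.succ (.var 5)) (.get 5 (.lit 0) (.succ (.var 3))))
              (.seq (.assign 3 (.succ (.var 3)))
                (.assign 5 (.succ (.var 5)))))))))

/-- Chord indices reach `2 * l.length - 1`; the second copy replaces reduction modulo the length. As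
the machine cannot add, variable 5 is incremented in step with variable 3 to hold the shifted index.
-/
theorem wp_doubleProg {s : State} (h0 : s.arr 4 0 0 = l.length)
    (hc : HoldsCyc s.arr l hl l.length) :
    WP doubleProg (fun t s' => t ≤ 50 * (l.length + 1) ∧ s'.var 10 = l.length ∧
      HoldsCyc s'.arr l hl (l.length + l.length) ∧
      ∀ a, a ≠ 4 → a ≠ 5 → s'.arr a = s.arr a) s := by
  apply WP.seq
  apply WP.assign
  apply WP.seq
  apply WP.assign
  apply WP.seq
  apply WP.assign
  refine WP.loop l.length 40 (fun k s' => s'.var 3 = k ∧ s'.var 5 = l.length + k ∧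
    s'.var 10 = l.length ∧ HoldsCyc s'.arr l hl (l.length + k) ∧
    ∀ a, a ≠ 4 → a ≠ 5 → s'.arr a = s.arr a) ?_ ?_ ?_ ?_
  · refine ⟨by simp [Expr.eval], by simp [Expr.eval, h0], by simp [Expr.eval, h0], hc,
      fun a _ _ => rfl⟩
  · rintro k hk s₁ ⟨h1, h2, h3, h4, h5⟩
    refine ⟨by simp [Expr.eval, h1, h3, hk], ?_⟩
    apply WP.seq
    apply WP.put
    apply WP.seq
    apply WP.put
    apply WP.seq
    apply WP.assign
    apply WP.assign
    refine ⟨by simp [Expr.cost], by simp [Expr.eval, h1], by simp [Expr.eval, h2, add_assoc],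
      by simp [h3], ?_, fun a h4 h5' => ?_⟩
    · intro k' hk'
      have hk2 := h4 k (by omega)
      rcases Nat.lt_succ_iff_lt_or_eq.1 (show k' < (l.length + k).succ by omega) with hlt | rfl
      · have hk1 := h4 k' hlt
        simp [Expr.eval, h2, hk1, show k' ≠ l.length + k by omega]
      · rw [Nat.add_comm l.length k, cyc_add_length]
        simp [Expr.eval, h1, h2, hk2, Nat.add_comm k l.length]
    · funext i j
      simp [h4, h5', h5 a h4 h5']
  · rintro s₁ ⟨h1, h2, h3, h4, h5⟩
    simp [Expr.eval, h1, h3]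
  · rintro t s₁ ht ⟨h1, h2, h3, h4, h5⟩
    refine ⟨?_, h3, h4, h5⟩
    simp only [Expr.cost] at ht ⊢
    omega

/-! ## The search for a chord -/

/-- The conjunction of two truth values, of which the first is 0 or 1. -/
def andExpr (e f : Expr) : Expr := .sub e (.sub (.lit 1) f)

theorem andExpr_lt_ne_zero {e e' f : Expr} {s : State} :
    (andExpr (.lt e e') f).eval s ≠ 0 ↔ e.eval s < e'.eval s ∧ f.eval s ≠ 0 := by
  simp only [andExpr, Expr.eval]
  split_ifs <;> omega

theorem lt_ne_zero {e e' : Expr} {s : State} :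
    (Expr.lt e e').eval s ≠ 0 ↔ e.eval s < e'.eval s := by
  simp [Expr.eval]

/-- The `X`-agent with the index `e`. -/
def xAt (e : Expr) : Expr := .get 4 (.lit 0) (.succ e)

/-- The `Y`-agent with the index `e`. -/
def yAt (e : Expr) : Expr := .get 5 (.lit 0) (.succ e)

/-- The test whether the variables 3 and 4 hold the indices of a chord. -/
def chordExpr : Expr :=
  andExpr
    (.lt (.get 8 (xAt (.var 3)) (yAt (.var 3)))
      (.get 8 (xAt (.var 3)) (yAt (.succ (.var 4)))))
    (andExpr
      (.lt (.get 8 (xAt (.var 3)) (yAt (.succ (.var 4))))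
        (.get 8 (xAt (.var 3)) (yAt (.succ (.var 3)))))
      (andExpr
        (.lt (.get 9 (yAt (.succ (.var 4))) (xAt (.var 4)))
          (.get 9 (yAt (.succ (.var 4))) (xAt (.var 3))))
        (.lt (.get 9 (yAt (.succ (.var 4))) (xAt (.var 3)))
          (.get 9 (yAt (.succ (.var 4))) (xAt (.succ (.var 4)))))))

theorem rankVal_lt_iff {n : ℕ} {L : List (Fin n)} {a b : Fin n} (ha : a ∈ L) (hb : b ∈ L) :
    rankVal L a < rankVal L b ↔ L.idxOf a < L.idxOf b := by
  simp [rankVal, ha, hb]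

/-- The two codings differ only on pairs that are not edges, and there both sides fail: `idxOf` is
then maximal and violates the second inequality, `rankVal` is zero and violates the first. -/
theorem isChord_iff_rankVal {T : Marriage p q} {a b c d : Fin p × Fin q} (ha : a ∈ T.edges)
    (hab : (a.1, b.2) ∈ T.edges) (hcd : (c.1, d.2) ∈ T.edges) (hd : d ∈ T.edges) :
    IsChord T a b c d ↔
      rankVal (T.xs a.1) a.2 < rankVal (T.xs a.1) d.2 ∧
      rankVal (T.xs a.1) d.2 < rankVal (T.xs a.1) b.2 ∧
      rankVal (T.ys d.2) c.1 < rankVal (T.ys d.2) a.1 ∧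
      rankVal (T.ys d.2) a.1 < rankVal (T.ys d.2) d.1 := by
  by_cases h : (a.1, d.2) ∈ T.edges
  · rw [rankVal_lt_iff (mem_edges.1 ha) (mem_edges.1 h),
      rankVal_lt_iff (mem_edges.1 h) (mem_edges.1 hab),
      rankVal_lt_iff (mem_edges'.1 hcd) (mem_edges'.1 h),
      rankVal_lt_iff (mem_edges'.1 h) (mem_edges'.1 hd)]
    rfl
  · refine iff_of_false (fun hc => h ?_) (fun hc => ?_)
    · exact List.idxOf_lt_length_iff.1 (hc.2.1.trans_le List.idxOf_le_length)
    · have h1 := hc.1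
      have h2 : rankVal (T.xs a.1) d.2 = 0 := if_neg h
      omega

theorem chordExpr_ne_zero {T : Marriage p q} {s : State} {i j : ℕ}
    (hc : HoldsCyc s.arr l hl (l.length + l.length))
    (h8 : ∀ (x : Fin p) (y : Fin q), s.arr 8 x y = rankVal (T.xs x) y)
    (h9 : ∀ (y : Fin q) (x : Fin p), s.arr 9 y x = rankVal (T.ys y) x)
    (hE : ∀ k, cyc l hl k ∈ T.edges)
    (hE' : ∀ k, ((cyc l hl k).1, (cyc l hl (k + 1)).2) ∈ T.edges)
    (hi : i < l.length) (hj : j < i + l.length) (h3 : s.var 3 = i)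
    (h4 : s.var 4 = j) :
    chordExpr.eval s ≠ 0 ↔
      IsChord T (cyc l hl i) (cyc l hl (i + 1)) (cyc l hl j) (cyc l hl (j + 1)) := by
  obtain ⟨a1, a2⟩ := hc i (by omega)
  obtain ⟨b1, b2⟩ := hc (i + 1) (by omega)
  obtain ⟨c1, c2⟩ := hc j (by omega)
  obtain ⟨d1, d2⟩ := hc (j + 1) (by omega)
  rw [isChord_iff_rankVal (hE i) (hE' i) (hE' j) (hE (j + 1))]
  simp only [chordExpr, andExpr_lt_ne_zero, lt_ne_zero]
  simp only [Expr.eval, xAt, yAt, h3, h4, a1, a2, b2, c1, d1, d2, h8, h9]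

/-- Searches for a chord: the variable 6 tells whether there is one, and the variables 7 and 8 then
hold its indices. -/
def searchProg : Prog :=
  .seq (.assign 3 (.lit 0))
    (.seq (.assign 5 (.var 10))
      (.seq (.assign 6 (.lit 0))
        (.loop (.lt (.var 3) (.var 10))
          (.seq (.assign 4 (.succ (.var 3)))
            (.seq
              (.loop (.lt (.var 4) (.var 5))
                (.seq
                  (.ite chordExpr
                    (.seq (.assign 6 (.lit 1))
                      (.seq (.assign 7 (.var 3))
                        (.seq (.assign 8 (.var 4))
                          (.assign 9 (.var 5)))))
                    .skip)
                  (.assign 4 (.succ (.var 4)))))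
              (.seq (.assign 3 (.succ (.var 3)))
                (.assign 5 (.succ (.var 5)))))))))

theorem wp_searchProg {s : State} {r : ℕ} (h10 : s.var 10 = r) {C : ℕ → ℕ → Prop}
    (hcond : ∀ s' : State, s'.arr = s.arr → ∀ i j, i < r → i < j → j < i + r → s'.var 3 = i →
      s'.var 4 = j → (chordExpr.eval s' ≠ 0 ↔ C i j)) :
    WP searchProg (fun t s' => t ≤ 200 * (r * r + r + 1) ∧ s'.arr = s.arr ∧ s'.var 10 = r ∧
      (s'.var 6 = 0 ∧ (∀ i j, i < r → i < j → j < i + r → ¬ C i j) ∨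
        s'.var 6 = 1 ∧ ∃ i j, i < r ∧ i < j ∧ j < i + r ∧ C i j ∧ s'.var 7 = i ∧ s'.var 8 = j ∧
          s'.var 9 = i + r)) s := by
  set Found : State → Prop := fun s' => s'.var 6 = 1 ∧ ∃ i j, i < r ∧ i < j ∧ j < i + r ∧ C i j ∧
    s'.var 7 = i ∧ s'.var 8 = j ∧ s'.var 9 = i + r with hFound
  apply WP.seq
  apply WP.assign
  apply WP.seq
  apply WP.assign
  apply WP.seq
  apply WP.assign
  refine WP.loop r (150 * r + 20) (fun k s' => s'.arr = s.arr ∧ s'.var 10 = r ∧ s'.var 3 = k ∧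
    s'.var 5 = k + r ∧ (s'.var 6 = 0 ∧ (∀ i j, i < k → i < j → j < i + r → ¬ C i j) ∨ Found s'))
    ?_ ?_ ?_ ?_
  · exact ⟨rfl, by simp [h10], by simp [Expr.eval], by simp [Expr.eval, h10],
      Or.inl ⟨by simp [Expr.eval], by simp⟩⟩
  · rintro k hk s₁ ⟨h1, h2, h3, h4, h5⟩
    refine ⟨by simp [Expr.eval, h2, h3, hk], ?_⟩
    apply WP.seq
    apply WP.assign
    apply WP.seq
    -- The second index runs over `k + 1, …, k + r - 1`. There is no early exit: a later chord
    -- overwrites an earlier one, and any chord is good enough.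
    refine WP.loop (r - 1) 140 (fun t s' => s'.arr = s.arr ∧ s'.var 10 = r ∧ s'.var 3 = k ∧
      s'.var 5 = k + r ∧ s'.var 4 = k + 1 + t ∧
      (s'.var 6 = 0 ∧ (∀ i j, (i < k ∨ i = k ∧ j < k + 1 + t) → i < j → j < i + r → ¬ C i j) ∨
        Found s')) ?_ ?_ ?_ ?_
    · refine ⟨h1, by simp [h2], by simp [h3], by simp [h4], by simp [Expr.eval, h3], ?_⟩
      rcases h5 with ⟨h5, h6⟩ | h5
      · refine Or.inl ⟨by simp [h5], ?_⟩
        rintro i j (hi | ⟨rfl, hj⟩) hij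
        · exact h6 i j hi hij
        · omega
      · right
        simpa [hFound] using h5
    · rintro t ht s₂ ⟨g1, g2, g3, g4, g5, g6⟩
      refine ⟨by simp [Expr.eval, g4, g5]; omega, ?_⟩
      have hC := hcond s₂ g1 k (k + 1 + t) hk (by omega) (by omega) g3 g5
      apply WP.seq
      apply WP.ite
      · intro hb
        apply WP.seq
        apply WP.assign
        apply WP.seq
        apply WP.assign
        apply WP.seq
        apply WP.assign
        apply WP.assign
        apply WP.assign
        refine ⟨by simp [Expr.cost, chordExpr, andExpr, xAt, yAt], g1, by simp [g2], by simp [g3],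
          by simp [g4], by simp [Expr.eval, g5]; omega, Or.inr ?_⟩
        exact ⟨by simp [Expr.eval], k, k + 1 + t, hk, by omega, by omega, hC.1 hb,
          by simp [Expr.eval, g3], by simp [Expr.eval, g5], by simp [Expr.eval, g4]⟩
      · intro hb
        apply WP.skip
        apply WP.assign
        refine ⟨by simp [Expr.cost, chordExpr, andExpr, xAt, yAt], g1, by simp [g2], by simp [g3],
          by simp [g4], by simp [Expr.eval, g5]; omega, ?_⟩
        rcases g6 with ⟨g6, g7⟩ | g6
        · refine Or.inl ⟨by simp [g6], fun i j hor hij hj => ?_⟩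
          by_cases he : i = k ∧ j = k + 1 + t
          · obtain ⟨rfl, rfl⟩ := he
            exact fun hc => absurd hb (hC.2 hc)
          · exact g7 i j (by omega) hij hj
        · right
          simpa [hFound] using g6
    · rintro s₂ ⟨g1, g2, g3, g4, g5, g6⟩
      simp [Expr.eval, g4, g5]; omega
    · rintro t s₂ ht ⟨g1, g2, g3, g4, g5, g6⟩
      apply WP.seq
      apply WP.assign
      apply WP.assign
      refine ⟨?_, g1, by simp [g2], by simp [Expr.eval, g3], by simp [Expr.eval, g4]; omega, ?_⟩
      · simp only [Expr.cost] at ht ⊢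
        omega
      · rcases g6 with ⟨g6, g7⟩ | g6
        · refine Or.inl ⟨by simp [g6], fun i j hi hij hj => g7 i j ?_ hij hj⟩
          omega
        · right
          simpa [hFound] using g6
  · rintro s₁ ⟨h1, h2, h3, h4, h5⟩
    simp [Expr.eval, h2, h3]
  · rintro t s₁ ht ⟨h1, h2, h3, h4, h5⟩
    refine ⟨?_, h1, h2, h5⟩
    simp only [Expr.cost] at ht ⊢
    nlinarith

/-! ## The output -/

/-- Appends to the list in the rows `ro` of the arrays 6 and 7, whose length is in the variable 13,
the entries of the input sequence from the index in the variable 11 up to that in the variable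
12. -/
def copyProg (ro : ℕ) : Prog :=
  .seq
    (.loop (.lt (.var 11) (.var 12))
      (.seq (.put 6 (.lit ro) (.succ (.var 13)) (xAt (.var 11)))
        (.seq (.put 7 (.lit ro) (.succ (.var 13)) (yAt (.var 11)))
          (.seq (.assign 11 (.succ (.var 11)))
            (.assign 13 (.succ (.var 13)))))))
    (.seq (.put 6 (.lit ro) (.lit 0) (.var 13))
      (.put 7 (.lit ro) (.lit 0) (.var 13)))

/-- The rows `ro` of the arrays 6 and 7 hold the entries of `L`. -/
def HoldsEntries (A : ℕ → ℕ → ℕ → ℕ) (ro : ℕ) (L : List (Fin p × Fin q)) : Prop :=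
  ∀ (k : ℕ) (hk : k < L.length), A 6 ro (k + 1) = L[k].1 ∧ A 7 ro (k + 1) = L[k].2

/-- The rows `ro` of the arrays 6 and 7 hold the list `L`. -/
def HoldsList (A : ℕ → ℕ → ℕ → ℕ) (ro : ℕ) (L : List (Fin p × Fin q)) : Prop :=
  A 6 ro 0 = L.length ∧ A 7 ro 0 = L.length ∧ HoldsEntries A ro L

theorem wp_copyProg {s : State} {ro N k n : ℕ} {L : List (Fin p × Fin q)}
    (hc : HoldsCyc s.arr l hl N) (h11 : s.var 11 = k) (h12 : s.var 12 = k + n) (hN : k + n ≤ N)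
    (h13 : s.var 13 = L.length) (hL : HoldsEntries s.arr ro L) :
    WP (copyProg ro) (fun t s' => t ≤ 60 * (n + 1) ∧ HoldsList s'.arr ro (L ++ arcList l hl k n) ∧
      (∀ v, v ≠ 11 → v ≠ 13 → s'.var v = s.var v) ∧
      (∀ a, a ≠ 6 → a ≠ 7 → s'.arr a = s.arr a) ∧
      ∀ a i j, i ≠ ro → s'.arr a i j = s.arr a i j) s := by
  apply WP.seq
  refine WP.loop n 40 (fun t s' => s'.var 11 = k + t ∧ s'.var 13 = L.length + t ∧
    HoldsEntries s'.arr ro (L ++ arcList l hl k t) ∧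
      (∀ v, v ≠ 11 → v ≠ 13 → s'.var v = s.var v) ∧
      (∀ a, a ≠ 6 → a ≠ 7 → s'.arr a = s.arr a) ∧
      ∀ a i j, i ≠ ro → s'.arr a i j = s.arr a i j) ?_ ?_ ?_ ?_
  · exact ⟨h11, h13, by simpa [arcList] using hL, fun _ _ _ => rfl, fun _ _ _ => rfl,
      fun _ _ _ _ => rfl⟩
  · rintro t ht s₁ ⟨g1, g2, g3, g4, g5, g6⟩
    refine ⟨by simp [Expr.eval, g1, g4 12, h12, ht], ?_⟩
    apply WP.seq
    apply WP.put
    apply WP.seq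
    apply WP.put
    apply WP.seq
    apply WP.assign
    apply WP.assign
    refine ⟨by simp [Expr.cost, xAt, yAt], by simp [Expr.eval, g1]; omega,
      by simp [Expr.eval, g2]; omega, ?_, fun v hv hv' => by simp [hv, hv', g4 v hv hv'],
      fun a ha ha' => ?_, fun a i j hi => by simp [Expr.eval, hi, g6 a i j hi]⟩
    · obtain ⟨c1, c2⟩ := hc (k + t) (by omega)
      rw [← g5 4 (by simp) (by simp)] at c1
      rw [← g5 5 (by simp) (by simp)] at c2
      intro k' hk'
      have hlen : (L ++ arcList l hl k (t + 1)).length = L.length + t + 1 := by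
        simp [add_assoc]
      rcases Nat.lt_succ_iff_lt_or_eq.1 (hlen ▸ hk') with hlt | rfl
      · have h1 := g3 k' (by simpa using hlt)
        have h2 : (L ++ arcList l hl k (t + 1))[k'] =
            (L ++ arcList l hl k t)[k']'(by simpa using hlt) := by
          simp only [List.getElem_append]
          split_ifs
          · rfl
          · simp [arcList]
        rw [h2]
        simp [Expr.eval, g2, h1, show k' ≠ L.length + t by omega]
      · have h2 : (L ++ arcList l hl k (t + 1))[L.length + t] = cyc l hl (k + t) := by
          simp [arcList]
        rw [h2]
        simp [Expr.eval, xAt, yAt, g1, g2, c1, c2]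
    · funext i j
      simp [ha, ha', g5 a ha ha']
  · rintro s₁ ⟨g1, g2, g3, g4, g5, g6⟩
    simp [Expr.eval, g1, g4 12, h12]
  · rintro t s₁ ht ⟨g1, g2, g3, g4, g5, g6⟩
    apply WP.seq
    apply WP.put
    apply WP.put
    refine ⟨?_, ⟨?_, ?_, ?_⟩, by simpa using g4, fun a ha ha' => ?_, fun a i j hi => ?_⟩
    · simp only [Expr.cost] at ht ⊢
      omega
    · simp [Expr.eval, g2]
    · simp [Expr.eval, g2]
    · intro k' hk'
      simpa [Expr.eval] using g3 k' hk'
    · funext i j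
      simp [ha, ha', g5 a ha ha']
    · simp [Expr.eval, hi, g6 a i j hi]

/-- Writes the input sequence, or the two parts into which the chord divides it. -/
def outputProg : Prog :=
  .ite (.eq (.var 6) (.lit 0))
    (.seq (.assign 2 (.lit 1))
      (.seq (.assign 11 (.lit 0))
        (.seq (.assign 12 (.var 10))
          (.seq (.assign 13 (.lit 0))
            (copyProg 0)))))
    (.seq (.assign 2 (.lit 2))
      (.seq (.assign 11 (.succ (.var 8)))
        (.seq (.assign 12 (.succ (.var 9)))
          (.seq (.assign 13 (.lit 0))
            (.seq (copyProg 0)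
              (.seq (.put 6 (.lit 1) (.lit 1) (xAt (.var 7)))
                (.seq (.put 7 (.lit 1) (.lit 1) (yAt (.succ (.var 8))))
                  (.seq (.assign 11 (.succ (.var 7)))
                    (.seq (.assign 12 (.succ (.var 8)))
                      (.seq (.assign 13 (.lit 1))
                        (copyProg 1)))))))))))

theorem wp_outputProg_of_no_chord {s : State} (hc : HoldsCyc s.arr l hl (l.length + l.length))
    (h10 : s.var 10 = l.length) (h6 : s.var 6 = 0) :
    WP outputProg (fun t s' => t ≤ 300 * (l.length + 1) ∧ s'.var 2 = 1 ∧
      HoldsList s'.arr 0 (arcList l hl 0 l.length)) s := by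
  apply WP.ite
  swap
  · intro hb
    simp [Expr.eval, h6] at hb
  intro _
  apply WP.seq
  apply WP.assign
  apply WP.seq
  apply WP.assign
  apply WP.seq
  apply WP.assign
  apply WP.seq
  apply WP.assign
  refine (wp_copyProg (l := l) (hl := hl) (N := l.length + l.length) (L := []) (k := 0)
    (n := l.length) (by exact hc) (by simp [Expr.eval]) (by simp [Expr.eval, h10])
    (by omega) (by simp [Expr.eval]) (fun k hk => by simp at hk)).mono ?_
  rintro t s' ⟨h1, h2, h3, -⟩
  refine ⟨?_, by simp [h3 2, Expr.eval], by simpa using h2⟩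
  simp only [Expr.cost]
  omega

/-- Variable 9 keeps `i + l.length` from the search, because the sum could not be formed in one step
here. The first part is read up to that index, which still lies in the doubled sequence. -/
theorem wp_outputProg_of_chord {s : State} {i j : ℕ}
    (hc : HoldsCyc s.arr l hl (l.length + l.length)) (h6 : s.var 6 = 1) (hi : i < l.length)
    (hij : i < j) (hj : j < i + l.length) (h7 : s.var 7 = i) (h8 : s.var 8 = j)
    (h9 : s.var 9 = i + l.length) :
    WP outputProg (fun t s' => t ≤ 300 * (l.length + 1) ∧ s'.var 2 = 2 ∧
      HoldsList s'.arr 0 (chordFst l hl i j) ∧ HoldsList s'.arr 1 (chordSnd l hl i j)) s := by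
  apply WP.ite
  · intro hb
    simp [Expr.eval, h6] at hb
  intro _
  apply WP.seq
  apply WP.assign
  apply WP.seq
  apply WP.assign
  apply WP.seq
  apply WP.assign
  apply WP.seq
  apply WP.assign
  apply WP.seq
  refine (wp_copyProg (l := l) (hl := hl) (N := l.length + l.length) (L := []) (k := j + 1)
    (n := i + l.length - j) (by exact hc) (by simp [Expr.eval, h8])
    (by simp [Expr.eval, h9]; omega) (by omega) (by simp [Expr.eval])
    (fun k hk => by simp at hk)).mono ?_
  rintro t s₁ ⟨h1, h2, h3, h4, -⟩
  have e7 : s₁.var 7 = i := by rw [h3 7 (by simp) (by simp)]; simp [h7]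
  have e8 : s₁.var 8 = j := by rw [h3 8 (by simp) (by simp)]; simp [h8]
  have e2 : s₁.var 2 = 2 := by rw [h3 2 (by simp) (by simp)]; simp [Expr.eval]
  have hc₁ : HoldsCyc s₁.arr l hl (l.length + l.length) := by
    intro k hk
    rw [h4 4 (by simp) (by simp), h4 5 (by simp) (by simp)]
    exact hc k hk
  obtain ⟨c1, -⟩ := hc₁ i (by omega)
  obtain ⟨-, c2⟩ := hc₁ (j + 1) (by omega)
  apply WP.seq
  apply WP.put
  apply WP.seq
  apply WP.put
  apply WP.seq
  apply WP.assign
  apply WP.seq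
  apply WP.assign
  apply WP.seq
  apply WP.assign
  -- The chord pair has just been written as entry 1, so copying resumes from a list of length one.
  refine (wp_copyProg (L := [((cyc l hl i).1, (cyc l hl (j + 1)).2)]) (l := l) (hl := hl)
    (N := l.length + l.length) (k := i + 1) (n := j - i) ?_ (by simp [Expr.eval, e7])
    (by simp [Expr.eval, e8]; omega) (by omega) (by simp [Expr.eval]) ?_).mono ?_
  · intro k hk
    simpa [Expr.eval] using hc₁ k hk
  · intro k hk
    obtain rfl : k = 0 := by simpa using hk
    simp [Expr.eval, xAt, yAt, e7, e8, c1, c2]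
  · rintro t' s₂ ⟨g1, g2, g3, -, g5⟩
    refine ⟨?_, by simp [g3 2, e2], ?_, g2⟩
    · simp only [Expr.cost, xAt, yAt]
      omega
    · obtain ⟨k1, k2, k3⟩ := h2
      refine ⟨?_, ?_, fun k hk => ?_⟩
      · rw [g5 6 0 0 (by simp)]
        simpa [Expr.eval, chordFst] using k1
      · rw [g5 7 0 0 (by simp)]
        simpa [Expr.eval, chordFst] using k2
      · rw [g5 6 0 _ (by simp), g5 7 0 _ (by simp)]
        simpa [Expr.eval, chordFst] using k3 k hk

end RAM

namespace RAM

variable {p q : ℕ} {l : List (Fin p × Fin q)} {hl : 0 < l.length}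

/-! ## The program for the algorithm -/

/-- The program that carries out the algorithm. -/
def dissectProg : Prog :=
  .seq (rankProg 0 8 0) (.seq (rankProg 1 9 1) (.seq doubleProg (.seq searchProg outputProg)))

theorem HoldsList.row_eq {A : ℕ → ℕ → ℕ → ℕ} {ro : ℕ} {L : List (Fin p × Fin q)}
    (h : HoldsList A ro L) {k : ℕ} (hk : k ≤ L.length) :
    A 6 ro k = row (L.map Prod.fst) k ∧ A 7 ro k = row (L.map Prod.snd) k := by
  obtain ⟨h1, h2, h3⟩ := h
  rcases k with _ | k
  · rw [row_zero, row_zero]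
    simp [h1, h2]
  · rw [row_succ (by simpa using hk), row_succ (by simpa using hk)]
    simpa using h3 k hk

theorem arcList_zero_length : arcList l hl 0 l.length = l := by
  apply List.ext_getElem (by simp)
  intro k h1 h2
  simp [arcList, cyc_eq_getElem hl h2]

theorem holdsCyc_input (T T' : Marriage p q) : HoldsCyc (input T T' l).arr l hl l.length := by
  intro k hk
  rw [cyc_eq_getElem hl hk]
  have h1 := rows_eq (fun _ : Fin 1 => l.map Prod.fst) 0 (k + 1)
  have h2 := rows_eq (fun _ : Fin 1 => l.map Prod.snd) 0 (k + 1)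
  rw [row_succ (by simpa using hk)] at h1 h2
  exact ⟨by simpa [input] using h1, by simpa [input] using h2⟩

/-- The left side adds up the bounds for the five program parts and their sequencing steps.
Positivity of `r` gives `1 ≤ p`, which absorbs the linear and constant terms into the square. -/
theorem time_bound {p q r : ℕ} (hr : 0 < r) (hrp : r ≤ p) :
    100 * (p * (q + 1) + 1) + (100 * (q * (p + 1) + 1) + (50 * (r + 1) +
      (200 * (r * r + r + 1) + 300 * (r + 1) + 1) + 1) + 1) + 1 ≤ 3000 * (p + q) ^ 2 := by
  have h1 : r * r ≤ p * p := Nat.mul_le_mul hrp hrp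
  have h2 : p ≤ p * p := Nat.le_mul_of_pos_left p (by omega)
  have h3 : q ≤ p * q := Nat.le_mul_of_pos_left q (by omega)
  nlinarith

theorem length_le_of_exposed {T : Marriage p q} {M : Set (Fin p × Fin q)}
    (h : T.Exposed M (l : Cycle (Fin p × Fin q))) : l.length ≤ p := by
  have hnd : (l.map Prod.fst).Nodup := by
    refine List.Nodup.map_on (fun a ha b hb hab => ?_) h.2.2.1
    exact h.1.1.eq_of_fst_eq (h.2.2.2.1 a ha) (h.2.2.2.1 b hb) hab
  simpa using hnd.length_le_card

/-- The program reads only the lists of `T` and the sequence `ρ`; the table `T'` and the matching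
`M⁰` enter through the validity of the input, which guarantees that the chord test decides step 4 of
the algorithm. -/
theorem wp_dissectProg {T T' : Marriage p q} (hv : ValidInput T T' (l : Cycle (Fin p × Fin q))) :
    WP dissectProg (fun t s => t ≤ 3000 * (p + q) ^ 2 ∧
      ∃ R, Outputs s R ∧ DissectRotation T T' (l : Cycle (Fin p × Fin q)) R) (input T T' l) := by
  obtain ⟨hS, -, M, hM⟩ := id hv
  have hl : 0 < l.length := by
    refine List.length_pos_iff.2 fun h => hM.2.1 ?_
    rw [h]
    rfl
  have hrp := length_le_of_exposed hM
  have hE : ∀ k, cyc l hl k ∈ T.edges := fun k =>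
    hS.edges_subset (hM.mem_edges_E (Or.inl (cyc_mem hl k)))
  have hE' : ∀ k, ((cyc l hl k).1, (cyc l hl (k + 1)).2) ∈ T.edges := fun k =>
    hS.edges_subset (hM.mem_edges_E (Or.inr ⟨_, _, follows_cyc hl k, rfl⟩))
  apply WP.seq
  refine (wp_rankProg (f := T.xs) T.xs_nodup (by simp) (by simp) (by simp) rfl rfl
    (fun _ _ => rfl)).mono ?_
  rintro t₁ s₁ ⟨ht₁, v₁, a₁, r₁⟩
  apply WP.seq
  refine (wp_rankProg (f := T.ys) (s := s₁) T.ys_nodup (by simp) (by simp) (by simp)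
    (by rw [a₁ 1 (by simp)]; rfl) (by rw [v₁ 1 (by simp) (by simp)]; rfl)
    (fun i j => by rw [a₁ 9 (by simp)]; rfl)).mono ?_
  rintro t₂ s₂ ⟨ht₂, -, a₂, r₂⟩
  have harr : ∀ a, a ≠ 8 → a ≠ 9 → s₂.arr a = (input T T' l).arr a := fun a h8 h9 =>
    (a₂ a h9).trans (a₁ a h8)
  apply WP.seq
  refine (wp_doubleProg (l := l) (hl := hl) (s := s₂) ?_ ?_).mono ?_
  · rw [harr 4 (by simp) (by simp)]
    simp [input, rows, row]
  · intro k hk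
    rw [harr 4 (by simp) (by simp), harr 5 (by simp) (by simp)]
    exact holdsCyc_input T T' k hk
  rintro t₃ s₃ ⟨ht₃, h10, hc, a₃⟩
  have h8 : ∀ (x : Fin p) (y : Fin q), s₃.arr 8 x y = rankVal (T.xs x) y := fun x y => by
    rw [a₃ 8 (by simp) (by simp), a₂ 8 (by simp), r₁]
  have h9 : ∀ (y : Fin q) (x : Fin p), s₃.arr 9 y x = rankVal (T.ys y) x := fun y x => by
    rw [a₃ 9 (by simp) (by simp), r₂]
  apply WP.seq
  refine (wp_searchProg (s := s₃) h10 (C := fun i j =>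
    IsChord T (cyc l hl i) (cyc l hl (i + 1)) (cyc l hl j) (cyc l hl (j + 1))) ?_).mono ?_
  · intro s' h i j hi hij hj h3 h4
    exact chordExpr_ne_zero (by rwa [h]) (by rwa [h]) (by rwa [h]) hE hE' hi hj h3 h4
  have hbound := time_bound (q := q) hl hrp
  rintro t₄ s₄ ⟨ht₄, a₄, h10', ⟨h6, hno⟩ | ⟨h6, i, j, hi, hij, hj, hch, h7, h8', h9'⟩⟩
  · refine (wp_outputProg_of_no_chord (l := l) (hl := hl) (by rwa [a₄]) h10' h6).mono ?_
    rintro t₅ s₅ ⟨ht₅, h2, hL⟩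
    rw [arcList_zero_length] at hL
    refine ⟨by omega, _, ⟨[l], by simp, by simp, h2, ?_⟩, dissectRotation_of_no_chord hv hno⟩
    intro j hj k hk
    obtain rfl : j = 0 := by simpa using hj
    exact hL.row_eq hk
  · refine (wp_outputProg_of_chord (l := l) (hl := hl) (by rwa [a₄]) h6 hi hij hj h7 h8'
      h9').mono ?_
    rintro t₅ s₅ ⟨ht₅, h2, hL, hL'⟩
    obtain ⟨hne, hd⟩ := dissectRotation_of_chord hv hi hij hj hch
    refine ⟨by omega, _, ⟨[chordFst l hl i j, chordSnd l hl i j], by simpa using hne,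
      by simp, h2, ?_⟩, hd⟩
    intro m hm k hk
    obtain rfl | rfl : m = 0 ∨ m = 1 := by simp at hm; omega
    · exact hL.row_eq hk
    · exact hL'.row_eq hk

end RAM

/-- Dissect_Rotation always returns, and whatever it returns is a correct answer to `DR(T, T', ρ)`;
and it can be carried out by one fixed program in time `O(n²)`, where `n = p + q` is the number of
agents. -/
theorem mainTheorem3 :
    (∀ (p q : ℕ) (T T' : Marriage p q) (ρ : Rot p q), ValidInput T T' ρ →
      (∃ R, DissectRotation T T' ρ R) ∧ ∀ R, DissectRotation T T' ρ R → SolvesDR T T' ρ R) ∧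
    (∃ (P : RAM.Prog) (c : ℕ), ∀ (p q : ℕ) (T T' : Marriage p q) (l : List (Fin p × Fin q)),
      ValidInput T T' (l : Cycle (Fin p × Fin q)) →
      ∃ (t : ℕ) (s : RAM.State) (R : Set (Rot p q)),
        RAM.Run P (RAM.input T T' l) t s ∧ t ≤ c * (p + q) ^ 2 ∧ RAM.Outputs s R ∧
          DissectRotation T T' (l : Cycle (Fin p × Fin q)) R ∧
          SolvesDR T T' (l : Cycle (Fin p × Fin q)) R) := by
  refine ⟨fun p q T T' ρ hv => ⟨exists_dissectRotation hv, fun R h => h.solvesDR hv⟩,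
    RAM.dissectProg, 3000, fun p q T T' l hv => ?_⟩
  obtain ⟨t, s, hrun, ht, R, hR, hd⟩ := RAM.wp_dissectProg hv
  exact ⟨t, s, R, hrun, ht, hR, hd, hd.solvesDR hv⟩
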